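/- **Setting.** Let $\chi$ be a real primitive Dirichlet character modulo $D$. Put $\mathcal L=\log D$, $Q=\exp(\mathcal L^2)$, $\alpha=\mathcal L^{-2}$, $R=\pi\left[\frac{\log\mathcal L}{30\pi}\right]-\frac{\pi}{2}$ ($[\cdot]$ is the integral part), $\omega=\alpha R$, $\delta=R^{-9/10}$, $\delta_1=R^{-8/9}$, $s_0=\frac12+iD$. Fix a real constant $d\ge 425$ and a constant $K$, and let $\varepsilon$ be a real number with $$|\varepsilon-R^{-11/12}|\le K R^{-1},\qquad \varepsilon R\equiv 0\ (\mathrm{mod}\ 2\pi).$$ **Characters.** Let $\Psi$ be the set of all primitive characters $\psi$ modulo $q$, where $q$ runs over the square-free integers with $Q<q<2Q$ and $(q,6)=1$, such that $\psi\chi$ is a primitive character modulo $[q,D]$. Define $\nu(n)$, $\upsilon(n)$ by $\sum\nu(n)n^{-s}=\zeta(s)L(s,\chi)$, $\sum\upsilon(n)n^{-s}=\zeta(s)^{-1}L(s,\chi)^{-1}$, and put $$F(s,\psi)=\sum_{n\le D^5}\frac{\nu(n)\psi(n)}{n^s},\qquad G(s,\psi)=\sum_{n\le D^5}\frac{\upsilon(n)\psi(n)}{n^s}.$$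 For a primitive character $\theta$ let $\Delta(s,\theta)$ be the meromorphic function $L(s,\theta)/L(1-s,\bar\theta)$; let $\Delta_1(s,\psi)=\Delta(s,\psi)\Delta(s,\psi\chi)$ and $\mathcal F(s,\psi)=F(s,\psi)+\Delta_1(s,\psi)F(1-s,\bar\psi)$. Let $$\Omega_1=\{s:-2\alpha^{1/2}<\Re(s-s_0)<1,\ |\Im(s-s_0)|<1+20\mathcal L\},$$ $$\Omega_2=\{s:-\tfrac1{10}\alpha\log\mathcal L<\Re(s-s_0)<\tfrac12,\ |\Im(s-s_0)|<1+10\mathcal L\}.$$ Let $\Psi^*$ be the set of $\psi\in\Psi$ with $$\sup_{\Omega_1}\big(|F(s,\psi)|+|G(s,\psi)|\big)<\mathcal L^3\log\mathcal L,\qquad \sup_{\Omega_1}|F(s,\psi)G(s,\psi)-1|<\tfrac12,$$ $$\sup_{\Omega_2}|L(s,\psi)L(s,\psi\chi)-\mathcal F(s,\psi)|<\mathcal L^{-24/5}.$$ For $\psi\in\Psi^*$ let $S(\psi)$ be the set of zeros of $L(s,\psi)L(s,\psi\chi)$ in the strip $|\Im s-D|<1$. **Weights.** Let $$\vartheta(x)=\frac1{2\pi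 i}\int_{(1)}x^s\,\frac{5\alpha(Q^{s/10}-Q^{-s/10})e^{s^2/4}}{s^2}\,ds\quad(x>0),\qquad \varpi_1(x)=\delta^{3-d}(1+\delta-x^2)^d,$$ and define $\lambda_\pm(n)$ by $\sum\lambda_\pm(n)n^{-s}=\zeta(s\pm\alpha)/\zeta(s\mp\alpha)$. Let $$U_\pm(x)=\frac1{2\pi i}\int_{\mathcal C_\pm}\frac{Q^{xs}}{s}\,ds,$$ where $\mathcal C_+$ is the right half of the circle $|s|=\omega$ from $-i\omega$ to $i\omega$ and $\mathcal C_-$ its left half from $i\omega$ to $-i\omega$. Let $$X_+(x)=\frac{\sin(Rx)}{\pi x}+\frac{\sin(R(2+x))}{\pi e^2(2+x)},\qquad X_-(x)=\frac{\sin(Rx)}{\pi e^2x}+\frac{\sin(R(-2+x))}{\pi(-2+x)}.$$ **The quantity $\mathcal E$.** For $0\le a\le b$ put $$\mathcal U_+(a,b;s,\psi)=\sum_{Q^a<n\le Q^b}\frac{\lambda_+(n)\psi(n)}{n^s}\vartheta\Big(\frac{Q^{4/3}}n\Big),\qquad \mathcal U_-(a,b;s,\psi)=\sum_{Q^a<n\le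 Q^b}\frac{\lambda_-(n)\psi(n)}{n^s}\vartheta\Big(\frac{Q^{2/3}}n\Big),$$ $$\Upsilon_\pm(\rho,\psi)=|\mathcal U_\pm(0,\delta_1;\rho,\psi)|^2+|\mathcal U_\pm(\delta_1,1;\rho,\psi)|^2+\int_0^{\delta_1}\frac{|\mathcal U_\pm(0,y;\rho,\psi)|^2}{\varpi_1(1-y)}\,dy+\int_{\delta_1}^1|\mathcal U_\pm(\delta_1,y;\rho,\psi)|^2\,dy,$$ $$\Upsilon^*(\rho,\psi)=\varepsilon^{-2}|\mathcal U_+(0,\varepsilon;\rho,\psi)|^2+|\mathcal U_+(1,\tfrac32;\rho,\psi)|^2+\int_0^{1/2}|\mathcal U_+(1+y,\tfrac32;\rho,\psi)|^2\,dy,$$ and $\Upsilon=\Upsilon_++\Upsilon_-+\Upsilon^*$. Put $$\mathcal X_+(z;s,\psi)=\sum_{1<n\le Q^{3/2}}\frac{\lambda_-(n)\psi(n)}{n^s}\vartheta\Big(\frac{Q^{4/3}}n\Big)X_+(z-\alpha\log n),$$ $$\mathcal X_-(z;s,\psi)=\sum_{1<n\le Q}\frac{\lambda_+(n)\psi(n)}{n^s}\vartheta\Big(\frac{Q^{2/3}}n\Big)X_-(z+\alpha\log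 n),$$ $$\mathcal E_1(\rho,\psi)=\int_{1-2\delta_1}^{1}\big\{|\mathcal X_+(1+\varepsilon-y;\rho,\psi)|^2+|\mathcal X_-(1+\varepsilon-y;1-\rho,\bar\psi)|^2\big\}dy$$ $$\qquad+\int_{-1}^{-1+2\delta_1}\big\{|\mathcal X_+(-1+\varepsilon-y;\rho,\psi)|^2+|\mathcal X_-(-1+\varepsilon-y;1-\rho,\bar\psi)|^2\big\}dy.$$ Put $$\mathcal Y_1(s,\psi)=\sum_{1<n\le Q^{3/2}}\frac{\lambda_-(n)\psi(n)}{n^s}\vartheta\Big(\frac{Q^{4/3}}n\Big)U_+(\varepsilon-\alpha\log n),\quad \mathcal Y_2(s,\psi)=\sum_{n\le Q}\frac{\lambda_+(n)\psi(n)}{n^s}\vartheta\Big(\frac{Q^{2/3}}n\Big)U_+(-2+\varepsilon+\alpha\log n),$$ $$\mathcal Y_3(s,\psi)=\sum_{n\le Q^{3/2}}\frac{\lambda_-(n)\psi(n)}{n^s}\vartheta\Big(\frac{Q^{4/3}}n\Big)U_-(2+\varepsilon-\alpha\log n),\quad \mathcal Y_4(s,\psi)=\sum_{1<n\le Q}\frac{\lambda_+(n)\psi(n)}{n^s}\vartheta\Big(\frac{Q^{2/3}}n\Big)U_-(\varepsilon+\alpha\log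 n),$$ $$\mathcal E_2(\rho,\psi)=\varepsilon^{-1}\big[|\mathcal Y_1(\rho,\psi)|^2+|\mathcal Y_2(1-\rho,\bar\psi)|^2+|\mathcal Y_3(\rho,\psi)|^2+|\mathcal Y_4(1-\rho,\bar\psi)|^2\big].$$ Finally let $$\mathcal E(\rho,\psi)=\frac{\Upsilon(\rho,\psi)}{R^{1/12}\log R}+\mathcal E_1(\rho,\psi)+\mathcal E_2(\rho,\psi),\qquad \mathcal E=\sum_{\psi\in\Psi^*}\ \sum_{\rho\in S(\psi)}\mathcal E(\rho,\psi).$$ **Proposition 12.3.** For all constants $d\ge 425$ and $K$ there are constants $C$ and $D_0$, depending only on $d$ and $K$, such that for every $D\ge D_0$, every real primitive character $\chi$ modulo $D$ and every $\varepsilon$ as above, the set $\Psi^*$ and all the sets $S(\psi)$, $\psi\in\Psi^*$, are finite, and $$\mathcal E\le C\,\mathcal L^2Q^2R^{-1/12}(\log R)^{-1}.$$ -/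

import Mathlib

open Complex

noncomputable section

namespace LandauSiegel

instance neZeroLcm {m n : ℕ} [NeZero m] [NeZero n] : NeZero (Nat.lcm m n) :=
  ⟨Nat.lcm_ne_zero (NeZero.ne m) (NeZero.ne n)⟩

/-! ## Parameters -/

/-- `𝓛 = log D`. -/
def logD (D : ℕ) : ℝ := Real.log D

/-- `Q = exp (𝓛²)`. -/
def Q (D : ℕ) : ℝ := Real.exp (logD D ^ 2)

/-- `α = 𝓛⁻² = (log Q)⁻¹`. -/
def alpha (D : ℕ) : ℝ := (logD D ^ 2)⁻¹

/-- `R = π [log 𝓛 / (30 π)] - π / 2`, with `[·]` the integral part. -/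
def R (D : ℕ) : ℝ :=
  Real.pi * (⌊Real.log (logD D) / (30 * Real.pi)⌋ : ℝ) - Real.pi / 2

/-- `ω = α R`. -/
def omega (D : ℕ) : ℝ := alpha D * R D

/-- `δ = R ^ (-9/10)`. -/
def delta (D : ℕ) : ℝ := R D ^ (-(9 / 10) : ℝ)

/-- `δ₁ = R ^ (-8/9)`. -/
def delta1 (D : ℕ) : ℝ := R D ^ (-(8 / 9) : ℝ)

/-- `s₀ = 1/2 + i D`. -/
def s0 (D : ℕ) : ℂ := 1 / 2 + I * D

/-! ## Arithmetic functions -/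

/-- The coefficients of `ζ(s) L(s, χ)`. -/
def nu {D : ℕ} (χ : DirichletCharacter ℂ D) (n : ℕ) : ℂ :=
  ∑ p ∈ n.divisorsAntidiagonal, χ (p.2 : ZMod D)

/-- The coefficients of `ζ(s)⁻¹ L(s, χ)⁻¹`. -/
def upsilon {D : ℕ} (χ : DirichletCharacter ℂ D) (n : ℕ) : ℂ :=
  ∑ p ∈ n.divisorsAntidiagonal,
    (ArithmeticFunction.moebius p.1 : ℂ) *
      ((ArithmeticFunction.moebius p.2 : ℂ) * χ (p.2 : ZMod D))

/-- The coefficients of `ζ(s + a) / ζ(s - a)`. -/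
def zetaQuotCoeff (a : ℝ) (n : ℕ) : ℝ :=
  ∑ p ∈ n.divisorsAntidiagonal,
    (p.1 : ℝ) ^ (-a) * ((ArithmeticFunction.moebius p.2 : ℝ) * (p.2 : ℝ) ^ a)

/-- `λ₊`: the coefficients of `ζ(s + α) / ζ(s - α)`. -/
def lamPlus (D n : ℕ) : ℝ := zetaQuotCoeff (alpha D) n

/-- `λ₋`: the coefficients of `ζ(s - α) / ζ(s + α)`. -/
def lamMinus (D n : ℕ) : ℝ := zetaQuotCoeff (-alpha D) n

theorem LSeries_zetaQuot (a : ℝ) {s : ℂ} (hs : 1 + |a| < s.re) :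
    LSeries (fun n => (zetaQuotCoeff a n : ℂ)) s = riemannZeta (s + a) / riemannZeta (s - a) := by
  have ha := abs_le.mp (le_refl |a|)
  have h1 : 1 < (s + a).re := by simp; linarith
  have h2 : 1 < (s - a).re := by simp; linarith
  have t1 : ∀ n, LSeries.term (fun n : ℕ => ((n : ℝ) ^ (-a) : ℝ) : ℕ → ℂ) s n = LSeries.term 1 (s + a) n := by
    intro n
    rcases eq_or_ne n 0 with rfl | hn
    · simp
    · have : (n:ℂ) ≠ 0 := by exact_mod_cast hn
      rw [LSeries.term_of_ne_zero hn, LSeries.term_of_ne_zero hn, Complex.ofReal_cpow (by positivity)]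
      push_cast
      rw [Complex.cpow_neg, Complex.cpow_add _ _ this]; simp [div_eq_mul_inv, mul_comm]
  have t2 : ∀ n, LSeries.term (fun n : ℕ => (ArithmeticFunction.moebius n : ℂ) * (((n:ℝ) ^ a : ℝ) : ℂ)) s n = LSeries.term (fun n => (ArithmeticFunction.moebius n : ℂ)) (s - a) n := by
    intro n
    rcases eq_or_ne n 0 with rfl | hn
    · simp
    · have : (n:ℂ) ≠ 0 := by exact_mod_cast hn
      rw [LSeries.term_of_ne_zero hn, LSeries.term_of_ne_zero hn, Complex.ofReal_cpow (by positivity)]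
      push_cast
      rw [Complex.cpow_sub _ _ this]; field_simp
  have e1 : LSeries (fun n : ℕ => ((n : ℝ) ^ (-a) : ℝ) : ℕ → ℂ) s = riemannZeta (s + a) := by
    rw [← LSeries_one_eq_riemannZeta h1]; exact tsum_congr t1
  have e2 : LSeries (fun n : ℕ => (ArithmeticFunction.moebius n : ℂ) * (((n:ℝ) ^ a : ℝ) : ℂ)) s = (riemannZeta (s - a))⁻¹ := by
    rw [← LSeries_one_eq_riemannZeta h2]
    refine eq_inv_of_mul_eq_one_right ((congrArg _ (tsum_congr t2)).trans ?_)
    exact LSeries_one_mul_Lseries_moebius h2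
  have s1 : LSeriesSummable (fun n : ℕ => ((n : ℝ) ^ (-a) : ℝ) : ℕ → ℂ) s := by
    unfold LSeriesSummable; rw [funext t1]; exact LSeriesSummable_one_iff.mpr h1
  have s2 : LSeriesSummable (fun n : ℕ => (ArithmeticFunction.moebius n : ℂ) * (((n:ℝ) ^ a : ℝ) : ℂ)) s := by
    unfold LSeriesSummable; rw [funext t2]; exact ArithmeticFunction.LSeriesSummable_moebius_iff.mpr h2
  rw [div_eq_mul_inv, ← e1, ← e2, ← LSeries_convolution' s1 s2]
  congr 1
  ext n
  simp [zetaQuotCoeff, LSeries.convolution_def]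

theorem LSeries_nu {D : ℕ} (χ : DirichletCharacter ℂ D) {s : ℂ} (hs : 1 < s.re) :
    LSeries (nu χ) s = riemannZeta s * LSeries (fun n => χ (n : ZMod D)) s := by
  rw [← LSeries_one_eq_riemannZeta hs, ← LSeries_convolution' (LSeriesSummable_one_iff.mpr hs)
    (χ.LSeriesSummable_of_one_lt_re hs)]
  congr 1
  ext n
  simp [nu, LSeries.convolution_def]

theorem LSeries_upsilon {D : ℕ} (χ : DirichletCharacter ℂ D) {s : ℂ} (hs : 1 < s.re) :
    LSeries (upsilon χ) s =
      (riemannZeta s)⁻¹ * (LSeries (fun n => χ (n : ZMod D)) s)⁻¹ := by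
  have h1 := LSeries_one_mul_Lseries_moebius hs
  have h2 := DirichletCharacter.LSeries.mul_mu_eq_one χ hs
  rw [← LSeries_one_eq_riemannZeta hs, ← eq_inv_of_mul_eq_one_right h1,
    ← eq_inv_of_mul_eq_one_right h2, ← LSeries_convolution'
      (ArithmeticFunction.LSeriesSummable_moebius_iff.mpr hs)
      (χ.LSeriesSummable_mul (ArithmeticFunction.LSeriesSummable_moebius_iff.mpr hs))]
  congr 1
  ext n
  simp [upsilon, LSeries.convolution_def, mul_comm]

/-! ## The characters -/

/-- Dirichlet characters together with their (positive) modulus. -/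
abbrev Chars : Type := Σ q : ℕ+, DirichletCharacter ℂ (q : ℕ)

/-- `Ψ`: the primitive characters `ψ` modulo a square-free `q` prime to `6` with `Q < q < 2Q`, such
that `ψχ` is a primitive character modulo `[q, D]`. -/
def Psi (D : ℕ) (χ : DirichletCharacter ℂ D) : Set Chars :=
  {p | Q D < ((p.1 : ℕ) : ℝ) ∧ ((p.1 : ℕ) : ℝ) < 2 * Q D ∧ Nat.Coprime 6 (p.1 : ℕ) ∧
    Squarefree (p.1 : ℕ) ∧ p.2.IsPrimitive ∧ (p.2.mul χ).IsPrimitive}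

/-- `L(s, ψ) L(s, ψχ)`. -/
def LL {q D : ℕ} [NeZero q] [NeZero D] (ψ : DirichletCharacter ℂ q) (χ : DirichletCharacter ℂ D)
    (s : ℂ) : ℂ :=
  ψ.LFunction s * (ψ.mul χ).LFunction s

/-- `F(s, ψ)`. -/
def F {q D : ℕ} (χ : DirichletCharacter ℂ D) (ψ : DirichletCharacter ℂ q) (s : ℂ) : ℂ :=
  ∑ n ∈ Finset.Icc 1 (D ^ 5), nu χ n * ψ (n : ZMod q) / (n : ℂ) ^ s

/-- `G(s, ψ)`. -/
def G {q D : ℕ} (χ : DirichletCharacter ℂ D) (ψ : DirichletCharacter ℂ q) (s : ℂ) : ℂ :=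
  ∑ n ∈ Finset.Icc 1 (D ^ 5), upsilon χ n * ψ (n : ZMod q) / (n : ℂ) ^ s

/-- The factor `Δ(s, ψ)` of the functional equation of a primitive character `ψ`, i.e. the
meromorphic function `L(s, ψ) / L(1 - s, ψ̄)`. It is written through gamma factors because the
pointwise quotient is `0 / 0` at the zeros; see `LFunction_eq_Delta_mul`. -/
def Delta {q : ℕ} [NeZero q] (ψ : DirichletCharacter ℂ q) (s : ℂ) : ℂ :=
  ψ.rootNumber * (q : ℂ) ^ (1 / 2 - s) * (ψ⁻¹.gammaFactor (1 - s) / ψ.gammaFactor s)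

theorem gammaFactor_ne_zero {q : ℕ} [NeZero q] (ψ : DirichletCharacter ℂ q) {s : ℂ}
    (hs : s.im ≠ 0) : ψ.gammaFactor s ≠ 0 := by
  unfold DirichletCharacter.gammaFactor
  split_ifs
  · rw [Ne, Gammaℝ_eq_zero_iff]
    rintro ⟨n, rfl⟩
    simp at hs
  · rw [Ne, Gammaℝ_eq_zero_iff]
    rintro ⟨n, hn⟩
    have := congrArg Complex.im hn
    simp at this
    exact hs this

theorem LFunction_eq_Delta_mul {q : ℕ} [NeZero q] {ψ : DirichletCharacter ℂ q}
    (hψ : ψ.IsPrimitive) {s : ℂ} (hs : s.im ≠ 0) :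
    ψ.LFunction s = Delta ψ s * ψ⁻¹.LFunction (1 - s) := by
  have hs' : (1 - s).im ≠ 0 := by simpa using hs
  have h0 : s ≠ 0 := by rintro rfl; simp at hs
  have h1 : 1 - s ≠ 0 := by intro h; rw [h] at hs'; simp at hs'
  have key := hψ.completedLFunction_one_sub (1 - s)
  rw [sub_sub_cancel] at key
  rw [ψ.LFunction_eq_completed_div_gammaFactor s (.inl h0),
    ψ⁻¹.LFunction_eq_completed_div_gammaFactor (1 - s) (.inl h1), key, Delta]
  have g0 := gammaFactor_ne_zero ψ hs
  have g1 := gammaFactor_ne_zero ψ⁻¹ hs'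
  have e : (1 - s - 1 / 2 : ℂ) = 1 / 2 - s := by ring
  rw [e]
  field_simp

/-- `Δ₁(s, ψ) = Δ(s, ψ) Δ(s, ψχ)`. -/
def Delta1 {q D : ℕ} [NeZero q] [NeZero D] (χ : DirichletCharacter ℂ D)
    (ψ : DirichletCharacter ℂ q) (s : ℂ) : ℂ :=
  Delta ψ s * Delta (ψ.mul χ) s

/-- `𝓕(s, ψ) = F(s, ψ) + Δ₁(s, ψ) F(1 - s, ψ̄)`. -/
def calF {q D : ℕ} [NeZero q] [NeZero D] (χ : DirichletCharacter ℂ D)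
    (ψ : DirichletCharacter ℂ q) (s : ℂ) : ℂ :=
  F χ ψ s + Delta1 χ ψ s * F χ ψ⁻¹ (1 - s)

def Omega1 (D : ℕ) : Set ℂ :=
  {s | -2 * alpha D ^ (1 / 2 : ℝ) < (s - s0 D).re ∧ (s - s0 D).re < 1 ∧
    |(s - s0 D).im| < 1 + 20 * logD D}

def Omega2 (D : ℕ) : Set ℂ :=
  {s | -(1 / 10) * alpha D * Real.log (logD D) < (s - s0 D).re ∧ (s - s0 D).re < 1 / 2 ∧
    |(s - s0 D).im| < 1 + 10 * logD D}

/-- `sup_{s ∈ U} f(s) < M`, with the supremum taken in the extended reals. -/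
def SupLT (U : Set ℂ) (f : ℂ → ℝ) (M : ℝ) : Prop := ∃ c < M, ∀ s ∈ U, f s ≤ c

/-- `Ψ*`: the characters `ψ ∈ Ψ` that satisfy the three inequalities
`sup_{Ω₁} (|F| + |G|) < 𝓛³ log 𝓛`, `sup_{Ω₁} |F G - 1| < 1/2` and
`sup_{Ω₂} |L(s, ψ) L(s, ψχ) - 𝓕(s, ψ)| < 𝓛 ^ (-24/5)`. -/
def PsiStar (D : ℕ) [NeZero D] (χ : DirichletCharacter ℂ D) : Set Chars :=
  {p | p ∈ Psi D χ ∧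
    SupLT (Omega1 D) (fun s => ‖F χ p.2 s‖ + ‖G χ p.2 s‖) (logD D ^ 3 * Real.log (logD D)) ∧
    SupLT (Omega1 D) (fun s => ‖F χ p.2 s * G χ p.2 s - 1‖) (1 / 2) ∧
    SupLT (Omega2 D) (fun s => ‖LL p.2 χ s - calF χ p.2 s‖) (logD D ^ (-(24 / 5) : ℝ))}

/-- `S(ψ)`: the zeros of `L(s, ψ) L(s, ψχ)` in the strip `|t - D| < 1`. -/
def zeroSet {q D : ℕ} [NeZero q] [NeZero D] (χ : DirichletCharacter ℂ D)
    (ψ : DirichletCharacter ℂ q) : Set ℂ :=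
  {s | |s.im - D| < 1 ∧ LL ψ χ s = 0}

/-! ## Weights -/

/-- `Y(s) = 5 α (Q^{s/10} - Q^{-s/10}) exp(s²/4) / s²`. -/
def Y (D : ℕ) (s : ℂ) : ℂ :=
  5 * (alpha D : ℂ) * ((Q D : ℂ) ^ (s / 10) - (Q D : ℂ) ^ (-s / 10)) * exp (s ^ 2 / 4) / s ^ 2

/-- `ϑ(x) = (2πi)⁻¹ ∫_{(1)} x^s Y(s) ds`, the line `Re s = 1` being parametrized by `s = 1 + it`. -/
def vartheta (D : ℕ) (x : ℝ) : ℂ :=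
  1 / (2 * Real.pi * I) * ∫ t : ℝ, (x : ℂ) ^ (1 + I * t) * Y D (1 + I * t) * I

/-- `ϖ₁(x) = δ^{3-d} (1 + δ - x²)^d`. -/
def varpi1 (D : ℕ) (d x : ℝ) : ℝ := delta D ^ (3 - d) * (1 + delta D - x ^ 2) ^ d

/-- The integral of `Q^{xs} / (2πi s)` along the arc `s = ω e^{iθ}`, `a ≤ θ ≤ b`. -/
def Uarc (D : ℕ) (a b x : ℝ) : ℂ :=
  1 / (2 * Real.pi * I) *
    ∫ θ in a..b, (Q D : ℂ) ^ (x * circleMap 0 (omega D) θ) / circleMap 0 (omega D) θ *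
      deriv (circleMap 0 (omega D)) θ

/-- `U₊`: the right half of the circle `|s| = ω`, from `-iω` to `iω`. -/
def Uplus (D : ℕ) (x : ℝ) : ℂ := Uarc D (-(Real.pi / 2)) (Real.pi / 2) x

/-- `U₋`: the left half of the circle `|s| = ω`, from `iω` to `-iω`. -/
def Uminus (D : ℕ) (x : ℝ) : ℂ := Uarc D (Real.pi / 2) (3 * Real.pi / 2) x

/-- `sin (R x) / x`, with the value `R` at `x = 0`. -/
def sinQuot (D : ℕ) (x : ℝ) : ℝ := R D * Real.sinc (R D * x)

/-- `X₊`. -/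
def Xplus (D : ℕ) (x : ℝ) : ℝ :=
  1 / Real.pi * sinQuot D x + 1 / (Real.pi * Real.exp 2) * sinQuot D (2 + x)

/-- `X₋`. -/
def Xminus (D : ℕ) (x : ℝ) : ℝ :=
  1 / (Real.pi * Real.exp 2) * sinQuot D x + 1 / Real.pi * sinQuot D (-2 + x)

/-! ## Dirichlet polynomials -/

/-- `∑_{A < n ≤ B} c(n) ψ(n) n^{-s} w(n)`, for real `A, B ≥ 0`. -/
def dirPoly {q : ℕ} (A B : ℝ) (c : ℕ → ℝ) (w : ℕ → ℂ) (s : ℂ) (ψ : DirichletCharacter ℂ q) : ℂ :=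
  ∑ n ∈ Finset.Ioc ⌊A⌋₊ ⌊B⌋₊, (c n : ℂ) * ψ (n : ZMod q) / (n : ℂ) ^ s * w n

/-- The weight `ϑ(Q^{4/3} / n)`. -/
def wPlus (D n : ℕ) : ℂ := vartheta D (Q D ^ (4 / 3 : ℝ) / n)

/-- The weight `ϑ(Q^{2/3} / n)`. -/
def wMinus (D n : ℕ) : ℂ := vartheta D (Q D ^ (2 / 3 : ℝ) / n)

/-- `𝓤₊(a, b; s, ψ)`. -/
def calUplus {q : ℕ} (D : ℕ) (a b : ℝ) (s : ℂ) (ψ : DirichletCharacter ℂ q) : ℂ :=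
  dirPoly (Q D ^ a) (Q D ^ b) (lamPlus D) (wPlus D) s ψ

/-- `𝓤₋(a, b; s, ψ)`. -/
def calUminus {q : ℕ} (D : ℕ) (a b : ℝ) (s : ℂ) (ψ : DirichletCharacter ℂ q) : ℂ :=
  dirPoly (Q D ^ a) (Q D ^ b) (lamMinus D) (wMinus D) s ψ

/-- The common shape of `Υ₊` and `Υ₋`, for `u a b = 𝓤_±(a, b; ρ, ψ)`. -/
def upsilonShape (D : ℕ) (d : ℝ) (u : ℝ → ℝ → ℂ) : ℝ :=
  ‖u 0 (delta1 D)‖ ^ 2 + ‖u (delta1 D) 1‖ ^ 2 +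
    (∫ y in (0 : ℝ)..delta1 D, ‖u 0 y‖ ^ 2 * (varpi1 D d (1 - y))⁻¹) +
    ∫ y in delta1 D..1, ‖u (delta1 D) y‖ ^ 2

/-- `Υ*(ρ, ψ)`. -/
def UpsilonStar {q : ℕ} (D : ℕ) (ε : ℝ) (ρ : ℂ) (ψ : DirichletCharacter ℂ q) : ℝ :=
  (ε ^ 2)⁻¹ * ‖calUplus D 0 ε ρ ψ‖ ^ 2 + ‖calUplus D 1 (3 / 2) ρ ψ‖ ^ 2 +
    ∫ y in (0 : ℝ)..(1 / 2), ‖calUplus D (1 + y) (3 / 2) ρ ψ‖ ^ 2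

/-- `Υ(ρ, ψ) = Υ₊(ρ, ψ) + Υ₋(ρ, ψ) + Υ*(ρ, ψ)`. -/
def Upsilon {q : ℕ} (D : ℕ) (d ε : ℝ) (ρ : ℂ) (ψ : DirichletCharacter ℂ q) : ℝ :=
  upsilonShape D d (fun a b => calUplus D a b ρ ψ) +
    upsilonShape D d (fun a b => calUminus D a b ρ ψ) + UpsilonStar D ε ρ ψ

/-- `𝓧₊(z; s, ψ)`. -/
def calXplus {q : ℕ} (D : ℕ) (z : ℝ) (s : ℂ) (ψ : DirichletCharacter ℂ q) : ℂ :=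
  dirPoly 1 (Q D ^ (3 / 2 : ℝ)) (lamMinus D)
    (fun n => wPlus D n * Xplus D (z - alpha D * Real.log n)) s ψ

/-- `𝓧₋(z; s, ψ)`. -/
def calXminus {q : ℕ} (D : ℕ) (z : ℝ) (s : ℂ) (ψ : DirichletCharacter ℂ q) : ℂ :=
  dirPoly 1 (Q D) (lamPlus D)
    (fun n => wMinus D n * Xminus D (z + alpha D * Real.log n)) s ψ

/-- `𝓔₁(ρ, ψ)`. -/
def E1 {q : ℕ} (D : ℕ) (ε : ℝ) (ρ : ℂ) (ψ : DirichletCharacter ℂ q) : ℝ :=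
  (∫ y in (1 - 2 * delta1 D)..1,
    (‖calXplus D (1 + ε - y) ρ ψ‖ ^ 2 + ‖calXminus D (1 + ε - y) (1 - ρ) ψ⁻¹‖ ^ 2)) +
  ∫ y in (-1 : ℝ)..(-1 + 2 * delta1 D),
    (‖calXplus D (-1 + ε - y) ρ ψ‖ ^ 2 + ‖calXminus D (-1 + ε - y) (1 - ρ) ψ⁻¹‖ ^ 2)

/-- `𝓨₁(s, ψ)`, a sum over `1 < n ≤ Q^{3/2}`. -/
def calY1 {q : ℕ} (D : ℕ) (ε : ℝ) (s : ℂ) (ψ : DirichletCharacter ℂ q) : ℂ :=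
  dirPoly 1 (Q D ^ (3 / 2 : ℝ)) (lamMinus D)
    (fun n => wPlus D n * Uplus D (ε - alpha D * Real.log n)) s ψ

/-- `𝓨₂(s, ψ)`, a sum over `1 ≤ n ≤ Q`. -/
def calY2 {q : ℕ} (D : ℕ) (ε : ℝ) (s : ℂ) (ψ : DirichletCharacter ℂ q) : ℂ :=
  dirPoly 0 (Q D) (lamPlus D)
    (fun n => wMinus D n * Uplus D (-2 + ε + alpha D * Real.log n)) s ψ

/-- `𝓨₃(s, ψ)`, a sum over `1 ≤ n ≤ Q^{3/2}`. -/
def calY3 {q : ℕ} (D : ℕ) (ε : ℝ) (s : ℂ) (ψ : DirichletCharacter ℂ q) : ℂ :=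
  dirPoly 0 (Q D ^ (3 / 2 : ℝ)) (lamMinus D)
    (fun n => wPlus D n * Uminus D (2 + ε - alpha D * Real.log n)) s ψ

/-- `𝓨₄(s, ψ)`, a sum over `1 < n ≤ Q`. -/
def calY4 {q : ℕ} (D : ℕ) (ε : ℝ) (s : ℂ) (ψ : DirichletCharacter ℂ q) : ℂ :=
  dirPoly 1 (Q D) (lamPlus D)
    (fun n => wMinus D n * Uminus D (ε + alpha D * Real.log n)) s ψ

/-- `𝓔₂(ρ, ψ)`. -/
def E2 {q : ℕ} (D : ℕ) (ε : ℝ) (ρ : ℂ) (ψ : DirichletCharacter ℂ q) : ℝ :=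
  ε⁻¹ * (‖calY1 D ε ρ ψ‖ ^ 2 + ‖calY2 D ε (1 - ρ) ψ⁻¹‖ ^ 2 +
    ‖calY3 D ε ρ ψ‖ ^ 2 + ‖calY4 D ε (1 - ρ) ψ⁻¹‖ ^ 2)

/-- `𝓔(ρ, ψ) = Υ(ρ, ψ) / (R^{1/12} log R) + 𝓔₁(ρ, ψ) + 𝓔₂(ρ, ψ)`. -/
def E {q : ℕ} (D : ℕ) (d ε : ℝ) (ρ : ℂ) (ψ : DirichletCharacter ℂ q) : ℝ :=
  1 / (R D ^ (1 / 12 : ℝ) * Real.log (R D)) * Upsilon D d ε ρ ψ + E1 D ε ρ ψ + E2 D ε ρ ψ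

/-- `𝓔 = ∑_{ψ ∈ Ψ*} ∑_{ρ ∈ S(ψ)} 𝓔(ρ, ψ)`. -/
def totalE (D : ℕ) [NeZero D] (χ : DirichletCharacter ℂ D) (d ε : ℝ) : ℝ :=
  ∑ᶠ p ∈ PsiStar D χ, ∑ᶠ ρ ∈ zeroSet χ p.2, E D d ε ρ p.2

end LandauSiegel

end

/-! Each piece of `𝓔(ρ, ψ)` is built from squared absolute values of Dirichlet polynomials of length
at most `Q^{3/2}`, evaluated at `ρ` with `ψ` or at `1 - ρ` with `ψ̄`. The coefficients are `λ_±(n)`,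
the weight `ϑ` (bounded, `norm_vartheta_le`) and an explicit kernel in `u = α log n`. Two estimates
carry the proof.

(1) A discrete mean value theorem (`sum_dirichlet_poly_le`): the sum over `ψ ∈ Ψ*` and `ρ ∈ S(ψ)` of
`|∑ a(n) ψ(n) n^{-ρ}|²` is `≪ 𝓛² Q² ∑ |a(n)|² / n`. For `ψ ∈ Ψ*` the product of `L`-functions is
close to `F(s, ψ) + Δ₁(s, ψ) F(1 - s, ψ̄)`. Since `F` and `G` are bounded and `F G` is near `1`,
`log |F|` hardly varies on the scale `α`, whereas `|Δ₁|` decays like `exp(-2 𝓛² σ)` at distance `σ`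
to the right of the critical line. So a zero lies within `α` of the line (`zero_near_line`), and
Jensen's inequality leaves at most `50` distinct zeros in a box of height `α`
(`card_zeros_disc_le`). There are `O(𝓛²)` boxes. For each box the multiplicative large sieve
(`large_sieve`) gives `O(Q²)`. Moving from a fixed point of the box to the zeros multiplies the
terms by `exp(O(α log n)) = exp(O(1))`, which costs only a constant (`sum_norm_sq_exp_perturb`).

(2) A mean square for the coefficients (`sum_zetaQuotCoeff_sq_le`): `∑ λ_±(n)² / n` over `1 < n ≤
Q^b` is `≪ b²`, because at a prime `λ_±(p) = O(α log p)`. The term `n = 1` is not small and has to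
be excluded or met by a small kernel.

With these, `Υ` contributes `O(𝓛² Q²)`. The kernels of `𝓔₁` are at most `2R` for `u ≤ 4 δ₁` and
`O(1/u)` beyond, and the integrals have length `2 δ₁`. Those of `𝓔₂` are `O(1)` for `u ≤ 2 ε` and
`O(1/(R u))` beyond, or `O(1/R)` throughout. Both parts come out as `O(𝓛² Q² R^{-2/9})`, which is
smaller than the required `R^{-1/12} / log R`. -/

namespace LandauSiegel

/-! ### The large sieve inequality for primitive characters. -/

/-- Quadratic form bounds are stable under bounded exponential perturbations of the vectors. -/
theorem sum_norm_sq_exp_perturb {J : Type*} (T : Finset J) (S : Finset ℕ) (v : J → ℕ → ℂ) (B : ℝ)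
    (hB0 : 0 ≤ B)
    (hB : ∀ b : ℕ → ℂ, ∑ j ∈ T, ‖∑ n ∈ S, b n * v j n‖ ^ 2 ≤ B * ∑ n ∈ S, ‖b n‖ ^ 2)
    (z : J → ℂ) (hz : ∀ j ∈ T, ‖z j‖ ≤ 1) (φ : ℕ → ℝ) (A : ℝ) (hφ : ∀ n ∈ S, |φ n| ≤ A)
    (b : ℕ → ℂ) :
    ∑ j ∈ T, ‖∑ n ∈ S, b n * v j n * exp (z j * φ n)‖ ^ 2 ≤
      Real.exp (1 + A ^ 2) * (B * ∑ n ∈ S, ‖b n‖ ^ 2) := by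
  set c : J → ℕ → ℂ := fun j k => ∑ n ∈ S, (b n * (φ n : ℂ) ^ k) * v j n with hc
  have hsum : ∀ j, HasSum (fun k : ℕ => (z j) ^ k / (k.factorial : ℂ) * c j k)
      (∑ n ∈ S, b n * v j n * exp (z j * φ n)) := by
    intro j
    have h1 : ∀ n ∈ S, HasSum (fun k : ℕ => b n * v j n * ((z j * φ n) ^ k / (k.factorial : ℂ)))
        (b n * v j n * exp (z j * φ n)) := by
      intro n _
      have := NormedSpace.expSeries_div_hasSum_exp (𝔸 := ℂ) (z j * φ n)
      rw [← Complex.exp_eq_exp_ℂ] at this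
      exact this.mul_left _
    refine (hasSum_sum h1).congr_fun ?_
    intro k
    simp only [hc, Finset.mul_sum]
    exact Finset.sum_congr rfl fun n _ => by rw [mul_pow]; ring
  have hlim : Filter.Tendsto (fun K : ℕ => ∑ j ∈ T,
      ‖∑ k ∈ Finset.range K, (z j) ^ k / (k.factorial : ℂ) * c j k‖ ^ 2) Filter.atTop
      (nhds (∑ j ∈ T, ‖∑ n ∈ S, b n * v j n * exp (z j * φ n)‖ ^ 2)) :=
    tendsto_finsetSum _ fun j _ => ((hsum j).tendsto_sum_nat.norm.pow 2)
  refine le_of_tendsto' hlim fun K => ?_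
  -- Cauchy–Schwarz with the weight `1/k!` split evenly between the two factors. The powers `z_j^k`
  -- disappear because `‖z_j‖ ≤ 1`, and what remains is the unperturbed quadratic form at the
  -- vectors `b(n) φ(n)^k`.
  have hcs : ∀ j ∈ T, ‖∑ k ∈ Finset.range K, (z j) ^ k / (k.factorial : ℂ) * c j k‖ ^ 2 ≤
      Real.exp 1 * ∑ k ∈ Finset.range K, ((k.factorial : ℝ))⁻¹ * ‖c j k‖ ^ 2 := by
    intro j hj
    have h1 : ‖∑ k ∈ Finset.range K, (z j) ^ k / (k.factorial : ℂ) * c j k‖ ≤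
        ∑ k ∈ Finset.range K, √((k.factorial : ℝ)⁻¹) * (√((k.factorial : ℝ)⁻¹) * ‖c j k‖) := by
      refine norm_sum_le_of_le _ fun k _ => ?_
      rw [← mul_assoc, Real.mul_self_sqrt (by positivity), norm_mul, norm_div, norm_pow,
        Complex.norm_natCast, div_eq_mul_inv]
      refine mul_le_mul_of_nonneg_right ?_ (norm_nonneg _)
      exact mul_le_of_le_one_left (by positivity) (pow_le_one₀ (norm_nonneg _) (hz j hj))
    calc _ ≤ (∑ k ∈ Finset.range K, √((k.factorial : ℝ)⁻¹) * (√((k.factorial : ℝ)⁻¹) * ‖c j k‖)) ^ 2 := by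
          gcongr
      _ ≤ (∑ k ∈ Finset.range K, √((k.factorial : ℝ)⁻¹) ^ 2) *
          ∑ k ∈ Finset.range K, (√((k.factorial : ℝ)⁻¹) * ‖c j k‖) ^ 2 :=
          Finset.sum_mul_sq_le_sq_mul_sq _ _ _
      _ = (∑ k ∈ Finset.range K, (1 : ℝ) ^ k / (k.factorial : ℝ)) *
          ∑ k ∈ Finset.range K, ((k.factorial : ℝ))⁻¹ * ‖c j k‖ ^ 2 := by
          simp only [mul_pow]
          simp_rw [Real.sq_sqrt (inv_nonneg.mpr (Nat.cast_nonneg _)), one_pow, one_div]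
      _ ≤ _ := by
          refine mul_le_mul_of_nonneg_right (Real.sum_le_exp_of_nonneg zero_le_one K) ?_
          exact Finset.sum_nonneg fun k _ => by positivity
  calc _ ≤ ∑ j ∈ T, Real.exp 1 * ∑ k ∈ Finset.range K, ((k.factorial : ℝ))⁻¹ * ‖c j k‖ ^ 2 :=
        Finset.sum_le_sum hcs
    _ = Real.exp 1 * ∑ k ∈ Finset.range K, ((k.factorial : ℝ))⁻¹ * ∑ j ∈ T, ‖c j k‖ ^ 2 := by
        rw [← Finset.mul_sum, Finset.sum_comm]
        simp_rw [Finset.mul_sum]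
    _ ≤ Real.exp 1 * ∑ k ∈ Finset.range K, ((k.factorial : ℝ))⁻¹ *
          (B * ((A ^ 2) ^ k * ∑ n ∈ S, ‖b n‖ ^ 2)) := by
        gcongr with k _
        refine (hB _).trans ?_
        gcongr
        rw [Finset.mul_sum]
        refine Finset.sum_le_sum fun n hn => ?_
        rw [norm_mul, mul_pow, norm_pow, Complex.norm_real, Real.norm_eq_abs, mul_comm, ← pow_mul,
          ← pow_mul, mul_comm k 2]
        gcongr
        exact hφ n hn
    _ = Real.exp 1 * ((∑ k ∈ Finset.range K, (A ^ 2) ^ k / (k.factorial : ℝ)) *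
          (B * ∑ n ∈ S, ‖b n‖ ^ 2)) := by
        rw [Finset.sum_mul]
        congr 1
        exact Finset.sum_congr rfl fun k _ => by ring
    _ ≤ Real.exp 1 * (Real.exp (A ^ 2) * (B * ∑ n ∈ S, ‖b n‖ ^ 2)) := by
        have : 0 ≤ B * ∑ n ∈ S, ‖b n‖ ^ 2 :=
          mul_nonneg hB0 (Finset.sum_nonneg fun n _ => by positivity)
        gcongr
        exact Real.sum_le_exp_of_nonneg (by positivity) K
    _ = _ := by rw [Real.exp_add, mul_assoc]

/-- Parseval's identity for the additive characters of `ZMod M`. -/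
theorem parseval_zmod {ι : Type*} (M : ℕ) [NeZero M] (S : Finset ι) (g : ι → ZMod M)
    (hg : Set.InjOn g S) (b : ι → ℂ) :
    ∑ j : ZMod M, ‖∑ n ∈ S, b n * ZMod.stdAddChar (j * g n)‖ ^ 2 = M * ∑ n ∈ S, ‖b n‖ ^ 2 := by
  classical
  have key : ∑ j : ZMod M, ((‖∑ n ∈ S, b n * ZMod.stdAddChar (j * g n)‖ ^ 2 : ℝ) : ℂ) =
      ((M * ∑ n ∈ S, ‖b n‖ ^ 2 : ℝ) : ℂ) := by
    have h1 : ∀ j : ZMod M, ((‖∑ n ∈ S, b n * ZMod.stdAddChar (j * g n)‖ ^ 2 : ℝ) : ℂ) =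
        ∑ n ∈ S, ∑ m ∈ S, b n * (starRingEnd ℂ) (b m) * ZMod.stdAddChar (j * (g n - g m)) := by
      intro j
      push_cast
      rw [← Complex.mul_conj', map_sum, Finset.sum_mul_sum]
      refine Finset.sum_congr rfl fun n _ => Finset.sum_congr rfl fun m _ => ?_
      rw [map_mul (starRingEnd ℂ), ← AddChar.map_neg_eq_conj, mul_sub, sub_eq_add_neg, AddChar.map_add_eq_mul]
      ring
    simp_rw [h1]
    rw [Finset.sum_comm]
    push_cast
    rw [Finset.mul_sum]
    refine Finset.sum_congr rfl fun n hn => ?_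
    rw [Finset.sum_comm]
    simp_rw [← Finset.mul_sum, AddChar.sum_mulShift _ (ZMod.isPrimitive_stdAddChar M)]
    rw [Finset.sum_eq_single n]
    · simp [Complex.mul_conj', mul_comm]
    · intro m hm hmn
      have : g n - g m ≠ 0 := sub_ne_zero.mpr fun h => hmn (hg hm hn h.symm)
      simp [this]
    · exact fun h => absurd hn h
  exact_mod_cast key

/-- The discrete Fourier transform of a primitive `ψ` is `ψ⁻¹` times the Gauss sum, so Parseval
compares `∑ |ψ|²` with itself. -/
theorem norm_gaussSum_sq {q : ℕ} [NeZero q] {ψ : DirichletCharacter ℂ q} (hψ : ψ.IsPrimitive) :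
    ‖gaussSum ψ ZMod.stdAddChar‖ ^ 2 = q := by
  have hP := parseval_zmod q Finset.univ (id : ZMod q → ZMod q) Function.injective_id.injOn ψ
  have h1 : ∀ j : ZMod q, ∑ n : ZMod q, ψ n * ZMod.stdAddChar (j * id n) =
      ψ⁻¹ j * gaussSum ψ ZMod.stdAddChar := by
    intro j
    rw [← gaussSum_mulShift_of_isPrimitive _ hψ]
    simp [gaussSum, AddChar.mulShift_apply]
  simp_rw [h1, norm_mul, mul_pow, ← Finset.sum_mul] at hP
  have h2 : ∑ j : ZMod q, ‖ψ⁻¹ j‖ ^ 2 = ∑ j : ZMod q, ‖ψ j‖ ^ 2 := by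
    refine Finset.sum_congr rfl fun j _ => ?_
    by_cases hj : IsUnit j
    · rw [← hj.unit_spec, DirichletCharacter.unit_norm_eq_one, DirichletCharacter.unit_norm_eq_one]
    · rw [MulChar.map_nonunit _ hj, MulChar.map_nonunit _ hj]
  have h3 : 0 < ∑ j : ZMod q, ‖ψ j‖ ^ 2 := by
    refine Finset.sum_pos' (fun j _ => by positivity) ⟨1, Finset.mem_univ _, by simp⟩
  rw [h2, mul_comm] at hP
  exact mul_right_cancel₀ h3.ne' hP

-- Gauss sums turn `∑ b(n) ψ(n)` into a combination of additive sums weighted by `ψ⁻¹`, at the cost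
-- of `|τ|² = q`. Dropping primitivity then allows orthogonality over all characters, which brings
-- in `φ(q) ≤ q`, and the two factors cancel.
open Classical in
theorem sum_primitive_le {q : ℕ} [NeZero q] (S : Finset ℕ) (b : ℕ → ℂ) :
    ∑ ψ : DirichletCharacter ℂ q with ψ.IsPrimitive, ‖∑ n ∈ S, b n * ψ (n : ZMod q)‖ ^ 2 ≤
      ∑ x : ZMod q with IsUnit x, ‖∑ n ∈ S, b n * ZMod.stdAddChar (x * (n : ZMod q))‖ ^ 2 := by
  set V : ZMod q → ℂ := fun x => ∑ n ∈ S, b n * ZMod.stdAddChar (x * (n : ZMod q)) with hV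
  have hq : (0 : ℝ) < q := by exact_mod_cast NeZero.pos q
  have h1 : ∀ ψ : DirichletCharacter ℂ q, ψ.IsPrimitive →
      (q : ℝ) * ‖∑ n ∈ S, b n * ψ (n : ZMod q)‖ ^ 2 = ‖∑ x : ZMod q, ψ⁻¹ x * V x‖ ^ 2 := by
    intro ψ hψ
    have hψ' : ψ⁻¹.IsPrimitive := by
      rw [DirichletCharacter.isPrimitive_def] at hψ ⊢
      rw [DirichletCharacter.conductor_inv, hψ]
    have e : ∑ x : ZMod q, ψ⁻¹ x * V x =
        (∑ n ∈ S, b n * ψ (n : ZMod q)) * gaussSum ψ⁻¹ ZMod.stdAddChar := by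
      simp_rw [hV, Finset.mul_sum]
      rw [Finset.sum_comm, Finset.sum_mul]
      refine Finset.sum_congr rfl fun n _ => ?_
      have := gaussSum_mulShift_of_isPrimitive ZMod.stdAddChar hψ' (n : ZMod q)
      rw [inv_inv] at this
      rw [mul_assoc, ← this, gaussSum, Finset.mul_sum]
      exact Finset.sum_congr rfl fun x _ => by rw [AddChar.mulShift_apply, mul_comm x]; ring
    rw [e, norm_mul, mul_pow, norm_gaussSum_sq hψ', mul_comm]
  have h2 : ∑ ψ : DirichletCharacter ℂ q, ‖∑ x : ZMod q, ψ⁻¹ x * V x‖ ^ 2 =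
      q.totient * ∑ x : ZMod q with IsUnit x, ‖V x‖ ^ 2 := by
    have key : ∑ ψ : DirichletCharacter ℂ q, ((‖∑ x : ZMod q, ψ⁻¹ x * V x‖ ^ 2 : ℝ) : ℂ) =
        ((q.totient * ∑ x : ZMod q with IsUnit x, ‖V x‖ ^ 2 : ℝ) : ℂ) := by
      have h3 : ∀ ψ : DirichletCharacter ℂ q, ((‖∑ x : ZMod q, ψ⁻¹ x * V x‖ ^ 2 : ℝ) : ℂ) =
          ∑ x : ZMod q with IsUnit x, ∑ y : ZMod q, V x * (starRingEnd ℂ) (V y) *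
            (ψ x⁻¹ * ψ y) := by
        intro ψ
        push_cast
        rw [← Complex.mul_conj', map_sum]
        have : ∑ x : ZMod q, ψ⁻¹ x * V x = ∑ x : ZMod q with IsUnit x, ψ⁻¹ x * V x := by
          rw [Finset.sum_filter]
          refine Finset.sum_congr rfl fun x _ => ?_
          split_ifs with h
          · rfl
          · rw [MulChar.map_nonunit _ h, zero_mul]
        rw [this, Finset.sum_mul_sum]
        refine Finset.sum_congr rfl fun x hx => Finset.sum_congr rfl fun y _ => ?_
        have e1 : ψ⁻¹ x = ψ x⁻¹ := by
          rw [MulChar.inv_apply]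
          congr 1
          obtain ⟨u, rfl⟩ := (Finset.mem_filter.mp hx).2
          rw [Ring.inverse_unit, ZMod.inv_coe_unit]
        have e2 : (starRingEnd ℂ) (ψ⁻¹ y) = ψ y := by
          rw [starRingEnd_apply, MulChar.star_apply', inv_inv]
        rw [map_mul, e1, e2]
        ring
      simp_rw [h3]
      rw [Finset.sum_comm]
      push_cast
      rw [Finset.mul_sum]
      refine Finset.sum_congr rfl fun x hx => ?_
      rw [Finset.sum_comm]
      simp_rw [← Finset.mul_sum,
        DirichletCharacter.sum_char_inv_mul_char_eq ℂ (Finset.mem_filter.mp hx).2]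
      simp [Complex.mul_conj', mul_comm]
    exact_mod_cast key
  have h4 : (q : ℝ) * ∑ ψ : DirichletCharacter ℂ q with ψ.IsPrimitive,
      ‖∑ n ∈ S, b n * ψ (n : ZMod q)‖ ^ 2 ≤ q * ∑ x : ZMod q with IsUnit x, ‖V x‖ ^ 2 := by
    calc _ = ∑ ψ : DirichletCharacter ℂ q with ψ.IsPrimitive, ‖∑ x : ZMod q, ψ⁻¹ x * V x‖ ^ 2 := by
          rw [Finset.mul_sum]
          exact Finset.sum_congr rfl fun ψ hψ => h1 ψ (Finset.mem_filter.mp hψ).2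
      _ ≤ ∑ ψ : DirichletCharacter ℂ q, ‖∑ x : ZMod q, ψ⁻¹ x * V x‖ ^ 2 :=
          Finset.sum_le_sum_of_subset_of_nonneg (Finset.filter_subset _ _)
            fun _ _ _ => by positivity
      _ ≤ _ := by
          rw [h2]
          gcongr
          exact Nat.totient_le q
  exact le_of_mul_le_mul_left h4 hq

/-- Distinct reduced fractions with denominators at most `X` lie in distinct cells of length
`X⁻²`. -/
theorem farey_cell_injective {X a q a' q' : ℕ} (hq : 0 < q) (hq' : 0 < q') (hX : q ≤ X)
    (hX' : q' ≤ X) (h : a.Coprime q) (h' : a'.Coprime q')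
    (hc : a * X ^ 2 / q = a' * X ^ 2 / q') : q = q' ∧ a = a' := by
  have key : ∀ {a q a' q' : ℕ}, 0 < q → 0 < q' → q ≤ X → q' ≤ X →
      a * X ^ 2 / q = a' * X ^ 2 / q' → a * q' ≤ a' * q := by
    intro a q a' q' hq hq' hX hX' hc
    have h1 := Nat.lt_mul_div_succ (a * X ^ 2) hq
    have h2 := Nat.div_mul_le_self (a' * X ^ 2) q'
    rw [hc] at h1
    set c := a' * X ^ 2 / q'
    -- Distinct fractions differ by at least `1/(q q') ≥ X⁻²`, while two points of one half-open
    -- cell differ by less.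
    by_contra! hlt
    have h3 : (a' * q + 1) * X ^ 2 ≤ a * q' * X ^ 2 := Nat.mul_le_mul_right _ hlt
    have h4 : a * X ^ 2 * q' < q * (c + 1) * q' := (Nat.mul_lt_mul_right hq').mpr h1
    have h5 : c * q' * q ≤ a' * X ^ 2 * q := Nat.mul_le_mul_right _ h2
    have h6 : q * q' ≤ X * X := Nat.mul_le_mul hX hX'
    nlinarith
  have e : a * q' = a' * q := le_antisymm (key hq hq' hX hX' hc) (key hq' hq hX' hX hc.symm)
  have d1 : q ∣ q' := h.symm.dvd_of_dvd_mul_left (e ▸ Dvd.intro_left a' rfl)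
  have d2 : q' ∣ q := h'.symm.dvd_of_dvd_mul_left (e ▸ Dvd.intro_left a rfl)
  obtain rfl := Nat.dvd_antisymm d1 d2
  exact ⟨rfl, Nat.eq_of_mul_eq_mul_right hq e⟩

/-- The additive large sieve inequality for reduced fractions with denominators at most `X` and
sums of length at most `X²`. -/
theorem sum_farey_le (X : ℕ) (S : Finset ℕ) (hS : S ⊆ Finset.Icc 1 (X ^ 2))
    (T : Finset (Σ q : ℕ+, ZMod q)) (hT : ∀ j ∈ T, (j.1 : ℕ) ≤ X ∧ IsUnit j.2) (b : ℕ → ℂ) :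
    ∑ j ∈ T, ‖∑ n ∈ S, b n * ZMod.stdAddChar (j.2 * (n : ZMod j.1))‖ ^ 2 ≤
      Real.exp (1 + (2 * Real.pi) ^ 2) * ((X : ℝ) ^ 2 * ∑ n ∈ S, ‖b n‖ ^ 2) := by
  rcases Nat.eq_zero_or_pos X with rfl | hX
  · have : T = ∅ := Finset.eq_empty_of_forall_notMem fun j hj => by
      have h1 := (hT j hj).1
      have h2 := j.1.pos
      omega
    simp [this]
  have : NeZero (X ^ 2) := ⟨by positivity⟩
  have hM : (0 : ℝ) < (X : ℝ) ^ 2 := by positivity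
  -- Division in `ℕ`: the cell is the integral part of `X² a / q`. Each fraction is replaced by the
  -- left end of its cell, so that Parseval modulo `X²` applies to the resulting distinct residues.
  set cell : (Σ q : ℕ+, ZMod q) → ℕ := fun j => j.2.val * X ^ 2 / j.1 with hcell
  have hcell_lt : ∀ j, cell j < X ^ 2 := by
    intro j
    have h1 := ZMod.val_lt j.2
    rw [hcell]
    refine Nat.div_lt_of_lt_mul ?_
    exact (Nat.mul_lt_mul_right (by positivity)).mpr h1
  have hcop : ∀ j ∈ T, j.2.val.Coprime j.1 := by
    intro j hj
    have := (ZMod.isUnit_iff_coprime j.2.val j.1).mp (by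
      rw [ZMod.natCast_zmod_val]; exact (hT j hj).2)
    exact this
  have hinj : Set.InjOn (fun j => ((cell j : ℕ) : ZMod (X ^ 2))) T := by
    rintro ⟨q, x⟩ hj ⟨q', x'⟩ hj' h
    have h1 : cell ⟨q, x⟩ = cell ⟨q', x'⟩ := by
      have := congrArg ZMod.val h
      simpa [ZMod.val_natCast, Nat.mod_eq_of_lt (hcell_lt _)] using this
    obtain ⟨h2, h3⟩ := farey_cell_injective q.pos q'.pos (hT _ hj).1 (hT _ hj').1 (hcop _ hj)
      (hcop _ hj') h1
    obtain rfl := PNat.eq h2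
    exact congrArg (Sigma.mk q) (ZMod.val_injective _ h3)
  set v : (Σ q : ℕ+, ZMod q) → ℕ → ℂ := fun j n =>
    ZMod.stdAddChar (((cell j : ℕ) : ZMod (X ^ 2)) * (n : ZMod (X ^ 2))) with hv
  -- The rounding error is put back as a perturbation `exp(z φ(n))`: `z` is `i` times the fractional
  -- part of `X² a / q`, and `φ(n) = 2π n / X²` is at most `2π`.
  set z : (Σ q : ℕ+, ZMod q) → ℂ := fun j =>
    I * ((((j.2.val : ℝ) * (X : ℝ) ^ 2 / (j.1 : ℕ) - cell j : ℝ)) : ℂ) with hz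
  set φ : ℕ → ℝ := fun n => 2 * Real.pi * n / (X : ℝ) ^ 2 with hφ
  have hB : ∀ b : ℕ → ℂ, ∑ j ∈ T, ‖∑ n ∈ S, b n * v j n‖ ^ 2 ≤
      (X : ℝ) ^ 2 * ∑ n ∈ S, ‖b n‖ ^ 2 := by
    intro b
    have hSinj : Set.InjOn (fun n : ℕ => (n : ZMod (X ^ 2))) S := by
      intro m hm n hn h
      have hm' := Finset.mem_Icc.mp (hS hm)
      have hn' := Finset.mem_Icc.mp (hS hn)
      have h2 := (ZMod.natCast_eq_natCast_iff _ _ _).mp h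
      wlog hmn : m ≤ n generalizing m n
      · exact (this hn hm h.symm hn' hm' h2.symm (le_of_not_ge hmn)).symm
      have h3 := (Nat.modEq_iff_dvd' hmn).mp h2
      have h4 : n - m = 0 := Nat.eq_zero_of_dvd_of_lt h3 (by omega)
      omega
    have hp := parseval_zmod (X ^ 2) S (fun n : ℕ => (n : ZMod (X ^ 2))) hSinj b
    rw [Nat.cast_pow] at hp
    rw [← hp]
    classical
    rw [← Finset.sum_image (s := T) (g := fun j => ((cell j : ℕ) : ZMod (X ^ 2)))
      (f := fun c => ‖∑ n ∈ S, b n * ZMod.stdAddChar (c * (n : ZMod (X ^ 2)))‖ ^ 2) hinj]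
    exact Finset.sum_le_sum_of_subset_of_nonneg (Finset.subset_univ _) fun _ _ _ => by positivity
  have hz1 : ∀ j ∈ T, ‖z j‖ ≤ 1 := by
    intro j _
    have hq : (0 : ℝ) < (j.1 : ℕ) := by exact_mod_cast j.1.pos
    have h1 : ((j.2.val * X ^ 2 / j.1 : ℕ) : ℝ) * (j.1 : ℕ) ≤ j.2.val * (X : ℝ) ^ 2 := by
      exact_mod_cast Nat.div_mul_le_self (j.2.val * X ^ 2) j.1
    have h2 : j.2.val * (X : ℝ) ^ 2 < (j.1 : ℕ) * (((j.2.val * X ^ 2 / j.1 : ℕ) : ℝ) + 1) := by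
      exact_mod_cast Nat.lt_mul_div_succ (j.2.val * X ^ 2) j.1.pos
    rw [hz, norm_mul, Complex.norm_I, one_mul, Complex.norm_real, Real.norm_eq_abs, abs_le]
    constructor
    · have : (cell j : ℝ) ≤ j.2.val * (X : ℝ) ^ 2 / (j.1 : ℕ) := by
        rw [le_div_iff₀ hq]; exact h1
      linarith
    · have : j.2.val * (X : ℝ) ^ 2 / (j.1 : ℕ) ≤ cell j + 1 := by
        rw [div_le_iff₀ hq, mul_comm _ (((j.1 : ℕ)) : ℝ)]; exact h2.le
      linarith
  have hφ1 : ∀ n ∈ S, |φ n| ≤ 2 * Real.pi := by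
    intro n hn
    have hn' : (n : ℝ) ≤ (X : ℝ) ^ 2 := by exact_mod_cast (Finset.mem_Icc.mp (hS hn)).2
    have hpi := Real.pi_pos
    rw [hφ, abs_of_nonneg (by positivity), div_le_iff₀ hM]
    gcongr
  have main := sum_norm_sq_exp_perturb T S v ((X : ℝ) ^ 2) hM.le hB z hz1 φ (2 * Real.pi) hφ1 b
  refine le_trans (le_of_eq ?_) main
  refine Finset.sum_congr rfl fun j _ => ?_
  congr 2
  refine Finset.sum_congr rfl fun n _ => ?_
  rw [mul_assoc]
  congr 1
  have e1 : (j.2 * (n : ZMod j.1)) = ((j.2.val * n : ℤ) : ZMod j.1) := by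
    push_cast
    rw [ZMod.natCast_zmod_val]
  have e2 : (((cell j : ℕ) : ZMod (X ^ 2)) * (n : ZMod (X ^ 2))) =
      ((cell j * n : ℤ) : ZMod (X ^ 2)) := by push_cast; rfl
  rw [hv, e1]
  simp only [e2]
  rw [ZMod.stdAddChar_coe, ZMod.stdAddChar_coe, ← Complex.exp_add]
  congr 1
  have hq : ((j.1 : ℕ) : ℂ) ≠ 0 := by exact_mod_cast j.1.pos.ne'
  have hX' : (X : ℂ) ≠ 0 := by exact_mod_cast hX.ne'
  simp only [hz, hφ]
  push_cast
  field_simp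
  ring

/-- The large sieve inequality for primitive characters to moduli at most `X` and sums of length
at most `X²`. -/
theorem large_sieve (X : ℕ) (S : Finset ℕ) (hS : S ⊆ Finset.Icc 1 (X ^ 2))
    (P : Finset Chars) (hP : ∀ p ∈ P, (p.1 : ℕ) ≤ X ∧ p.2.IsPrimitive) (b : ℕ → ℂ) :
    ∑ p ∈ P, ‖∑ n ∈ S, b n * p.2 (n : ZMod p.1)‖ ^ 2 ≤
      Real.exp (1 + (2 * Real.pi) ^ 2) * ((X : ℝ) ^ 2 * ∑ n ∈ S, ‖b n‖ ^ 2) := by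
  classical
  set A : Finset ℕ+ := P.image Sigma.fst with hA
  have hsub : P ⊆ A.sigma fun q => Finset.univ.filter
      fun ψ : DirichletCharacter ℂ (q : ℕ) => ψ.IsPrimitive := by
    intro p hp
    simp only [Finset.mem_sigma, Finset.mem_filter, Finset.mem_univ, true_and]
    exact ⟨Finset.mem_image_of_mem _ hp, (hP p hp).2⟩
  calc _ ≤ ∑ p ∈ A.sigma fun q => Finset.univ.filter
        fun ψ : DirichletCharacter ℂ (q : ℕ) => ψ.IsPrimitive,
        ‖∑ n ∈ S, b n * p.2 (n : ZMod p.1)‖ ^ 2 :=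
        Finset.sum_le_sum_of_subset_of_nonneg hsub fun _ _ _ => by positivity
    _ = ∑ q ∈ A, ∑ ψ : DirichletCharacter ℂ (q : ℕ) with ψ.IsPrimitive,
        ‖∑ n ∈ S, b n * ψ (n : ZMod q)‖ ^ 2 := by rw [Finset.sum_sigma]
    _ ≤ ∑ q ∈ A, ∑ x : ZMod q with IsUnit x,
        ‖∑ n ∈ S, b n * ZMod.stdAddChar (x * (n : ZMod q))‖ ^ 2 :=
        Finset.sum_le_sum fun q _ => sum_primitive_le S b
    _ = ∑ j ∈ A.sigma fun q => Finset.univ.filter fun x : ZMod q => IsUnit x,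
        ‖∑ n ∈ S, b n * ZMod.stdAddChar (j.2 * (n : ZMod j.1))‖ ^ 2 := by rw [Finset.sum_sigma]
    _ ≤ _ := by
      refine sum_farey_le X S hS _ ?_ b
      intro j hj
      simp only [Finset.mem_sigma, Finset.mem_filter, Finset.mem_univ, true_and] at hj
      obtain ⟨p, hp, hpj⟩ := Finset.mem_image.mp hj.1
      exact ⟨hpj ▸ (hP p hp).1, hj.2⟩

end LandauSiegel

/-! ### Gamma factors and the size of `Δ` near the critical line. -/

namespace LandauSiegel

/-- The excess over the harmonic sum is majorized by the telescoping series with partial sums `4 -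
4/(m+1)`. This and the next lemma sum the logarithms of the factors in Euler's product for `Γ`. -/
theorem sum_add_div_sq_le (n : ℕ) :
    ∑ j ∈ Finset.range (n + 1), ((j : ℝ) + 1) / ((j : ℝ) ^ 2 + 1) ≤ Real.log (n + 1) + 5 := by
  have h1 : ∀ m : ℕ, ∑ j ∈ Finset.range m, ((j : ℝ) + 1) / ((j : ℝ) ^ 2 + 1) ≤
      (harmonic m : ℝ) + (4 - 4 / ((m : ℝ) + 1)) := by
    intro m
    induction m with
    | zero => simp
    | succ k ih =>
      rw [Finset.sum_range_succ, harmonic_succ]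
      have hk : (0 : ℝ) ≤ k := Nat.cast_nonneg k
      have : ((k : ℝ) + 1) / ((k : ℝ) ^ 2 + 1) ≤
          ((k : ℝ) + 1)⁻¹ + (4 / ((k : ℝ) + 1) - 4 / ((k : ℝ) + 1 + 1)) := by
        rw [← sub_nonneg]
        have : ((k : ℝ) + 1)⁻¹ + (4 / ((k : ℝ) + 1) - 4 / ((k : ℝ) + 1 + 1)) -
            ((k : ℝ) + 1) / ((k : ℝ) ^ 2 + 1) =
            (2 * (k - 1) ^ 2 + 2) / (((k : ℝ) + 1) * (k + 2) * ((k : ℝ) ^ 2 + 1)) := by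
          field_simp
          ring
        rw [this]
        positivity
      push_cast
      linarith
  have h2 := h1 (n + 1)
  have h3 := harmonic_le_one_add_log (n + 1)
  have h4 : (0 : ℝ) ≤ 4 / (((n + 1 : ℕ) : ℝ) + 1) := by positivity
  push_cast at h2 h3 h4
  linarith

/-- The increments of `½ log((m+2)² + t²)` are compared with the summands; their difference is
dominated by the telescoping `3/(m+1) - 3/(m+2)`. -/
theorem log_sub_le_sum_div_sq {t : ℝ} (ht : 1 ≤ |t|) (n : ℕ) :
    Real.log n - Real.log (4 + t ^ 2) / 2 - 3 ≤
      ∑ j ∈ Finset.range (n + 1), (j : ℝ) / (((j : ℝ) + 2) ^ 2 + t ^ 2) := by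
  have ht2 : 0 < t ^ 2 := by have := abs_pos.mp (lt_of_lt_of_le one_pos ht); positivity
  have h1 : ∀ m : ℕ, Real.log (((m : ℝ) + 2) ^ 2 + t ^ 2) / 2 - Real.log (4 + t ^ 2) / 2 -
      (3 - 3 / ((m : ℝ) + 1)) ≤
      ∑ j ∈ Finset.range m, (j : ℝ) / (((j : ℝ) + 2) ^ 2 + t ^ 2) := by
    intro m
    induction m with
    | zero => norm_num
    | succ k ih =>
      rw [Finset.sum_range_succ]
      have hk : (0 : ℝ) ≤ k := Nat.cast_nonneg k
      set u : ℝ := ((k : ℝ) + 2) ^ 2 + t ^ 2 with hu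
      have hupos : 0 < u := by positivity
      have e1 : Real.log (((k + 1 : ℕ) + 2 : ℝ) ^ 2 + t ^ 2) ≤
          Real.log u + (2 * (k : ℝ) + 5) / u := by
        have e2 : (((k + 1 : ℕ) + 2 : ℝ) ^ 2 + t ^ 2) = u * (1 + (2 * (k : ℝ) + 5) / u) := by
          push_cast
          field_simp
          rw [hu]; ring
        rw [e2, Real.log_mul hupos.ne' (by positivity)]
        have := Real.log_le_sub_one_of_pos (x := 1 + (2 * (k : ℝ) + 5) / u) (by positivity)
        linarith
      have e3 : (2 * (k : ℝ) + 5) / u / 2 - (k : ℝ) / u ≤ 3 / ((k : ℝ) + 1) - 3 / ((k : ℝ) + 1 + 1) := by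
        have : (2 * (k : ℝ) + 5) / u / 2 - (k : ℝ) / u = 5 / 2 / u := by ring
        rw [this]
        have : 3 / ((k : ℝ) + 1) - 3 / ((k : ℝ) + 1 + 1) = 3 / (((k : ℝ) + 1) * (k + 2)) := by
          field_simp; ring
        rw [this, div_le_div_iff₀ hupos (by positivity), hu]
        nlinarith
      push_cast at e1 ⊢
      linarith
  have h2 := h1 (n + 1)
  have h3 : Real.log n ≤ Real.log ((((n + 1 : ℕ) : ℝ) + 2) ^ 2 + t ^ 2) / 2 := by
    rcases Nat.eq_zero_or_pos n with rfl | hn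
    · simp only [Nat.cast_zero, Real.log_zero]
      exact div_nonneg (Real.log_nonneg (by push_cast; nlinarith)) two_pos.le
    · have hn' : (0 : ℝ) < n := by exact_mod_cast hn
      have : 2 * Real.log n = Real.log ((n : ℝ) ^ 2) := by rw [Real.log_pow]; norm_num
      have h5 : Real.log ((n : ℝ) ^ 2) ≤ Real.log ((((n + 1 : ℕ) : ℝ) + 2) ^ 2 + t ^ 2) := by
        apply Real.log_le_log (by positivity)
        push_cast
        nlinarith
      linarith
  have h4 : (0 : ℝ) ≤ 3 / (((n + 1 : ℕ) : ℝ) + 1) := by positivity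
  linarith

theorem norm_sq_add_mul_I (x t : ℝ) : ‖(x : ℂ) + t * I‖ ^ 2 = x ^ 2 + t ^ 2 := by
  rw [Complex.sq_norm, Complex.normSq_add_mul_I]

theorem le_mul_exp_of_sq {a b c : ℝ} (ha : 0 < a) (hb : 0 ≤ b)
    (h : b ^ 2 ≤ a ^ 2 * (1 + 2 * c)) : b ≤ a * Real.exp c := by
  refine (pow_le_pow_iff_left₀ hb (by positivity) two_ne_zero).mp ?_
  have h1 := Real.add_one_le_exp (2 * c)
  calc b ^ 2 ≤ a ^ 2 * (1 + 2 * c) := h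
    _ ≤ a ^ 2 * Real.exp (2 * c) := by gcongr; linarith
    _ = (a * Real.exp c) ^ 2 := by rw [mul_pow, ← Real.exp_nat_mul]; norm_num

theorem norm_GammaSeq {s : ℂ} {n : ℕ} (hn : 0 < n) :
    ‖Complex.GammaSeq s n‖ = (n : ℝ) ^ s.re * n.factorial /
      ∏ j ∈ Finset.range (n + 1), ‖s + j‖ := by
  rw [Complex.GammaSeq, norm_div, norm_mul, Complex.norm_natCast, norm_prod,
    Complex.norm_natCast_cpow_of_pos hn]

/-- Comparison of the Gamma function at two points of the same height, from a comparison of the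
factors in Euler's product. -/
theorem norm_Gamma_le_of_factors {t a b E : ℝ} (ht : t ≠ 0)
    (hfac : ∀ n : ℕ, 0 < n → ∏ j ∈ Finset.range (n + 1), ‖((b + j : ℝ) : ℂ) + t * I‖ ≤
      (∏ j ∈ Finset.range (n + 1), ‖((a + j : ℝ) : ℂ) + t * I‖) *
        Real.exp (E + (b - a) * Real.log n)) :
    ‖Complex.Gamma ((a : ℂ) + t * I)‖ ≤ Real.exp E * ‖Complex.Gamma ((b : ℂ) + t * I)‖ := by
  have h1 := (Complex.GammaSeq_tendsto_Gamma ((a : ℂ) + t * I)).norm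
  have h2 := ((Complex.GammaSeq_tendsto_Gamma ((b : ℂ) + t * I)).norm).const_mul (Real.exp E)
  refine le_of_tendsto_of_tendsto h1 h2 ?_
  filter_upwards [Filter.eventually_gt_atTop 0] with n hn
  have hn' : (0 : ℝ) < n := by exact_mod_cast hn
  have hpos : ∀ y : ℝ, 0 < ∏ j ∈ Finset.range (n + 1), ‖(y : ℂ) + t * I + j‖ := by
    intro y
    refine Finset.prod_pos fun j _ => norm_pos_iff.mpr fun h => ht ?_
    have := congrArg Complex.im h
    simpa using this
  rw [norm_GammaSeq hn, norm_GammaSeq hn]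
  have e : ∀ y : ℝ, ∏ j ∈ Finset.range (n + 1), ‖((y + j : ℝ) : ℂ) + t * I‖ =
      ∏ j ∈ Finset.range (n + 1), ‖(y : ℂ) + t * I + j‖ := fun y =>
    Finset.prod_congr rfl fun j _ => by push_cast; ring_nf
  have hf := hfac n hn
  rw [e, e] at hf
  have hre : ∀ y : ℝ, ((y : ℂ) + t * I).re = y := fun y => by simp
  rw [hre, hre, ← mul_div_assoc, div_le_div_iff₀ (hpos a) (hpos b)]
  have e3 : (n : ℝ) ^ b = (n : ℝ) ^ a * Real.exp ((b - a) * Real.log n) := by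
    rw [mul_comm (b - a), ← Real.rpow_def_of_pos hn', ← Real.rpow_add hn']
    congr 1; ring
  calc (n : ℝ) ^ a * n.factorial * ∏ j ∈ Finset.range (n + 1), ‖(b : ℂ) + t * I + j‖
      ≤ (n : ℝ) ^ a * n.factorial * ((∏ j ∈ Finset.range (n + 1), ‖(a : ℂ) + t * I + j‖) *
        Real.exp (E + (b - a) * Real.log n)) := by gcongr
    _ = _ := by rw [e3, Real.exp_add]; ring

theorem prod_norm_le {t a b c : ℝ} (n : ℕ) (w : ℕ → ℝ) (ht : t ≠ 0)
    (h : ∀ j : ℕ, (b + j) ^ 2 + t ^ 2 ≤ ((a + j) ^ 2 + t ^ 2) * (1 + 2 * (c * w j))) :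
    ∏ j ∈ Finset.range (n + 1), ‖((b + j : ℝ) : ℂ) + t * I‖ ≤
      (∏ j ∈ Finset.range (n + 1), ‖((a + j : ℝ) : ℂ) + t * I‖) *
        Real.exp (c * ∑ j ∈ Finset.range (n + 1), w j) := by
  rw [Finset.mul_sum, Real.exp_sum, ← Finset.prod_mul_distrib]
  refine Finset.prod_le_prod (fun _ _ => norm_nonneg _) fun j _ => ?_
  refine le_mul_exp_of_sq (norm_pos_iff.mpr fun h => ht ?_) (norm_nonneg _) ?_
  · have := congrArg Complex.im h
    simpa using this
  · rw [norm_sq_add_mul_I, norm_sq_add_mul_I]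
    exact h j

/-- The squared moduli of the `j`-th Euler factors differ by exactly `4h(x + j)`. The bound is
uniform in `t`: to the right of the critical line the extra decay in `|t|` is not needed. -/
theorem norm_Gamma_sub_le {x t h : ℝ} (ht : 1 ≤ |t|) (hh : 0 ≤ h) (hx : h ≤ x) (hx1 : x ≤ 1) :
    ‖Complex.Gamma (((x - h : ℝ) : ℂ) + t * I)‖ ≤
      Real.exp (12 * h) * ‖Complex.Gamma (((x + h : ℝ) : ℂ) + t * I)‖ := by
  have ht0 : t ≠ 0 := abs_pos.mp (lt_of_lt_of_le one_pos ht)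
  have ht2 : 1 ≤ t ^ 2 := by rw [← sq_abs]; nlinarith
  refine norm_Gamma_le_of_factors ht0 fun n hn => ?_
  refine (prod_norm_le (a := x - h) (b := x + h) (c := 2 * h) n (fun j => ((j : ℝ) + 1) / ((j : ℝ) ^ 2 + 1)) ht0
    fun j => ?_).trans ?_
  · have hj : (0 : ℝ) ≤ j := Nat.cast_nonneg j
    have h1 : (j : ℝ) ^ 2 + 1 ≤ (x - h + j) ^ 2 + t ^ 2 := by nlinarith
    have h2 : 1 * (x + j) ≤ (((x - h + j) ^ 2 + t ^ 2) / ((j : ℝ) ^ 2 + 1)) * ((j : ℝ) + 1) := by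
      have : 1 ≤ ((x - h + j) ^ 2 + t ^ 2) / ((j : ℝ) ^ 2 + 1) := by
        rw [one_le_div (by positivity)]; exact h1
      exact mul_le_mul this (by linarith) (by linarith) (by positivity)
    have h3 : ((x - h + j) ^ 2 + t ^ 2) * (1 + 2 * (2 * h * (((j : ℝ) + 1) / ((j : ℝ) ^ 2 + 1)))) =
      ((x - h + j) ^ 2 + t ^ 2) + 4 * h * ((((x - h + j) ^ 2 + t ^ 2) / ((j : ℝ) ^ 2 + 1)) * ((j : ℝ) + 1)) := by
      ring
    rw [h3]
    nlinarith
  · gcongr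
    have h1 := sum_add_div_sq_le n
    have h2 : Real.log ((n : ℝ) + 1) ≤ Real.log n + 1 := by
      have hn' : (1 : ℝ) ≤ n := by exact_mod_cast hn
      have : Real.log ((n : ℝ) + 1) ≤ Real.log (n * 2) :=
        Real.log_le_log (by positivity) (by linarith)
      rw [Real.log_mul (by positivity) (by norm_num)] at this
      have := Real.log_two_lt_d9
      linarith
    nlinarith

/-- Here the growth in `|t|` cannot be dropped. It appears as `log(4 + t²)`, which for `t` of size
`D` is `O(𝓛)` and so negligible beside `log q ≍ 𝓛²`. -/
theorem norm_Gamma_add_le {x t h : ℝ} (ht : 1 ≤ |t|) (hh : 0 ≤ h) (hx : h ≤ x) (hx1 : x ≤ 1) :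
    ‖Complex.Gamma (((x + h : ℝ) : ℂ) + t * I)‖ ≤
      Real.exp (h * (Real.log (4 + t ^ 2) + 6)) *
        ‖Complex.Gamma (((x - h : ℝ) : ℂ) + t * I)‖ := by
  have ht0 : t ≠ 0 := abs_pos.mp (lt_of_lt_of_le one_pos ht)
  refine norm_Gamma_le_of_factors ht0 fun n hn => ?_
  refine (prod_norm_le (a := x + h) (b := x - h) (c := -(2 * h)) n (fun j => (j : ℝ) / (((j : ℝ) + 2) ^ 2 + t ^ 2)) ht0
    fun j => ?_).trans ?_
  · have hj : (0 : ℝ) ≤ j := Nat.cast_nonneg j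
    have h1 : (x + h + j) ^ 2 + t ^ 2 ≤ ((j : ℝ) + 2) ^ 2 + t ^ 2 := by nlinarith
    have h2 : (((x + h + j) ^ 2 + t ^ 2) / (((j : ℝ) + 2) ^ 2 + t ^ 2)) * j ≤ 1 * (x + j) := by
      have : ((x + h + j) ^ 2 + t ^ 2) / (((j : ℝ) + 2) ^ 2 + t ^ 2) ≤ 1 := by
        rw [div_le_one (by positivity)]; exact h1
      gcongr
      linarith
    have h3 : ((x + h + j) ^ 2 + t ^ 2) *
        (1 + 2 * (-(2 * h) * ((j : ℝ) / (((j : ℝ) + 2) ^ 2 + t ^ 2)))) =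
      ((x + h + j) ^ 2 + t ^ 2) -
        4 * h * ((((x + h + j) ^ 2 + t ^ 2) / (((j : ℝ) + 2) ^ 2 + t ^ 2)) * j) := by
      ring
    rw [h3]
    nlinarith
  · gcongr
    have h1 := log_sub_le_sum_div_sq ht n
    nlinarith

theorem norm_rootNumber {q : ℕ} [NeZero q] {ψ : DirichletCharacter ℂ q} (hψ : ψ.IsPrimitive) :
    ‖ψ.rootNumber‖ = 1 := by
  have hq : (0 : ℝ) < q := by exact_mod_cast NeZero.pos q
  have h1 : ‖gaussSum ψ ZMod.stdAddChar‖ = √q := by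
    rw [← norm_gaussSum_sq hψ, Real.sqrt_sq (norm_nonneg _)]
  have h2 : ‖(q : ℂ) ^ (1 / 2 : ℂ)‖ = √q := by
    rw [Complex.norm_natCast_cpow_of_pos (NeZero.pos q), Real.sqrt_eq_rpow]
    norm_num
  rw [DirichletCharacter.rootNumber, norm_div, norm_div, h1, norm_pow, Complex.norm_I, one_pow,
    div_one, h2, div_self (by positivity)]

theorem norm_Gammaℝ (x y : ℝ) : ‖Complex.Gammaℝ ((x : ℂ) + y * I)‖ =
    Real.pi ^ (-x / 2) * ‖Complex.Gamma (((x / 2 : ℝ) : ℂ) + ((y / 2 : ℝ) : ℂ) * I)‖ := by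
  rw [Complex.Gammaℝ_def, norm_mul, Complex.norm_cpow_eq_rpow_re_of_pos Real.pi_pos]
  congr 2
  · simp
  · congr 1; push_cast; ring

theorem norm_Gamma_conj (x y : ℝ) : ‖Complex.Gamma ((x : ℂ) + ((-y : ℝ) : ℂ) * I)‖ =
    ‖Complex.Gamma ((x : ℂ) + y * I)‖ := by
  rw [← Complex.norm_conj (Complex.Gamma ((x : ℂ) + y * I)), ← Complex.Gamma_conj]
  congr 2
  simp

/-- The archimedean part of `Delta`. -/
theorem norm_gammaFactor_div {q : ℕ} [NeZero q] (ψ : DirichletCharacter ℂ q) (σ t : ℝ) :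
    ∃ x : ℝ, 1 / 4 ≤ x ∧ x ≤ 1 ∧
      ‖ψ⁻¹.gammaFactor (1 - (((1 / 2 + σ : ℝ) : ℂ) + t * I)) /
        ψ.gammaFactor (((1 / 2 + σ : ℝ) : ℂ) + t * I)‖ =
      Real.pi ^ σ * (‖Complex.Gamma (((x - σ / 2 : ℝ) : ℂ) + ((t / 2 : ℝ) : ℂ) * I)‖ /
        ‖Complex.Gamma (((x + σ / 2 : ℝ) : ℂ) + ((t / 2 : ℝ) : ℂ) * I)‖) := by
  have key : ∀ a : ℝ, ‖Complex.Gammaℝ (1 - (((1 / 2 + σ : ℝ) : ℂ) + t * I) + a) /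
      Complex.Gammaℝ (((1 / 2 + σ : ℝ) : ℂ) + t * I + a)‖ =
      Real.pi ^ σ * (‖Complex.Gamma (((1 / 4 + a / 2 - σ / 2 : ℝ) : ℂ) + ((t / 2 : ℝ) : ℂ) * I)‖ /
        ‖Complex.Gamma (((1 / 4 + a / 2 + σ / 2 : ℝ) : ℂ) + ((t / 2 : ℝ) : ℂ) * I)‖) := by
    intro a
    have e1 : 1 - (((1 / 2 + σ : ℝ) : ℂ) + t * I) + a =
        ((1 / 2 - σ + a : ℝ) : ℂ) + ((-t : ℝ) : ℂ) * I := by push_cast; ring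
    have e2 : ((1 / 2 + σ : ℝ) : ℂ) + t * I + a = ((1 / 2 + σ + a : ℝ) : ℂ) + t * I := by
      push_cast; ring
    rw [e1, e2, norm_div, norm_Gammaℝ, norm_Gammaℝ, neg_div 2 t, norm_Gamma_conj]
    rw [mul_div_mul_comm, ← Real.rpow_sub Real.pi_pos]
    congr 3
    · ring
    · congr 4; ring
    · congr 4; ring
  have hinv : ψ⁻¹ (-1) = ψ (-1) := by
    have := Ring.inverse_unit (-1 : (ZMod q)ˣ)
    rw [inv_neg_one] at this
    rw [MulChar.inv_apply]
    exact congrArg ψ (by simpa using this)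
  by_cases hE : ψ.Even
  · have hE' : ψ⁻¹.Even := by rw [DirichletCharacter.Even, hinv]; exact hE
    refine ⟨1 / 4, le_rfl, by norm_num, ?_⟩
    rw [hE.gammaFactor_def, hE'.gammaFactor_def]
    have := key 0
    simpa using this
  · have hO : ψ.Odd := ψ.even_or_odd.resolve_left hE
    have hO' : ψ⁻¹.Odd := by rw [DirichletCharacter.Odd, hinv]; exact hO
    refine ⟨3 / 4, by norm_num, by norm_num, ?_⟩
    rw [hO.gammaFactor_def, hO'.gammaFactor_def]
    have := key 1
    norm_num at this ⊢
    exact this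

/-- The factor `q^{-σ}` is the main term. The `8σ` collects `2σ` from `π^σ` and `12h = 6σ` from the
Gamma quotient with `h = σ/2`. -/
theorem norm_Delta_le_of_nonneg {q : ℕ} [NeZero q] {ψ : DirichletCharacter ℂ q}
    (hψ : ψ.IsPrimitive) {σ t : ℝ} (h0 : 0 ≤ σ) (h1 : σ ≤ 1 / 2) (ht : 2 ≤ |t|) :
    ‖Delta ψ (((1 / 2 + σ : ℝ) : ℂ) + t * I)‖ ≤ Real.exp (-σ * Real.log q + 8 * σ) := by
  obtain ⟨x, hx, hx1, hxe⟩ := norm_gammaFactor_div ψ σ t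
  have hq : (0 : ℝ) < q := by exact_mod_cast NeZero.pos q
  have ht' : 1 ≤ |t / 2| := by rw [abs_div, abs_two]; linarith
  have hG := norm_Gamma_sub_le (x := x) (h := σ / 2) ht' (by linarith) (by linarith) hx1
  rw [Delta, norm_mul, norm_mul, norm_rootNumber hψ, one_mul, hxe,
    Complex.norm_natCast_cpow_of_pos (NeZero.pos q)]
  have e1 : (1 / 2 - (((1 / 2 + σ : ℝ) : ℂ) + t * I) : ℂ).re = -σ := by simp
  have e2 : Real.pi ^ σ ≤ Real.exp (2 * σ) := by
    rw [Real.rpow_def_of_pos Real.pi_pos]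
    gcongr
    rw [Real.log_le_iff_le_exp Real.pi_pos]
    have := Real.add_one_le_exp (1 : ℝ)
    have h4 : Real.exp 2 = Real.exp 1 * Real.exp 1 := by rw [← Real.exp_add]; norm_num
    have := Real.pi_le_four
    nlinarith
  have e3 : ‖Complex.Gamma (((x - σ / 2 : ℝ) : ℂ) + ((t / 2 : ℝ) : ℂ) * I)‖ /
        ‖Complex.Gamma (((x + σ / 2 : ℝ) : ℂ) + ((t / 2 : ℝ) : ℂ) * I)‖ ≤ Real.exp (6 * σ) := by
    refine div_le_of_le_mul₀ (norm_nonneg _) (Real.exp_nonneg _) (hG.trans (le_of_eq ?_))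
    congr 2; ring
  rw [e1]
  calc (q : ℝ) ^ (-σ) * _ ≤ Real.exp (-σ * Real.log q) * (Real.exp (2 * σ) * Real.exp (6 * σ)) := by
        rw [Real.rpow_def_of_pos hq, mul_comm (Real.log _)]
        gcongr
    _ = _ := by rw [← Real.exp_add, ← Real.exp_add]; congr 1; ring

theorem norm_Delta_le_of_nonpos {q : ℕ} [NeZero q] {ψ : DirichletCharacter ℂ q}
    (hψ : ψ.IsPrimitive) {σ t : ℝ} (h0 : 0 ≤ σ) (h1 : σ ≤ 1 / 2) (ht : 2 ≤ |t|) :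
    ‖Delta ψ (((1 / 2 + -σ : ℝ) : ℂ) + t * I)‖ ≤
      Real.exp (σ * (Real.log q + Real.log (4 + t ^ 2) + 6)) := by
  obtain ⟨x, hx, hx1, hxe⟩ := norm_gammaFactor_div ψ (-σ) t
  have hq : (0 : ℝ) < q := by exact_mod_cast NeZero.pos q
  have ht' : 1 ≤ |t / 2| := by rw [abs_div, abs_two]; linarith
  have hG := norm_Gamma_add_le (x := x) (h := σ / 2) ht' (by linarith) (by linarith) hx1
  rw [Delta, norm_mul, norm_mul, norm_rootNumber hψ, one_mul, hxe,
    Complex.norm_natCast_cpow_of_pos (NeZero.pos q)]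
  have e1 : (1 / 2 - (((1 / 2 + -σ : ℝ) : ℂ) + t * I) : ℂ).re = σ := by simp
  have e2 : Real.pi ^ (-σ) ≤ 1 :=
    Real.rpow_le_one_of_one_le_of_nonpos (by have := Real.pi_gt_three; linarith) (by linarith)
  have hlog : Real.log (4 + (t / 2) ^ 2) ≤ Real.log (4 + t ^ 2) := by
    apply Real.log_le_log (by positivity); nlinarith [sq_nonneg t]
  have hlog0 : 0 ≤ Real.log (4 + t ^ 2) := Real.log_nonneg (by nlinarith [sq_nonneg t])
  have e3 : ‖Complex.Gamma (((x - -σ / 2 : ℝ) : ℂ) + ((t / 2 : ℝ) : ℂ) * I)‖ /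
        ‖Complex.Gamma (((x + -σ / 2 : ℝ) : ℂ) + ((t / 2 : ℝ) : ℂ) * I)‖ ≤
        Real.exp (σ * (Real.log (4 + t ^ 2) + 6)) := by
    rw [neg_div, sub_neg_eq_add, ← sub_eq_add_neg]
    refine div_le_of_le_mul₀ (norm_nonneg _) (Real.exp_nonneg _) (hG.trans ?_)
    have := Real.log_nonneg (x := 4 + (t / 2) ^ 2) (by nlinarith [sq_nonneg (t / 2)])
    have := mul_le_mul (show σ / 2 ≤ σ by linarith) (add_le_add_left hlog 6) (by linarith) h0
    gcongr Real.exp ?_ * _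
  rw [e1]
  calc (q : ℝ) ^ σ * _ ≤ Real.exp (σ * Real.log q) * (1 *
        Real.exp (σ * (Real.log (4 + t ^ 2) + 6))) := by
        rw [Real.rpow_def_of_pos hq, mul_comm (Real.log _)]
        gcongr
    _ = _ := by rw [one_mul, ← Real.exp_add]; congr 1; ring

end LandauSiegel

/-! ### Complex analysis: Harnack and Jensen inequalities, conjugation of `L`-functions. -/

namespace LandauSiegel

theorem exists_log_on_ball {f : ℂ → ℂ} {c : ℂ} {r : ℝ} (hr : 0 < r) (hf : Differentiable ℂ f)
    (h0 : ∀ z ∈ Metric.ball c r, f z ≠ 0) :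
    ∃ g : ℂ → ℂ, DifferentiableOn ℂ g (Metric.ball c r) ∧ g c = 0 ∧
      ∀ z ∈ Metric.ball c r, f z = f c * exp (g z) := by
  have hd : DifferentiableOn ℂ (fun z => deriv f z / f z) (Metric.ball c r) :=
    (hf.deriv.differentiableOn).div hf.differentiableOn h0
  obtain ⟨g, hgc, hg⟩ := hd.isExactOn_ball.with_val_at c 0
  have hc : c ∈ Metric.ball c r := Metric.mem_ball_self hr
  refine ⟨g, fun z hz => (hg z hz).differentiableAt.differentiableWithinAt, hgc, ?_⟩
  have hconst : ∀ z ∈ Metric.ball c r, f z * exp (-g z) = f c * exp (-g c) := by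
    intro z hz
    have hder : ∀ w ∈ Metric.ball c r, HasDerivAt (fun z => f z * exp (-g z)) 0 w := by
      intro w hw
      have := (hf w).hasDerivAt.mul ((hg w hw).neg.cexp)
      refine this.congr_deriv ?_
      have := h0 w hw
      field_simp
      ring
    exact (convex_ball c r).is_const_of_fderivWithin_eq_zero (𝕜 := ℂ)
      (fun w hw => (hder w hw).differentiableAt.differentiableWithinAt)
      (fun w hw => by
        rw [fderivWithin_of_isOpen Metric.isOpen_ball hw]
        ext
        simpa using (hder w hw).deriv) hz hc
  intro z hz
  have := hconst z hz
  rw [hgc, neg_zero, exp_zero, mul_one] at this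
  rw [← this, mul_assoc, ← exp_add, neg_add_cancel, exp_zero, mul_one]

/-- A Harnack type inequality: a holomorphic function with bounds above and below on a disc is
almost constant near the centre. -/
theorem norm_le_mul_exp_of_bounds {f : ℂ → ℂ} {c z : ℂ} {r m M : ℝ} (hr : 0 < r)
    (hf : Differentiable ℂ f) (hm : 0 < m) (hmM : m < M)
    (hb : ∀ w ∈ Metric.ball c r, m ≤ ‖f w‖ ∧ ‖f w‖ ≤ M) (hz : ‖z - c‖ ≤ r / 2) :
    ‖f z‖ ≤ ‖f c‖ * Real.exp (4 * Real.log (M / m) * (‖z - c‖ / r)) := by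
  obtain ⟨g, hgd, hgc, hg⟩ := exists_log_on_ball hr hf fun w hw =>
    norm_pos_iff.mp (hm.trans_le (hb w hw).1)
  have hA : 0 < Real.log (M / m) := Real.log_pos ((one_lt_div hm).mpr hmM)
  have hcb := hb c (Metric.mem_ball_self hr)
  have hfc : 0 < ‖f c‖ := hm.trans_le hcb.1
  have hmaps : ∀ w, w ∈ Metric.ball (0 : ℂ) r → w + c ∈ Metric.ball c r := by
    intro w hw
    simpa [dist_eq_norm] using hw
  have hzr : z - c ∈ Metric.ball (0 : ℂ) r := by
    rw [mem_ball_zero_iff]; linarith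
  -- Applied to `g = log(f / f(c))`, which vanishes at the centre and has real part at most
  -- `log(M/m)`.
  have hbc := Complex.borelCaratheodory_zero (f := fun w => g (w + c)) (M := Real.log (M / m))
    (R := r) (z := z - c) hA (hgd.comp (by fun_prop) hmaps) (fun w hw => ?_) hr hzr (by simpa using hgc)
  · simp only [sub_add_cancel] at hbc
    have hzb : z ∈ Metric.ball c r := by simpa using hmaps _ hzr
    rw [hg z hzb, norm_mul, Complex.norm_exp]
    gcongr
    refine (Complex.re_le_norm _).trans (hbc.trans ?_)
    rw [div_le_iff₀ (by linarith)]
    have : 4 * Real.log (M / m) * (‖z - c‖ / r) * (r - ‖z - c‖) =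
      2 * Real.log (M / m) * ‖z - c‖ * (2 * (r - ‖z - c‖) / r) := by ring
    rw [this]
    refine le_mul_of_one_le_right (by positivity) ?_
    rw [one_le_div hr]
    linarith
  · simp only [Set.mem_ofPred_eq]
    have h1 := hb _ (hmaps w hw)
    have h2 := congrArg norm (hg _ (hmaps w hw))
    rw [norm_mul, Complex.norm_exp] at h2
    rw [Real.le_log_iff_exp_le (div_pos (hm.trans hmM) hm), le_div_iff₀ hm]
    calc Real.exp (g (w + c)).re * m ≤ Real.exp (g (w + c)).re * ‖f c‖ := by
          gcongr; exact hcb.1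
      _ = ‖f (w + c)‖ := by rw [h2, mul_comm]
      _ ≤ M := h1.2

/-- The number of distinct zeros in a disc, by Jensen's inequality. -/
theorem card_zeros_le {f : ℂ → ℂ} {c : ℂ} {r M : ℝ} (hr : 0 < r) (hM : 1 ≤ M)
    (hf : AnalyticOnNhd ℂ f (Metric.closedBall c (3 * r))) (hc : f c ≠ 0)
    (hb : ∀ z ∈ Metric.sphere c (3 * r), ‖f z‖ ≤ M * ‖f c‖) (Z : Finset ℂ)
    (hZ : ∀ z ∈ Z, z ∈ Metric.closedBall c r ∧ f z = 0) :
    (Z.card : ℝ) ≤ Real.log M := by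
  have hfc : 0 < ‖f c‖ := norm_pos_iff.mpr hc
  set F : ℂ → ℂ := fun z => f z / f c with hF
  have hFan : AnalyticOnNhd ℂ F (Metric.closedBall c (3 * r)) := hf.div analyticOnNhd_const
    fun _ _ => hc
  have hFc : F c = 1 := div_self hc
  have h3r : |3 * r| = 3 * r := abs_of_pos (by positivity)
  have hr' : |r| = r := abs_of_pos hr
  have hsub : Metric.closedBall c r ⊆ Metric.closedBall c (3 * r) :=
    Metric.closedBall_subset_closedBall (by linarith)
  have hJ := AnalyticOnNhd.sum_divisor_le (c := c) (r := r) (R := 3 * r) (M := M) (f := F)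
    (by rwa [hr']) (by rw [hr', h3r]; linarith) hM (by rwa [h3r]) (by rw [hFc]; exact one_ne_zero)
    (by
      intro z hz
      rw [h3r] at hz
      rw [hF, norm_div, div_le_iff₀ hfc]
      exact hb z hz)
  rw [hr', hFc, norm_one, div_one, mul_div_assoc, div_self hr.ne', mul_one] at hJ
  have hFan' : AnalyticOnNhd ℂ F (Metric.closedBall c r) := hFan.mono hsub
  have hge : ∀ z ∈ Z, 1 ≤ MeromorphicOn.divisor F (Metric.closedBall c r) z := by
    intro z hz
    rw [MeromorphicOn.AnalyticOnNhd.divisor_apply hFan' (hZ z hz).1]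
    have hz0 : F z = 0 := by rw [hF]; simp [(hZ z hz).2]
    have hpre : IsPreconnected (Metric.closedBall c r) := (convex_closedBall c r).isPreconnected
    have htop : analyticOrderAt F z ≠ ⊤ := by
      intro htop
      have h1 : Set.EqOn F 0 (Metric.closedBall c r) :=
        hFan'.eqOn_zero_of_preconnected_of_eventuallyEq_zero hpre (hZ z hz).1
          (analyticOrderAt_eq_top.mp htop)
      have := h1 (Metric.mem_closedBall_self hr.le)
      rw [hFc] at this
      exact one_ne_zero this
    have hne : analyticOrderAt F z ≠ 0 := by
      rw [(hFan' z (hZ z hz).1).analyticOrderAt_ne_zero]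
      exact hz0
    have : analyticOrderNatAt F z ≠ 0 := by
      intro h
      apply hne
      rw [← Nat.cast_analyticOrderNatAt htop, h, Nat.cast_zero]
    have h1 : ((analyticOrderAt F z).map (Nat.cast : ℕ → ℤ)).untop₀ = analyticOrderNatAt F z := by
      rw [← Nat.cast_analyticOrderNatAt htop]
      rfl
    rw [h1]
    exact_mod_cast Nat.one_le_iff_ne_zero.mpr this
  have hnn : ∀ z, 0 ≤ MeromorphicOn.divisor F (Metric.closedBall c r) z :=
    MeromorphicOn.AnalyticOnNhd.divisor_nonneg hFan'
  have hfin : (Function.support (MeromorphicOn.divisor F (Metric.closedBall c r))).Finite :=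
    (MeromorphicOn.divisor F (Metric.closedBall c r)).finiteSupport (isCompact_closedBall c r)
  have hcard : (Z.card : ℤ) ≤ ∑ᶠ u, MeromorphicOn.divisor F (Metric.closedBall c r) u := by
    classical
    rw [finsum_eq_sum_of_support_subset (s := hfin.toFinset ∪ Z) _ (by
      intro x hx; simp at hx ⊢; exact Or.inl hx)]
    calc (Z.card : ℤ) = ∑ z ∈ Z, 1 := by simp
      _ ≤ ∑ z ∈ Z, MeromorphicOn.divisor F (Metric.closedBall c r) z := Finset.sum_le_sum hge
      _ ≤ _ := Finset.sum_le_sum_of_subset_of_nonneg Finset.subset_union_right fun z _ _ => hnn z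
  -- The ratio `3` of the radii is chosen so that the denominator in Jensen's bound can be dropped.
  have h3 : 1 ≤ Real.log 3 := by
    rw [Real.le_log_iff_exp_le (by norm_num)]
    exact Real.exp_one_lt_d9.le.trans (by norm_num)
  calc (Z.card : ℝ) ≤ ((∑ᶠ u, MeromorphicOn.divisor F (Metric.closedBall c r) u : ℤ) : ℝ) := by
        exact_mod_cast hcard
    _ ≤ Real.log M / Real.log 3 := hJ
    _ ≤ Real.log M := div_le_self (Real.log_nonneg hM) h3

theorem inv_apply_eq_conj {q : ℕ} (ψ : DirichletCharacter ℂ q) (a : ZMod q) :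
    ψ⁻¹ a = (starRingEnd ℂ) (ψ a) := by
  rw [starRingEnd_apply, ← MulChar.star_apply']

theorem natCast_cpow_conj (n : ℕ) (s : ℂ) :
    (n : ℂ) ^ (starRingEnd ℂ) s = (starRingEnd ℂ) ((n : ℂ) ^ s) := by
  have h := Complex.cpow_conj (n : ℂ) s (by
    rw [Complex.natCast_arg]; exact Real.pi_pos.ne)
  rw [Complex.conj_natCast] at h
  exact h

/-- Both sides are entire up to conjugation and agree for `Re s > 1` by the Dirichlet series. -/
theorem LFunction_conj {q : ℕ} [NeZero q] {ψ : DirichletCharacter ℂ q} (hψ : ψ ≠ 1) (s : ℂ) :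
    ψ.LFunction ((starRingEnd ℂ) s) = (starRingEnd ℂ) (ψ⁻¹.LFunction s) := by
  have hψ' : ψ⁻¹ ≠ 1 := inv_ne_one.mpr hψ
  have h1 : Differentiable ℂ ((starRingEnd ℂ) ∘ ψ.LFunction ∘ (starRingEnd ℂ)) :=
    fun z => differentiableAt_conj_conj_iff.mpr (DirichletCharacter.differentiable_LFunction hψ _)
  have h2 : Differentiable ℂ ψ⁻¹.LFunction := DirichletCharacter.differentiable_LFunction hψ'
  have h3 : (starRingEnd ℂ) ∘ ψ.LFunction ∘ (starRingEnd ℂ) = ψ⁻¹.LFunction := by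
    refine AnalyticOnNhd.eq_of_eventuallyEq (z₀ := 2) (analyticOnNhd_univ_iff_differentiable.mpr h1)
      (analyticOnNhd_univ_iff_differentiable.mpr h2) ?_
    have hopen : {s : ℂ | 1 < s.re} ∈ nhds (2 : ℂ) :=
      (isOpen_lt continuous_const Complex.continuous_re).mem_nhds (by simp)
    filter_upwards [hopen] with z hz
    have hz' : 1 < ((starRingEnd ℂ) z).re := by simpa using hz
    simp only [Function.comp_apply]
    rw [DirichletCharacter.LFunction_eq_LSeries _ hz', DirichletCharacter.LFunction_eq_LSeries _ hz,
      LSeries, LSeries, Complex.conj_tsum]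
    refine tsum_congr fun n => ?_
    rcases eq_or_ne n 0 with rfl | hn
    · simp
    · rw [LSeries.term_of_ne_zero hn, LSeries.term_of_ne_zero hn, natCast_cpow_conj, map_div₀,
        Complex.conj_conj, inv_apply_eq_conj]
  have := congrFun h3 s
  rw [← this]
  simp

end LandauSiegel

/-! ### Bounds for `F` and `Δ₁` for characters in `Ψ`. -/

namespace LandauSiegel

/-- Writing `n = ab` and relaxing `ab ≤ N` to `a, b ≤ N` gives the square of a harmonic sum. -/
theorem sum_divisorsAntidiagonal_le (N : ℕ) :
    ∑ n ∈ Finset.Icc 1 N, (n.divisorsAntidiagonal.card : ℝ) / n ≤ (1 + Real.log N) ^ 2 := by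
  set T := (Finset.Icc 1 N ×ˢ Finset.Icc 1 N).filter fun p : ℕ × ℕ => p.1 * p.2 ≤ N with hT
  have hmaps : ∀ p ∈ T, p.1 * p.2 ∈ Finset.Icc 1 N := by
    intro p hp
    simp only [hT, Finset.mem_filter, Finset.mem_product, Finset.mem_Icc] at hp
    exact Finset.mem_Icc.mpr ⟨Nat.mul_pos hp.1.1.1 hp.1.2.1, hp.2⟩
  have hfib : ∀ n ∈ Finset.Icc 1 N, T.filter (fun p => p.1 * p.2 = n) = n.divisorsAntidiagonal := by
    intro n hn
    obtain ⟨hn1, hn2⟩ := Finset.mem_Icc.mp hn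
    ext p
    simp only [hT, Finset.mem_filter, Finset.mem_product, Finset.mem_Icc,
      Nat.mem_divisorsAntidiagonal]
    constructor
    · rintro ⟨_, h⟩
      exact ⟨h, by omega⟩
    · rintro ⟨h, h0⟩
      have h1 : 0 < p.1 := Nat.pos_of_ne_zero fun h' => h0 (by rw [← h, h', zero_mul])
      have h2 : 0 < p.2 := Nat.pos_of_ne_zero fun h' => h0 (by rw [← h, h', mul_zero])
      have h3 : p.1 ≤ p.1 * p.2 := Nat.le_mul_of_pos_right _ h2
      have h4 : p.2 ≤ p.1 * p.2 := Nat.le_mul_of_pos_left _ h1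
      exact ⟨⟨⟨⟨h1, by omega⟩, ⟨h2, by omega⟩⟩, by omega⟩, h⟩
  have hH : ∑ a ∈ Finset.Icc 1 N, (a : ℝ)⁻¹ ≤ 1 + Real.log N := by
    have := harmonic_le_one_add_log N
    rw [harmonic_eq_sum_Icc] at this
    push_cast at this
    exact this
  have hH0 : 0 ≤ ∑ a ∈ Finset.Icc 1 N, (a : ℝ)⁻¹ := Finset.sum_nonneg fun _ _ => by positivity
  calc ∑ n ∈ Finset.Icc 1 N, (n.divisorsAntidiagonal.card : ℝ) / n
      = ∑ n ∈ Finset.Icc 1 N, ∑ p ∈ T with p.1 * p.2 = n, ((p.1 : ℝ)⁻¹ * (p.2 : ℝ)⁻¹) := by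
        refine Finset.sum_congr rfl fun n hn => ?_
        rw [div_eq_mul_inv, ← nsmul_eq_mul, ← Finset.sum_const, ← hfib n hn]
        refine Finset.sum_congr rfl fun p hp => ?_
        rw [← (Finset.mem_filter.mp hp).2, Nat.cast_mul, mul_inv]
    _ = ∑ p ∈ T, ((p.1 : ℝ)⁻¹ * (p.2 : ℝ)⁻¹) := Finset.sum_fiberwise_of_maps_to hmaps _
    _ ≤ ∑ p ∈ Finset.Icc 1 N ×ˢ Finset.Icc 1 N, ((p.1 : ℝ)⁻¹ * (p.2 : ℝ)⁻¹) :=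
        Finset.sum_le_sum_of_subset_of_nonneg (Finset.filter_subset _ _)
          fun _ _ _ => by positivity
    _ = (∑ a ∈ Finset.Icc 1 N, (a : ℝ)⁻¹) ^ 2 := by rw [Finset.sum_product, sq, Finset.sum_mul_sum]
    _ ≤ _ := by gcongr

variable {D : ℕ} {χ : DirichletCharacter ℂ D}

theorem nu_conj (hχ : χ.IsQuadratic) (n : ℕ) : (starRingEnd ℂ) (nu χ n) = nu χ n := by
  rw [nu, map_sum]
  refine Finset.sum_congr rfl fun p _ => ?_
  rcases hχ (p.2 : ZMod D) with h | h | h <;> simp [h]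

theorem norm_nu_le (n : ℕ) : ‖nu χ n‖ ≤ n.divisorsAntidiagonal.card := by
  refine (norm_sum_le _ _).trans ((Finset.sum_le_card_nsmul _ _ 1 fun p _ => ?_).trans ?_)
  · exact DirichletCharacter.norm_le_one χ _
  · simp

/-- Since `χ` is real, `ν` is real, so the dual term is the conjugate of `F(·, ψ)` at the mirror
image `1 - s̄` of `s` in the critical line. Only `F(·, ψ)` then needs to be controlled. -/
theorem F_inv_one_sub {q : ℕ} (hχ : χ.IsQuadratic) (ψ : DirichletCharacter ℂ q) (s : ℂ) :
    F χ ψ⁻¹ (1 - s) = (starRingEnd ℂ) (F χ ψ (1 - (starRingEnd ℂ) s)) := by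
  rw [F, F, map_sum]
  refine Finset.sum_congr rfl fun n _ => ?_
  rw [map_div₀, map_mul, nu_conj hχ, inv_apply_eq_conj, ← natCast_cpow_conj, map_sub, map_one,
    Complex.conj_conj]

theorem differentiable_F {q : ℕ} (ψ : DirichletCharacter ℂ q) : Differentiable ℂ (F χ ψ) := by
  intro s
  unfold F
  refine DifferentiableAt.fun_sum fun n hn => ?_
  have hn0 : (n : ℂ) ≠ 0 := by
    have := (Finset.mem_Icc.mp hn).1
    exact_mod_cast (by omega : n ≠ 0)
  refine (differentiableAt_const _).div (differentiableAt_id.const_cpow (Or.inl hn0)) ?_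
  rw [Ne, Complex.cpow_eq_zero_iff]
  tauto

/-- The trivial bound for `F`. -/
theorem norm_F_le {q : ℕ} (hD : 1 ≤ D) (ψ : DirichletCharacter ℂ q) {σ : ℝ} (hσ : 0 ≤ σ) {s : ℂ}
    (hs : s.re = 1 / 2 - σ) :
    ‖F χ ψ s‖ ≤ Real.exp ((5 / 2 + 5 * σ) * logD D) * (1 + 5 * logD D) ^ 2 := by
  have hD' : (0 : ℝ) < D := by exact_mod_cast hD
  have hlog : Real.log ((D ^ 5 : ℕ) : ℝ) = 5 * logD D := by
    push_cast; rw [Real.log_pow, logD]; norm_num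
  rw [F]
  calc _ ≤ ∑ n ∈ Finset.Icc 1 (D ^ 5), Real.exp ((5 / 2 + 5 * σ) * logD D) *
        ((n.divisorsAntidiagonal.card : ℝ) / n) := by
        refine norm_sum_le_of_le _ fun n hn => ?_
        obtain ⟨hn1, hn2⟩ := Finset.mem_Icc.mp hn
        have hn0 : (0 : ℝ) < n := by exact_mod_cast hn1
        have hn2' : (n : ℝ) ≤ ((D ^ 5 : ℕ) : ℝ) := by exact_mod_cast hn2
        rw [norm_div, norm_mul, Complex.norm_natCast_cpow_of_pos hn1, hs]
        -- A full factor `1/n` is split off, leaving the sum of `d(n)/n`; the remaining `n^{1/2+σ}`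
        -- is bounded by its value at `D^5`.
        have e1 : (n : ℝ) ^ (1 / 2 - σ) = n / (n : ℝ) ^ (1 / 2 + σ) := by
          rw [eq_div_iff (by positivity), ← Real.rpow_add hn0]
          norm_num
        have e2 : (n : ℝ) ^ (1 / 2 + σ) ≤ Real.exp ((5 / 2 + 5 * σ) * logD D) := by
          calc (n : ℝ) ^ (1 / 2 + σ) ≤ ((D ^ 5 : ℕ) : ℝ) ^ (1 / 2 + σ) := by gcongr
            _ = _ := by
              rw [Real.rpow_def_of_pos (by positivity), hlog]
              congr 1; ring
        have e3 : ‖nu χ n‖ * ‖ψ (n : ZMod q)‖ ≤ n.divisorsAntidiagonal.card * 1 :=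
          mul_le_mul (norm_nu_le n) (DirichletCharacter.norm_le_one ψ _) (norm_nonneg _)
            (Nat.cast_nonneg _)
        rw [e1, div_div_eq_mul_div, mul_comm (Real.exp _), div_mul_eq_mul_div]
        gcongr
        exact e3.trans (mul_one _).le
    _ ≤ _ := by
        rw [← Finset.mul_sum]
        gcongr
        have := sum_divisorsAntidiagonal_le (D ^ 5)
        rwa [hlog] at this

theorem logD_le_of_large (hL : 101 ≤ Real.log (logD D)) : 101 ≤ logD D := by
  by_contra! h
  rcases le_or_gt (logD D) 0 with h0 | h0
  · have h1 : 0 ≤ logD D := Real.log_natCast_nonneg D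
    have : logD D = 0 := le_antisymm h0 h1
    rw [this, Real.log_zero] at hL
    linarith
  · have := Real.log_le_sub_one_of_pos h0
    linarith

theorem exp_logD (hD : 1 ≤ D) : Real.exp (logD D) = D := Real.exp_log (by exact_mod_cast hD)

theorem le_log_modulus {p : Chars} (hp : p ∈ Psi D χ) :
    logD D ^ 2 ≤ Real.log (p.1 : ℕ) ∧ Real.log (p.1 : ℕ) ≤ logD D ^ 2 + 1 := by
  have hq : (0 : ℝ) < (p.1 : ℕ) := by exact_mod_cast p.1.pos
  constructor
  · rw [Real.le_log_iff_exp_le hq]; exact hp.1.le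
  · rw [Real.log_le_iff_le_exp hq, Real.exp_add, mul_comm]
    refine hp.2.1.le.trans ?_
    have := Real.add_one_le_exp (1 : ℝ)
    unfold Q
    gcongr
    linarith

section Psi

variable [NeZero D]

theorem le_log_lcm {p : Chars} (hp : p ∈ Psi D χ) :
    logD D ^ 2 ≤ Real.log (Nat.lcm p.1 D : ℕ) ∧
      Real.log (Nat.lcm p.1 D : ℕ) ≤ logD D ^ 2 + 1 + logD D := by
  obtain ⟨h1, h2⟩ := le_log_modulus hp
  have hq : (0 : ℝ) < (p.1 : ℕ) := by exact_mod_cast p.1.pos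
  have hD : (0 : ℝ) < D := by exact_mod_cast NeZero.pos D
  constructor
  · refine h1.trans (Real.log_le_log hq ?_)
    exact_mod_cast Nat.le_of_dvd (Nat.lcm_pos p.1.pos (NeZero.pos D)) (Nat.dvd_lcm_left _ _)
  · refine (Real.log_le_log (by exact_mod_cast Nat.lcm_pos p.1.pos (NeZero.pos D)) (y := (p.1 : ℕ) * D) ?_).trans ?_
    · exact_mod_cast Nat.le_of_dvd (Nat.mul_pos p.1.pos (NeZero.pos D)) (Nat.lcm_dvd_mul _ _)
    · rw [Real.log_mul hq.ne' hD.ne']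
      unfold logD at *
      linarith

theorem norm_Delta1_le_of_nonneg {p : Chars} (hp : p ∈ Psi D χ) {σ t : ℝ} (h0 : 0 ≤ σ)
    (h1 : σ ≤ 1 / 2) (ht : 2 ≤ |t|) :
    ‖Delta1 χ p.2 (((1 / 2 + σ : ℝ) : ℂ) + t * I)‖ ≤
      Real.exp (-(2 * logD D ^ 2 - 16) * σ) := by
  have a1 := norm_Delta_le_of_nonneg hp.2.2.2.2.1 h0 h1 ht
  have a2 := norm_Delta_le_of_nonneg hp.2.2.2.2.2 h0 h1 ht
  have b1 := (le_log_modulus hp).1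
  have b2 := (le_log_lcm hp).1
  rw [Delta1, norm_mul]
  refine (mul_le_mul a1 a2 (norm_nonneg _) (Real.exp_nonneg _)).trans ?_
  rw [← Real.exp_add]
  gcongr
  nlinarith

/-- The two moduli give `2 𝓛² σ`; the extra `𝓛² σ` absorbs the `O(𝓛)` terms from `log D` and `log(4
+ t²)`. -/
theorem norm_Delta1_le_of_nonpos (hL : 101 ≤ logD D) {p : Chars} (hp : p ∈ Psi D χ) {σ t : ℝ}
    (h0 : 0 ≤ σ) (h1 : σ ≤ 1 / 2) (ht : 2 ≤ |t|) (ht' : |t| ≤ 2 * D) :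
    ‖Delta1 χ p.2 (((1 / 2 + -σ : ℝ) : ℂ) + t * I)‖ ≤ Real.exp (3 * logD D ^ 2 * σ) := by
  have a1 := norm_Delta_le_of_nonpos hp.2.2.2.2.1 h0 h1 ht
  have a2 := norm_Delta_le_of_nonpos hp.2.2.2.2.2 h0 h1 ht
  have b1 := (le_log_modulus hp).2
  have b2 := (le_log_lcm hp).2
  have hD1 : 1 ≤ D := NeZero.pos D
  have hD : (1 : ℝ) ≤ D := by exact_mod_cast hD1
  have hlog : Real.log (4 + t ^ 2) ≤ 7 + 2 * logD D := by
    rw [Real.log_le_iff_le_exp (by positivity), Real.exp_add, two_mul, Real.exp_add, exp_logD hD1]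
    have h8 : (8 : ℝ) ≤ Real.exp 7 := by have := Real.add_one_le_exp (7 : ℝ); linarith
    have : t ^ 2 ≤ (2 * D) ^ 2 := by rw [← sq_abs]; gcongr
    nlinarith
  rw [Delta1, norm_mul]
  refine (mul_le_mul a1 a2 (norm_nonneg _) (Real.exp_nonneg _)).trans ?_
  rw [← Real.exp_add]
  gcongr
  rw [← mul_add, mul_comm]
  gcongr
  nlinarith

end Psi

end LandauSiegel

/-! ### Zeros for `ψ ∈ Ψ*`: distance from the critical line and local number. -/

namespace LandauSiegel

variable {D : ℕ} {χ : DirichletCharacter ℂ D}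

theorem sub_s0_re (s : ℂ) : (s - s0 D).re = s.re - 1 / 2 := by simp [s0]

theorem sub_s0_im (s : ℂ) : (s - s0 D).im = s.im - D := by simp [s0]

theorem alpha_rpow_half (h : 0 ≤ logD D) : alpha D ^ (1 / 2 : ℝ) = (logD D)⁻¹ := by
  rw [← Real.sqrt_eq_rpow, alpha, ← inv_pow, Real.sqrt_sq (inv_nonneg.mpr h)]

section Star

variable [NeZero D]

/-- The lower bound is where `G` enters: `|F G| ≥ 1/2` and `|G|` is bounded. The condition `-2/𝓛` is
the left edge `-2 α^{1/2}` of `Omega1`. -/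
theorem F_bounds (hl : 101 ≤ Real.log (logD D)) {p : Chars} (hp : p ∈ PsiStar D χ) {s : ℂ}
    (h1 : -(2 / logD D) < s.re - 1 / 2) (h2 : s.re - 1 / 2 < 1)
    (h3 : |s.im - D| < 1 + 20 * logD D) :
    1 / (2 * (logD D ^ 3 * Real.log (logD D))) ≤ ‖F χ p.2 s‖ ∧
      ‖F χ p.2 s‖ ≤ logD D ^ 3 * Real.log (logD D) := by
  have hL := logD_le_of_large hl
  have hs : s ∈ Omega1 D := by
    simp only [Omega1, Set.mem_ofPred_eq, sub_s0_re, sub_s0_im]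
    refine ⟨?_, h2, h3⟩
    rw [alpha_rpow_half (by linarith)]
    rw [div_eq_mul_inv] at h1
    linarith
  obtain ⟨_, ⟨c1, hc1, hb1⟩, ⟨c2, hc2, hb2⟩, _⟩ := hp
  have b1 := (hb1 s hs).trans_lt hc1
  have b2 := (hb2 s hs).trans_lt hc2
  simp only at b1 b2
  have hF0 := norm_nonneg (F χ p.2 s)
  have hG0 := norm_nonneg (G χ p.2 s)
  refine ⟨?_, by linarith⟩
  have hM : 0 < logD D ^ 3 * Real.log (logD D) := by positivity
  have h4 : 1 / 2 ≤ ‖F χ p.2 s‖ * ‖G χ p.2 s‖ := by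
    rw [← norm_mul]
    have := norm_sub_norm_le (1 : ℂ) (1 - F χ p.2 s * G χ p.2 s)
    rw [sub_sub_cancel, norm_one, norm_sub_rev] at this
    linarith
  rw [div_le_iff₀ (by positivity)]
  have : ‖F χ p.2 s‖ * ‖G χ p.2 s‖ ≤ ‖F χ p.2 s‖ * (logD D ^ 3 * Real.log (logD D)) := by
    gcongr; linarith
  linarith

/-- Harnack on a disc of radius `1/𝓛`, where the ratio of the upper to the lower bound for `|F|` is
at most `𝓛⁸`. Over a distance `O(α)` the exponent is `O(log 𝓛 / 𝓛)`, so `F` is nearly constant on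
the scale on which `Δ₁` varies. -/
theorem norm_F_le_near (hl : 101 ≤ Real.log (logD D)) (hl2 : 2000 * Real.log (logD D) ≤ logD D)
    {p : Chars} (hp : p ∈ PsiStar D χ) {c z : ℂ} (h1 : -(1 / logD D) ≤ c.re - 1 / 2)
    (h2 : c.re - 1 / 2 ≤ 1 / 2) (h3 : |c.im - D| ≤ 2) (hz : ‖z - c‖ ≤ 1 / (2 * logD D)) :
    ‖F χ p.2 z‖ ≤ ‖F χ p.2 c‖ * Real.exp (32 * Real.log (logD D) * logD D * ‖z - c‖) := by
  have hL := logD_le_of_large hl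
  set L := logD D with hLdef
  set l := Real.log L with hldef
  have hL0 : 0 < L := by linarith
  have hM1 : 1 ≤ L ^ 3 * l := one_le_mul_of_one_le_of_one_le (one_le_pow₀ (by linarith)) (by linarith)
  have hLinv : 1 / L ≤ 1 / 101 := one_div_le_one_div_of_le (by norm_num) hL
  have key := norm_le_mul_exp_of_bounds (f := F χ p.2) (c := c) (z := z) (r := 1 / L)
    (m := 1 / (2 * (L ^ 3 * l))) (M := L ^ 3 * l) (by positivity) (differentiable_F p.2)
    (by positivity) (by
      rw [div_lt_iff₀ (by positivity)]; nlinarith) (fun w hw => ?_) (by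
      rw [div_div, mul_comm L 2]; exact hz)
  · refine key.trans (mul_le_mul_of_nonneg_left (Real.exp_le_exp.mpr ?_) (norm_nonneg _))
    have e : L ^ 3 * l / (1 / (2 * (L ^ 3 * l))) = 2 * (L ^ 3 * l) ^ 2 := by field_simp
    have h4 : Real.log (2 * (L ^ 3 * l) ^ 2) ≤ 8 * l := by
      have h5 : 2 * (L ^ 3 * l) ^ 2 ≤ L ^ 8 := by
        have : 2 * l ^ 2 ≤ L ^ 2 := by nlinarith
        calc 2 * (L ^ 3 * l) ^ 2 = L ^ 6 * (2 * l ^ 2) := by ring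
          _ ≤ L ^ 6 * L ^ 2 := by gcongr
          _ = L ^ 8 := by ring
      refine (Real.log_le_log (by positivity) h5).trans ?_
      rw [Real.log_pow]; norm_num; exact le_rfl
    rw [e]
    calc 4 * Real.log (2 * (L ^ 3 * l) ^ 2) * (‖z - c‖ / (1 / L))
        ≤ 4 * (8 * l) * (‖z - c‖ / (1 / L)) := by gcongr
      _ = 32 * l * L * ‖z - c‖ := by field_simp; ring
  · rw [Metric.mem_ball, dist_eq_norm] at hw
    have hre := (Complex.abs_re_le_norm (w - c)).trans_lt hw
    have him := (Complex.abs_im_le_norm (w - c)).trans_lt hw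
    rw [Complex.sub_re, abs_lt] at hre
    rw [Complex.sub_im, abs_lt] at him
    rw [abs_le] at h3
    refine F_bounds hl hp ?_ (by linarith) ?_
    · have : 2 / logD D = 1 / L + 1 / L := by rw [← hLdef]; ring
      rw [this]; linarith
    · rw [abs_lt]; constructor <;> linarith

/-- On `Omega2`, the product of `L`-functions is close to the two main terms. -/
theorem norm_LL_sub_le (hl : 101 ≤ Real.log (logD D)) (hl2 : 2000 * Real.log (logD D) ≤ logD D)
    (hχ : χ.IsQuadratic) {p : Chars} (hp : p ∈ PsiStar D χ) {s c : ℂ}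
    (h1 : -(1 / 10 * alpha D * Real.log (logD D)) < s.re - 1 / 2) (h2 : s.re - 1 / 2 < 1 / 2)
    (h3 : |s.im - D| ≤ 2) (hc1 : -(2 / logD D) < c.re - 1 / 2) (hc2 : c.re - 1 / 2 < 1)
    (hc3 : |c.im - D| ≤ 2) :
    ‖LL p.2 χ s - F χ p.2 s‖ ≤ ‖Delta1 χ p.2 s‖ * ‖F χ p.2 (1 - (starRingEnd ℂ) s)‖ +
      ‖F χ p.2 c‖ / 10 := by
  have hL := logD_le_of_large hl
  have hs : s ∈ Omega2 D := by
    simp only [Omega2, Set.mem_ofPred_eq, sub_s0_re, sub_s0_im]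
    refine ⟨by linarith, h2, by linarith⟩
  have hFc := (F_bounds hl hp hc1 hc2 (by linarith)).1
  obtain ⟨_, _, _, ⟨κ, hκ, hb⟩⟩ := hp
  have b := hb s hs
  simp only [calF, F_inv_one_sub hχ] at b
  set L := logD D with hLdef
  set l := Real.log L with hldef
  have hL0 : 0 < L := by linarith
  -- The approximation error in `Omega2` is absorbed by a tenth of the lower bound `1/(2 𝓛³ log 𝓛)`
  -- for `|F|`, at any admissible point `c`; later `c` is `s` itself or the centre of a disc.
  have hκ2 : L ^ (-(24 / 5) : ℝ) ≤ 1 / (2 * (L ^ 3 * l)) / 10 := by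
    rw [div_div, le_div_iff₀ (by positivity)]
    have e1 : L ^ (-(24 / 5) : ℝ) ≤ L ^ (-4 : ℝ) :=
      Real.rpow_le_rpow_of_exponent_le (by linarith) (by norm_num)
    have e2 : L ^ (-4 : ℝ) = (L ^ 4)⁻¹ := by
      rw [Real.rpow_neg hL0.le]; norm_cast
    rw [e2] at e1
    calc L ^ (-(24 / 5) : ℝ) * (2 * (L ^ 3 * l) * 10) ≤ (L ^ 4)⁻¹ * (2 * (L ^ 3 * l) * 10) := by
          gcongr
      _ = 20 * l / L := by field_simp; norm_num
      _ ≤ 1 := by rw [div_le_one hL0]; linarith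
  have e : LL p.2 χ s - F χ p.2 s = (LL p.2 χ s - (F χ p.2 s + Delta1 χ p.2 s *
      (starRingEnd ℂ) (F χ p.2 (1 - (starRingEnd ℂ) s)))) + Delta1 χ p.2 s *
      (starRingEnd ℂ) (F χ p.2 (1 - (starRingEnd ℂ) s)) := by ring
  rw [e]
  refine (norm_add_le _ _).trans ?_
  rw [norm_mul, Complex.norm_conj, add_comm]
  gcongr
  linarith

theorem ne_one_of_mem_Psi {p : Chars} (hL : 1 ≤ logD D) (hp : p ∈ Psi D χ) :
    p.2 ≠ 1 ∧ p.2.mul χ ≠ 1 := by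
  have hq : (1 : ℝ) < (p.1 : ℕ) := by
    refine lt_trans ?_ hp.1
    rw [Q, Real.one_lt_exp_iff]
    positivity
  have hq1 : 1 < (p.1 : ℕ) := by exact_mod_cast hq
  have hl : 1 < Nat.lcm p.1 D := lt_of_lt_of_le hq1
    (Nat.le_of_dvd (Nat.lcm_pos p.1.pos (NeZero.pos D)) (Nat.dvd_lcm_left _ _))
  constructor
  · intro h
    have := hp.2.2.2.2.1
    rw [DirichletCharacter.isPrimitive_def, h, DirichletCharacter.conductor_one] at this
    omega
  · intro h
    have := hp.2.2.2.2.2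
    rw [DirichletCharacter.isPrimitive_def, h, DirichletCharacter.conductor_one] at this
    omega

/-- The zero set is symmetric about the critical line. -/
theorem LL_reflect {p : Chars} (hL : 1 ≤ logD D) (hp : p ∈ Psi D χ) {s : ℂ} (hs : s.im ≠ 0)
    (h : LL p.2 χ s = 0) : LL p.2 χ (1 - (starRingEnd ℂ) s) = 0 := by
  obtain ⟨n1, n2⟩ := ne_one_of_mem_Psi hL hp
  have key : ∀ {q : ℕ} [NeZero q] (ψ : DirichletCharacter ℂ q), ψ.IsPrimitive → ψ ≠ 1 →
      ψ.LFunction s = 0 → ψ.LFunction (1 - (starRingEnd ℂ) s) = 0 := by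
    intro q _ ψ hψ hψ1 h0
    have hs' : (1 - (starRingEnd ℂ) s).im ≠ 0 := by simpa using hs
    rw [LFunction_eq_Delta_mul hψ hs', sub_sub_cancel, LFunction_conj (inv_ne_one.mpr hψ1), inv_inv,
      h0]
    simp
  rcases mul_eq_zero.mp h with h0 | h0
  · rw [LL, key p.2 hp.2.2.2.2.1 n1 h0, zero_mul]
  · rw [LL, key _ hp.2.2.2.2.2 n2 h0, mul_zero]

theorem LL_ne_zero_of_one_le_re {p : Chars} (hL : 1 ≤ logD D) (hp : p ∈ Psi D χ) {s : ℂ}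
    (hs : 1 ≤ s.re) : LL p.2 χ s ≠ 0 := by
  obtain ⟨n1, n2⟩ := ne_one_of_mem_Psi hL hp
  exact mul_ne_zero (DirichletCharacter.LFunction_ne_zero_of_one_le_re _ (Or.inl n1) hs)
    (DirichletCharacter.LFunction_ne_zero_of_one_le_re _ (Or.inl n2) hs)

theorem large_D (hL : 101 ≤ logD D) : (100 : ℝ) ≤ D := by
  have := Real.add_one_le_exp (logD D)
  rw [exp_logD (NeZero.pos D)] at this
  linarith

-- At a zero to the right of the line the two main terms must balance: `(9/10) |F(s)| ≤ |Δ₁(s)| |F(1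
-- - s̄)|`. The exponential decay of `Δ₁` in `𝓛² σ` forbids this once `𝓛² σ > 1`.
set_option maxHeartbeats 1000000 in
theorem zero_re_sub_half_le (hl : 101 ≤ Real.log (logD D))
    (hl2 : 2000 * Real.log (logD D) ≤ logD D) (hχ : χ.IsQuadratic) {p : Chars}
    (hp : p ∈ PsiStar D χ) {s : ℂ} (him : |s.im - D| < 1) (hre : 1 / 2 ≤ s.re)
    (h : LL p.2 χ s = 0) : s.re - 1 / 2 ≤ alpha D := by
  have hL := logD_le_of_large hl
  have hD := large_D hL
  have hre1 : s.re < 1 := by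
    by_contra! h1
    exact LL_ne_zero_of_one_le_re (by linarith) hp.1 h1 h
  have hlog0 : 0 < alpha D * Real.log (logD D) := by unfold alpha; positivity
  have hmain := norm_LL_sub_le hl hl2 hχ hp (s := s) (c := s) (by linarith) (by linarith)
    (by linarith) (by have : 0 < 2 / logD D := by positivity
                      linarith) (by linarith) (by linarith)
  obtain ⟨σ, hσ⟩ : ∃ σ : ℝ, σ = s.re - 1 / 2 := ⟨_, rfl⟩
  have hs : s = ((1 / 2 + σ : ℝ) : ℂ) + (s.im : ℝ) * I := by
    apply Complex.ext <;> simp [hσ]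
  have hσ0 : 0 ≤ σ := by linarith
  have hσ1 : σ ≤ 1 / 2 := by linarith
  have him' := abs_lt.mp him
  have hΔ := norm_Delta1_le_of_nonneg hp.1 (t := s.im) hσ0 hσ1
    (by rw [abs_of_pos (by linarith)]; linarith)
  rw [← hs] at hΔ
  rw [h, zero_sub, norm_neg] at hmain
  have hFs := F_bounds hl hp (s := s) (by have : 0 < 2 / logD D := by positivity
                                          linarith) (by linarith) (by linarith)
  set L := logD D with hLdef
  set l := Real.log L with hldef
  set w : ℂ := 1 - (starRingEnd ℂ) s with hw
  have hwre : w.re = 1 / 2 - σ := by rw [hw, hσ]; simp; ring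
  have hwim : w.im = s.im := by rw [hw]; simp
  have hL0 : 0 < L := by linarith
  have hM0 : 0 < L ^ 3 * l := by positivity
  have hFpos : 0 < ‖F χ p.2 s‖ := lt_of_lt_of_le (by positivity) hFs.1
  rw [← hσ]
  have hexp0 : Real.exp (-(2 * L ^ 2 - 16) * σ) ≤ Real.exp (-(1.99 * L ^ 2) * σ) := by
    gcongr; nlinarith
  have hΔ' := hΔ.trans hexp0
  -- The reflected point is at distance `2σ`, so `σ ≤ 1/(4𝓛)` keeps it within half the Harnack
  -- radius. For larger `σ` the factor `Δ₁` is so small that bounds for `|F|` at the two points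
  -- separately are enough.
  rcases le_or_gt σ (1 / (4 * L)) with hc | hc
  · have hdist : ‖w - s‖ = 2 * σ := by
      have : w - s = ((-(2 * σ) : ℝ) : ℂ) := by
        apply Complex.ext
        · rw [Complex.sub_re, hwre, hσ, Complex.ofReal_re]; ring
        · rw [Complex.sub_im, hwim, Complex.ofReal_im]; ring
      rw [this, Complex.norm_real, Real.norm_eq_abs, abs_neg, abs_of_nonneg (by linarith)]
    have hnear := norm_F_le_near hl hl2 hp (c := s) (z := w)
      (by have : 0 < 1 / logD D := by positivity
          linarith) (by linarith) (by linarith) (by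
        rw [hdist]
        have : 1 / (2 * logD D) = 2 * (1 / (4 * L)) := by rw [← hLdef]; field_simp; norm_num
        rw [this]; linarith)
    rw [hdist] at hnear
    have h2 : ‖Delta1 χ p.2 s‖ * ‖F χ p.2 w‖ ≤ Real.exp (-(L ^ 2 * σ)) * ‖F χ p.2 s‖ := by
      calc _ ≤ Real.exp (-(1.99 * L ^ 2) * σ) * (‖F χ p.2 s‖ * Real.exp (32 * l * L * (2 * σ))) := by
            gcongr
        _ = Real.exp (-(1.99 * L ^ 2) * σ + 32 * l * L * (2 * σ)) * ‖F χ p.2 s‖ := by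
            rw [Real.exp_add]; ring
        _ ≤ _ := by
            gcongr
            nlinarith [mul_nonneg hσ0 hL0.le, mul_le_mul_of_nonneg_right hl2 (mul_nonneg hσ0 hL0.le)]
    have h3 : (9 / 10 : ℝ) ≤ Real.exp (-(L ^ 2 * σ)) := by
      have : ‖F χ p.2 s‖ * (9 / 10) ≤ ‖F χ p.2 s‖ * Real.exp (-(L ^ 2 * σ)) := by linarith
      exact le_of_mul_le_mul_left this hFpos
    have h4 : L ^ 2 * σ ≤ 1 := by
      by_contra! h5
      have h6 : Real.exp (-(L ^ 2 * σ)) ≤ Real.exp (-1) := by gcongr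
      have h7 := Real.exp_neg_one_lt_d9
      linarith
    rw [alpha, ← hLdef, inv_eq_one_div, le_div_iff₀ (by positivity)]
    linarith
  · exfalso
    have hlL : L = Real.exp l := (Real.exp_log hL0).symm
    have hsmall : ‖Delta1 χ p.2 s‖ * ‖F χ p.2 w‖ ≤ Real.exp (-(L / 8)) * L ^ 5 := by
      -- For large `σ` the reflected point may leave `Omega1`, and the trivial bound `exp((5/2 + 5σ)
      -- 𝓛)` is used. It loses to `exp(-1.99 𝓛² σ)` once `σ 𝓛 ≥ 3/2`. Below that the point is still
      -- in `Omega1`.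
      rcases le_or_gt (3 / (2 * L)) σ with hc2 | hc2
      · have hFw := norm_F_le (χ := χ) (NeZero.pos D) p.2 hσ0 hwre
        have hc3 : 3 ≤ σ * (2 * L) := by rwa [div_le_iff₀ (by positivity)] at hc2
        calc _ ≤ Real.exp (-(1.99 * L ^ 2) * σ) *
              (Real.exp ((5 / 2 + 5 * σ) * L) * (1 + 5 * L) ^ 2) := by gcongr
          _ = Real.exp (-(1.99 * L ^ 2) * σ + (5 / 2 + 5 * σ) * L) * (1 + 5 * L) ^ 2 := by
              rw [Real.exp_add]; ring
          _ ≤ _ := by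
              gcongr
              · nlinarith [mul_nonneg hσ0 hL0.le, mul_le_mul_of_nonneg_right hL (mul_nonneg hσ0 hL0.le), mul_le_mul_of_nonneg_right hc3 hL0.le]
              · have : (1 + 5 * L) ^ 2 ≤ 36 * L ^ 2 := by nlinarith
                have h3 : (36 : ℝ) ≤ L ^ 3 := by
                  calc (36 : ℝ) ≤ 101 ^ 3 := by norm_num
                    _ ≤ L ^ 3 := by gcongr
                calc _ ≤ 36 * L ^ 2 := this
                  _ ≤ L ^ 3 * L ^ 2 := by gcongr
                  _ = L ^ 5 := by ring
      · have h23 : 3 / (2 * L) < 2 / L := by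
          rw [div_lt_div_iff₀ (by positivity) hL0]; nlinarith
        have hFw := (F_bounds hl hp (s := w) (by rw [hwre]; linarith) (by rw [hwre]; linarith)
          (by rw [hwim]; linarith)).2
        rw [← hLdef, ← hldef] at hFw
        have hc3 : 1 < σ * (4 * L) := by rwa [div_lt_iff₀ (by positivity)] at hc
        calc _ ≤ Real.exp (-(1.99 * L ^ 2) * σ) * (L ^ 3 * l) := by gcongr
          _ ≤ _ := by
            gcongr
            · nlinarith [mul_le_mul_of_nonneg_right hc3.le hL0.le, mul_nonneg hσ0 (sq_nonneg L)]
            · rw [show L ^ 5 = L ^ 3 * L ^ 2 by ring]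
              gcongr
              nlinarith
    have h5 : ‖F χ p.2 s‖ * (9 / 10) ≤ Real.exp (-(L / 8)) * L ^ 5 := by linarith
    have h6 : 1 / (2 * (L ^ 3 * l)) * (9 / 10) ≤ Real.exp (-(L / 8)) * L ^ 5 := by
      refine le_trans ?_ h5
      gcongr
      exact hFs.1
    rw [div_mul_eq_mul_div, div_le_iff₀ (by positivity)] at h6
    have h7 : Real.exp (-(L / 8)) * L ^ 5 * (2 * (L ^ 3 * l)) ≤ Real.exp (-(L / 8)) * L ^ 9 := by
      rw [mul_assoc]
      gcongr
      nlinarith [pow_pos hL0 8]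
    have h8 : Real.exp (-(L / 8)) * L ^ 9 ≤ Real.exp (-1) := by
      have : L ^ 9 = Real.exp (9 * l) := by
        conv_lhs => rw [hlL, ← Real.exp_nat_mul]
        norm_num
      rw [this, ← Real.exp_add]
      gcongr
      linarith
    have h9 := Real.exp_neg_one_lt_d9
    linarith

/-- Zeros to the left of the line are reflected to the right by the functional equation. -/
theorem zero_near_line (hl : 101 ≤ Real.log (logD D))
    (hl2 : 2000 * Real.log (logD D) ≤ logD D) (hχ : χ.IsQuadratic) {p : Chars}
    (hp : p ∈ PsiStar D χ) {s : ℂ} (hs : s ∈ zeroSet χ p.2) : |s.re - 1 / 2| ≤ alpha D := by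
  obtain ⟨him, h⟩ := hs
  have hL := logD_le_of_large hl
  have hD := large_D hL
  have him' := abs_lt.mp him
  rw [abs_le]
  rcases le_total (1 / 2) s.re with hre | hre
  · have := zero_re_sub_half_le hl hl2 hχ hp him hre h
    constructor <;> linarith
  · have h1 := LL_reflect (by linarith) hp.1 (by intro h0; rw [h0] at him'; linarith) h
    have := zero_re_sub_half_le hl hl2 hχ hp (s := 1 - (starRingEnd ℂ) s) (by simpa using him)
      (by simp; linarith) h1
    simp at this
    constructor <;> linarith

set_option maxHeartbeats 1000000 in
/-- The number of zeros in a disc of radius `4 α` is bounded. -/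
theorem card_zeros_disc_le (hl : 101 ≤ Real.log (logD D))
    (hl2 : 2000 * Real.log (logD D) ≤ logD D) (hχ : χ.IsQuadratic) {p : Chars}
    (hp : p ∈ PsiStar D χ) {t : ℝ} (ht : |t - D| ≤ 1) (Z : Finset ℂ)
    (hZ : ∀ s ∈ Z, s ∈ zeroSet χ p.2 ∧ |s.im - t| ≤ alpha D) : Z.card ≤ 50 := by
  have hL := logD_le_of_large hl
  have hD := large_D hL
  have hnear := fun s hs => zero_near_line hl hl2 hχ hp (hZ s hs).1
  obtain ⟨n1, n2⟩ := ne_one_of_mem_Psi (by linarith) hp.1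
  set L := logD D with hLdef
  set l := Real.log L with hldef
  have hL0 : 0 < L := by linarith
  set a := alpha D with ha
  have haL : a = 1 / L ^ 2 := by rw [ha, alpha, ← hLdef, inv_eq_one_div]
  have ha0 : 0 < a := by rw [haL]; positivity
  have haL2 : L ^ 2 * a = 1 := by rw [haL]; field_simp
  have haL1 : a ≤ 1 / (101 * L) := by
    rw [haL]
    apply one_div_le_one_div_of_le (by positivity); nlinarith
  have ha1 : a ≤ 1 / 10000 := by
    refine haL1.trans ?_
    apply one_div_le_one_div_of_le (by norm_num); linarith
  have hinv : 1 / L = 101 * (1 / (101 * L)) := by field_simp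
  have h2L : 1 / (2 * L) = 101 / 2 * (1 / (101 * L)) := by field_simp
  have ht' := abs_le.mp ht
  -- At distance `2α` to the right, `|Δ₁(c)|` is about `e^{-4}` at most, so the product of
  -- `L`-functions at `c` is bounded below by a multiple of `|F(c)|`, as Jensen's inequality
  -- requires.
  set c : ℂ := ((1 / 2 + 2 * a : ℝ) : ℂ) + t * I with hc
  have hcre : c.re = 1 / 2 + 2 * a := by simp [hc]
  have hcim : c.im = t := by simp [hc]
  have hFc := F_bounds hl hp (s := c) (by rw [hcre]; have : 0 < 2 / logD D := by positivity
                                          linarith) (by rw [hcre]; linarith)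
    (by rw [hcim]; linarith)
  have hFc0 : 0 < ‖F χ p.2 c‖ := lt_of_lt_of_le (by rw [← hLdef, ← hldef]; positivity) hFc.1
  have hexp : Real.exp (1 / 2) ≤ 2 := by
    have h1 : Real.exp (1 / 2) ^ 2 = Real.exp 1 := by rw [← Real.exp_nat_mul]; norm_num
    have h2 := Real.exp_one_lt_d9
    have h3 := Real.exp_pos (1 / 2)
    nlinarith
  -- `28 = 16 + 12` covers the reflections of the points of the outer circle of radius `12 α`. The
  -- Harnack exponent `896 log 𝓛 / 𝓛` is below `1/2` because `𝓛 ≥ 2000 log 𝓛`.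
  have hFnear : ∀ z : ℂ, ‖z - c‖ ≤ 28 * a → ‖F χ p.2 z‖ ≤ 2 * ‖F χ p.2 c‖ := by
    intro z hz
    have h1 := norm_F_le_near hl hl2 hp (c := c) (z := z)
      (by rw [hcre]; have : 0 < 1 / logD D := by positivity
          linarith) (by rw [hcre]; linarith) (by rw [hcim]; linarith)
      (by rw [← hLdef, h2L]; linarith)
    refine h1.trans ?_
    rw [mul_comm]
    gcongr
    refine le_trans ?_ hexp
    gcongr
    rw [← hLdef, ← hldef]
    calc 32 * l * L * ‖z - c‖ ≤ 32 * l * L * (28 * a) := by gcongr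
      _ = 896 * l * (L * a) := by ring
      _ ≤ 896 * (L / 2000) * (L * a) := by gcongr; linarith
      _ = 896 / 2000 * (L ^ 2 * a) := by ring
      _ ≤ 1 / 2 := by rw [haL2]; norm_num
  have hnorm : ∀ x y : ℝ, ∀ z : ℂ, |z.re - c.re| ≤ x → |z.im - c.im| ≤ y → ‖z - c‖ ≤ x + y := by
    intro x y z h1 h2
    refine (Complex.norm_le_abs_re_add_abs_im _).trans ?_
    rw [Complex.sub_re, Complex.sub_im]
    linarith
  have hrefl : ∀ s : ℂ, (1 - (starRingEnd ℂ) s).re = 1 - s.re ∧ (1 - (starRingEnd ℂ) s).im = s.im := by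
    intro s; simp
  have hdec : ∀ s : ℂ, s = ((1 / 2 + (s.re - 1 / 2) : ℝ) : ℂ) + (s.im : ℝ) * I := by
    intro s; apply Complex.ext <;> simp
  have hlow : ‖F χ p.2 c‖ / 2 ≤ ‖LL p.2 χ c‖ := by
    have h1 := norm_LL_sub_le hl hl2 hχ hp (s := c) (c := c)
      (by rw [hcre]; have : 0 < alpha D * Real.log (logD D) := by unfold alpha; positivity
          linarith) (by rw [hcre]; linarith) (by rw [hcim]; linarith)
      (by rw [hcre]; have : 0 < 2 / logD D := by positivity
          linarith) (by rw [hcre]; linarith) (by rw [hcim]; linarith)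
    have h2 := norm_Delta1_le_of_nonneg hp.1 (t := t) (σ := 2 * a) (by positivity) (by linarith)
      (by rw [abs_of_pos (by linarith)]; linarith)
    rw [← hc, ← hLdef] at h2
    have h3 : ‖Delta1 χ p.2 c‖ ≤ 1 / 16 := by
      refine h2.trans ?_
      have h4 : -(2 * L ^ 2 - 16) * (2 * a) ≤ (4 : ℕ) * (-1) + 1 / 10 := by
        have : -(2 * L ^ 2 - 16) * (2 * a) = -4 * (L ^ 2 * a) + 32 * a := by ring
        rw [this, haL2]
        push_cast
        linarith
      refine (Real.exp_le_exp.mpr h4).trans ?_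
      rw [Real.exp_add, Real.exp_nat_mul]
      have h5 : Real.exp (-1) ≤ 0.37 := Real.exp_neg_one_lt_d9.le.trans (by norm_num)
      have h6 : Real.exp (1 / 10) ≤ 2 := (Real.exp_le_exp.mpr (by norm_num)).trans hexp
      calc Real.exp (-1) ^ 4 * Real.exp (1 / 10) ≤ 0.37 ^ 4 * 2 := by gcongr
        _ ≤ 1 / 16 := by norm_num
    have h4 := hFnear (1 - (starRingEnd ℂ) c) ((hnorm (4 * a) 0 _ (by
      rw [(hrefl c).1, hcre, abs_le]; constructor <;> linarith) (by
      rw [(hrefl c).2, sub_self, abs_zero])).trans (by linarith))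
    have h5 : ‖Delta1 χ p.2 c‖ * ‖F χ p.2 (1 - (starRingEnd ℂ) c)‖ ≤
        1 / 16 * (2 * ‖F χ p.2 c‖) := by gcongr
    have h6 := norm_sub_norm_le (F χ p.2 c) (F χ p.2 c - LL p.2 χ c)
    rw [sub_sub_cancel, norm_sub_rev] at h6
    linarith
  have hup : ∀ s ∈ Metric.sphere c (3 * (4 * a)), ‖LL p.2 χ s‖ ≤ Real.exp 45 * ‖LL p.2 χ c‖ := by
    intro s hs
    rw [Metric.mem_sphere, dist_eq_norm] at hs
    have hre := (Complex.abs_re_le_norm (s - c)).trans hs.le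
    have him := (Complex.abs_im_le_norm (s - c)).trans hs.le
    rw [Complex.sub_re, abs_le, hcre] at hre
    rw [Complex.sub_im, abs_le, hcim] at him
    have h3 : |s.im - D| ≤ 2 := by rw [abs_le]; constructor <;> linarith
    have h1 := norm_LL_sub_le hl hl2 hχ hp (s := s) (c := c)
      -- The circle reaches `10 α` to the left of the critical line; it stays in `Omega2` because
      -- `log 𝓛 ≥ 101`.
      (by have : 1 / 10 * alpha D * Real.log (logD D) = a * (l / 10) := by ring
          rw [this]
          nlinarith) (by linarith) h3
      (by rw [hcre]; have : 0 < 2 / logD D := by positivity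
          linarith) (by rw [hcre]; linarith) (by rw [hcim]; linarith)
    have h4 := hFnear s (by rw [hs]; linarith)
    have h5 := hFnear (1 - (starRingEnd ℂ) s) ((hnorm (16 * a) (12 * a) _ (by
      rw [(hrefl s).1, hcre, abs_le]; constructor <;> linarith) (by
      rw [(hrefl s).2, hcim, abs_le]; constructor <;> linarith)).trans (by linarith))
    have h6 : ‖Delta1 χ p.2 s‖ ≤ Real.exp 30 := by
      have hdec' := hdec s
      have hsim : |s.im| = s.im := abs_of_pos (by have := abs_le.mp h3; linarith)
      rcases le_total 0 (s.re - 1 / 2) with h0 | h0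
      · rw [hdec']
        refine (norm_Delta1_le_of_nonneg hp.1 h0 (by linarith)
          (by rw [hsim]; have := abs_le.mp h3; linarith)).trans ?_
        gcongr
        rw [← hLdef]
        nlinarith
      · have h7 := norm_Delta1_le_of_nonpos (t := s.im) hL hp.1 (σ := -(s.re - 1 / 2)) (by linarith)
          (by linarith) (by rw [hsim]; have := abs_le.mp h3; linarith)
          (by rw [hsim]; have := abs_le.mp h3; linarith)
        rw [neg_neg] at h7
        rw [hdec']
        refine h7.trans ?_
        gcongr
        rw [← hLdef]
        calc 3 * L ^ 2 * -(s.re - 1 / 2) ≤ 3 * L ^ 2 * (10 * a) := by gcongr; linarith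
          _ = 30 * (L ^ 2 * a) := by ring
          _ = 30 := by rw [haL2, mul_one]
    have h7 : ‖Delta1 χ p.2 s‖ * ‖F χ p.2 (1 - (starRingEnd ℂ) s)‖ ≤
        Real.exp 30 * (2 * ‖F χ p.2 c‖) := by gcongr
    have h8 := norm_sub_norm_le (LL p.2 χ s) (F χ p.2 s)
    have h9 : Real.exp 45 = Real.exp 15 * Real.exp 30 := by rw [← Real.exp_add]; norm_num
    have h10 : (16 : ℝ) ≤ Real.exp 15 := by have := Real.add_one_le_exp (15 : ℝ); linarith
    have h11 : (1 : ℝ) ≤ Real.exp 30 := Real.one_le_exp (by norm_num)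
    calc ‖LL p.2 χ s‖ ≤ Real.exp 30 * (2 * ‖F χ p.2 c‖) + 3 * ‖F χ p.2 c‖ := by linarith
      _ ≤ Real.exp 30 * (5 * ‖F χ p.2 c‖) := by nlinarith
      _ ≤ Real.exp 30 * (5 * (2 * ‖LL p.2 χ c‖)) := by gcongr; linarith
      _ ≤ _ := by rw [h9]; nlinarith [mul_nonneg (Real.exp_nonneg 30) (norm_nonneg (LL p.2 χ c))]
  -- The radius `4α` suffices: the zeros are at most `3α` horizontally and `α` vertically from `c`.
  have hcard := card_zeros_le (f := LL p.2 χ) (c := c) (r := 4 * a) (M := Real.exp 45)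
    (by positivity) (Real.one_le_exp (by norm_num)) (by
      have : Differentiable ℂ (LL p.2 χ) :=
        (DirichletCharacter.differentiable_LFunction n1).mul
          (DirichletCharacter.differentiable_LFunction n2)
      exact (analyticOnNhd_univ_iff_differentiable.mpr this).mono (Set.subset_univ _))
    (norm_pos_iff.mp (lt_of_lt_of_le (by positivity) hlow)) hup Z (by
      intro s hs
      refine ⟨?_, (hZ s hs).1.2⟩
      rw [Metric.mem_closedBall, dist_eq_norm]
      have h1 := abs_le.mp (hnear s hs)
      refine (hnorm (3 * a) a s (by
        rw [hcre, abs_le]; constructor <;> linarith) (by rw [hcim]; exact (hZ s hs).2)).trans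
        (by linarith))
  rw [Real.log_exp] at hcard
  have : (Z.card : ℝ) ≤ (50 : ℕ) := by push_cast; linarith
  exact_mod_cast this

end Star

end LandauSiegel

/-! ### The mean square of the coefficients `λ_±`. -/

namespace LandauSiegel

/-- Chebyshev's argument: `∑ ⌊N/p⌋ log p` is at most `N log N`, since the primes dividing `m`
multiply to at most `m`. Replacing `⌊N/p⌋` by `N/p` costs `θ(N) ≤ N log 4`. -/
theorem sum_log_div_prime_le {N : ℕ} (hN : 2 ≤ N) :
    ∑ p ∈ Finset.Ioc 0 N with p.Prime, Real.log p / p ≤ 3 * Real.log N := by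
  have hN0 : (0 : ℝ) < N := by exact_mod_cast (by omega : 0 < N)
  have h1 : ∑ p ∈ Finset.Ioc 0 N with p.Prime, Real.log p * ((N / p : ℕ) : ℝ) ≤ N * Real.log N := by
    calc ∑ p ∈ Finset.Ioc 0 N with p.Prime, Real.log p * ((N / p : ℕ) : ℝ)
        = ∑ p ∈ Finset.Ioc 0 N with p.Prime, ∑ m ∈ Finset.Ioc 0 N, if p ∣ m then Real.log p else 0 := by
          refine Finset.sum_congr rfl fun p _ => ?_
          rw [← Finset.sum_filter, Finset.sum_const, nsmul_eq_mul, mul_comm,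
            Nat.Ioc_filter_dvd_card_eq_div]
      _ = ∑ m ∈ Finset.Ioc 0 N, ∑ p ∈ Finset.Ioc 0 N with p.Prime, if p ∣ m then Real.log p else 0 :=
          Finset.sum_comm
      _ ≤ ∑ m ∈ Finset.Ioc 0 N, Real.log N := by
          refine Finset.sum_le_sum fun m hm => ?_
          obtain ⟨hm0, hmN⟩ := Finset.mem_Ioc.mp hm
          have e : ((Finset.Ioc 0 N).filter Nat.Prime).filter (· ∣ m) = m.primeFactors := by
            ext p
            simp only [Finset.mem_filter, Finset.mem_Ioc, Nat.mem_primeFactors]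
            constructor
            · rintro ⟨⟨_, hp⟩, hd⟩
              exact ⟨hp, hd, hm0.ne'⟩
            · rintro ⟨hp, hd, _⟩
              exact ⟨⟨⟨hp.pos, (Nat.le_of_dvd hm0 hd).trans hmN⟩, hp⟩, hd⟩
          rw [← Finset.sum_filter, e, ← Real.log_prod fun p hp => by
            have := (Nat.prime_of_mem_primeFactors hp).pos
            positivity]
          apply Real.log_le_log
          · exact Finset.prod_pos fun p hp => by
              exact_mod_cast (Nat.prime_of_mem_primeFactors hp).pos
          · have := (Nat.le_of_dvd hm0 (Nat.prod_primeFactors_dvd m)).trans hmN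
            rw [← Nat.cast_prod]
            exact_mod_cast this
      _ = N * Real.log N := by simp
  have h2 : ∑ p ∈ Finset.Ioc 0 N with p.Prime, Real.log p ≤ Real.log 4 * N := by
    have := Chebyshev.theta_le_log4_mul_x (x := N) (Nat.cast_nonneg N)
    rwa [Chebyshev.theta, Nat.floor_natCast] at this
  have h3 : (N : ℝ) * ∑ p ∈ Finset.Ioc 0 N with p.Prime, Real.log p / p ≤
      N * Real.log N + Real.log 4 * N := by
    refine le_trans ?_ (add_le_add h1 h2)
    rw [Finset.mul_sum, ← Finset.sum_add_distrib]
    refine Finset.sum_le_sum fun p hp => ?_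
    have hpp := (Finset.mem_filter.mp hp).2
    have hp1 : (1 : ℝ) ≤ p := by exact_mod_cast hpp.one_lt.le
    have h4 : (N : ℝ) / p ≤ ((N / p : ℕ) : ℝ) + 1 := by
      rw [← Nat.floor_div_eq_div (K := ℝ)]
      exact (Nat.lt_floor_add_one _).le
    calc (N : ℝ) * (Real.log p / p) = Real.log p * (N / p) := by ring
      _ ≤ Real.log p * (((N / p : ℕ) : ℝ) + 1) := by
          gcongr
      _ = _ := by ring
  have h5 : Real.log 4 ≤ 2 * Real.log N := by
    have : Real.log 4 = 2 * Real.log 2 := by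
      rw [show (4 : ℝ) = 2 ^ 2 by norm_num, Real.log_pow]; norm_num
    rw [this]
    have : Real.log 2 ≤ Real.log N := Real.log_le_log (by norm_num) (by exact_mod_cast hN)
    linarith
  refine le_of_mul_le_mul_left (h3.trans ?_) hN0
  nlinarith

/-- The power function `n ↦ n ^ a`. -/
noncomputable def rpowFun (a : ℝ) : ArithmeticFunction ℝ :=
  ⟨fun n => if n = 0 then 0 else (n : ℝ) ^ a, if_pos rfl⟩

theorem rpowFun_apply (a : ℝ) {n : ℕ} (hn : n ≠ 0) : rpowFun a n = (n : ℝ) ^ a := if_neg hn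

theorem isMultiplicative_rpowFun (a : ℝ) : (rpowFun a).IsMultiplicative := by
  refine ArithmeticFunction.IsMultiplicative.iff_ne_zero.mpr
    ⟨by simp [rpowFun_apply], fun {m n} hm hn _ => ?_⟩
  rw [rpowFun_apply a hm, rpowFun_apply a hn, rpowFun_apply a (Nat.mul_ne_zero hm hn),
    Nat.cast_mul, Real.mul_rpow (Nat.cast_nonneg m) (Nat.cast_nonneg n)]

theorem zetaQuotCoeff_eq (a : ℝ) : ∃ f : ArithmeticFunction ℝ, f.IsMultiplicative ∧
    ∀ n, zetaQuotCoeff a n = f n := by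
  refine ⟨_, (isMultiplicative_rpowFun (-a)).mul
    ((ArithmeticFunction.isMultiplicative_moebius.intCast (R := ℝ)).pmul
      (isMultiplicative_rpowFun a)), fun n => ?_⟩
  rw [zetaQuotCoeff, ArithmeticFunction.mul_apply]
  refine Finset.sum_congr rfl fun p hp => ?_
  have h := Nat.mem_divisorsAntidiagonal.mp hp
  have h1 : p.1 ≠ 0 := fun h' => h.2 (by rw [← h.1, h', zero_mul])
  have h2 : p.2 ≠ 0 := fun h' => h.2 (by rw [← h.1, h', mul_zero])
  simp [rpowFun_apply, h1, h2]

theorem zetaQuotCoeff_one (a : ℝ) : zetaQuotCoeff a 1 = 1 := by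
  simp [zetaQuotCoeff]

theorem zetaQuotCoeff_prime_pow (a : ℝ) {p : ℕ} (hp : p.Prime) (k : ℕ) :
    zetaQuotCoeff a (p ^ (k + 1)) =
      ((p : ℝ) ^ (-a)) ^ (k + 1) - ((p : ℝ) ^ (-a)) ^ k * (p : ℝ) ^ a := by
  have hpp : ∀ j : ℕ, (((p ^ j : ℕ) : ℝ)) ^ (-a) = ((p : ℝ) ^ (-a)) ^ j := by
    intro j
    push_cast
    rw [← Real.rpow_natCast, ← Real.rpow_natCast, ← Real.rpow_mul (by positivity),
      ← Real.rpow_mul (by positivity), mul_comm]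
  rw [zetaQuotCoeff, Nat.sum_divisorsAntidiagonal' (f := fun x y => ((x : ℕ) : ℝ) ^ (-a) *
    ((ArithmeticFunction.moebius y : ℝ) * (y : ℝ) ^ a)), Nat.divisors_prime_pow hp, Finset.sum_map,
    Finset.sum_range_succ', Finset.sum_range_succ']
  rw [Finset.sum_eq_zero]
  · have hdiv : p ^ (k + 1) / p = p ^ k := by rw [pow_succ, Nat.mul_div_cancel _ hp.pos]
    simp [ArithmeticFunction.moebius_apply_prime hp, hdiv]
    have := hpp (k + 1)
    push_cast at this
    have h2 := hpp k
    push_cast at h2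
    rw [this, h2]
    ring
  · intro j _
    have : ArithmeticFunction.moebius (p ^ (j + 1 + 1)) = 0 := by
      rw [ArithmeticFunction.moebius_apply_prime_pow hp (by omega)]
      simp
    simp [this]

/-- The two terms of the coefficient nearly cancel: their difference carries the factor `1 -
p^{-2|a|} ≤ 2|a| log p`. All the smallness in the mean square comes from here. -/
theorem zetaQuotCoeff_prime_pow_sq_le (a : ℝ) {p : ℕ} (hp : p.Prime) (k : ℕ) :
    zetaQuotCoeff a (p ^ (k + 1)) ^ 2 ≤
      ((p : ℝ) ^ (2 * |a|)) ^ (k + 1) * (2 * |a| * Real.log p) ^ 2 := by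
  have hp0 : (0 : ℝ) < p := by exact_mod_cast hp.pos
  have hp1 : (1 : ℝ) ≤ p := by exact_mod_cast hp.one_lt.le
  have hl : 0 ≤ Real.log p := Real.log_nonneg hp1
  set u : ℝ := (p : ℝ) ^ |a| with hu
  have hu1 : 1 ≤ u := Real.one_le_rpow hp1 (abs_nonneg a)
  have hu2 : (p : ℝ) ^ (2 * |a|) = u ^ 2 := by
    rw [hu, ← Real.rpow_natCast, ← Real.rpow_mul hp0.le]; congr 1; push_cast; ring
  have hd : 1 - (u ^ 2)⁻¹ ≤ 2 * |a| * Real.log p := by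
    rw [← hu2, ← Real.rpow_neg hp0.le, Real.rpow_def_of_pos hp0]
    have := Real.add_one_le_exp (Real.log p * -(2 * |a|))
    linarith
  have hd0 : 0 ≤ 1 - (u ^ 2)⁻¹ := sub_nonneg.mpr (inv_le_one_of_one_le₀ (one_le_pow₀ hu1))
  have key : |zetaQuotCoeff a (p ^ (k + 1))| ≤ u ^ (k + 1) * (1 - (u ^ 2)⁻¹) := by
    rw [zetaQuotCoeff_prime_pow a hp]
    have hu0 : 0 < u := by linarith
    have hui : u * (u ^ 2)⁻¹ = u⁻¹ := by field_simp
    rcases le_total 0 a with ha | ha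
    · rw [abs_of_nonneg ha] at hu
      rw [Real.rpow_neg hp0.le, ← hu]
      have e : u⁻¹ ^ (k + 1) - u⁻¹ ^ k * u = -(u⁻¹ ^ k * (u * (1 - (u ^ 2)⁻¹))) := by
        linear_combination (-(u⁻¹ ^ k)) * hui
      rw [e, abs_neg, abs_of_nonneg (by positivity), ← mul_assoc]
      gcongr
      rw [pow_succ]
      gcongr
      exact (inv_le_one_of_one_le₀ hu1).trans hu1
    · rw [abs_of_nonpos ha] at hu
      have hua : (p : ℝ) ^ a = u⁻¹ := by rw [hu, ← Real.rpow_neg hp0.le, neg_neg]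
      rw [hua, ← hu]
      have e : u ^ (k + 1) - u ^ k * u⁻¹ = u ^ (k + 1) * (1 - (u ^ 2)⁻¹) := by
        linear_combination (u ^ k) * hui
      rw [e, abs_of_nonneg (by positivity)]
  rw [hu2, ← sq_abs]
  calc |zetaQuotCoeff a (p ^ (k + 1))| ^ 2 ≤ (u ^ (k + 1) * (1 - (u ^ 2)⁻¹)) ^ 2 := by gcongr
    _ = (u ^ 2) ^ (k + 1) * (1 - (u ^ 2)⁻¹) ^ 2 := by rw [mul_pow, ← pow_mul, ← pow_mul]; ring
    _ ≤ _ := by gcongr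

/-- A geometric series of ratio `p^{2|a|-1} ≤ 2^{-3/4} ≤ 3/5`; the constant is `5/2 = 1/(1 - 3/5)`.
-/
theorem local_factor_le {a : ℝ} (ha : |a| ≤ 1 / 16) {p : ℕ} (hp : p.Prime) :
    Summable (fun k : ℕ => ‖zetaQuotCoeff a (p ^ k) ^ 2 / ((p ^ k : ℕ) : ℝ)‖) ∧
    ∑' k : ℕ, zetaQuotCoeff a (p ^ k) ^ 2 / ((p ^ k : ℕ) : ℝ) ≤
      1 + 5 / 2 * ((p : ℝ) ^ (2 * |a|) / p) * (2 * |a| * Real.log p) ^ 2 := by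
  have hp0 : (0 : ℝ) < p := by exact_mod_cast hp.pos
  have hp2 : (2 : ℝ) ≤ p := by exact_mod_cast hp.two_le
  set r : ℝ := (p : ℝ) ^ (2 * |a|) / p with hr
  have hr0 : 0 < r := by positivity
  have hr1 : r ≤ 3 / 5 := by
    have e1 : r = (p : ℝ) ^ (2 * |a| - 1) := by rw [hr, Real.rpow_sub hp0, Real.rpow_one]
    have e2 : r ≤ (2 : ℝ) ^ (-(3 / 4) : ℝ) := by
      rw [e1]
      calc (p : ℝ) ^ (2 * |a| - 1) ≤ (p : ℝ) ^ (-(3 / 4) : ℝ) :=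
            Real.rpow_le_rpow_of_exponent_le (by linarith) (by linarith)
        _ ≤ _ := Real.rpow_le_rpow_of_nonpos (by norm_num) hp2 (by norm_num)
    refine e2.trans ?_
    have e3 : ((2 : ℝ) ^ (-(3 / 4) : ℝ)) ^ 4 = 1 / 8 := by
      rw [← Real.rpow_natCast, ← Real.rpow_mul (by norm_num)]
      norm_num
    refine (pow_le_pow_iff_left₀ (by positivity) (by norm_num) (four_ne_zero)).mp ?_
    rw [e3]; norm_num
  set B : ℝ := (2 * |a| * Real.log p) ^ 2 with hB
  have hbound : ∀ k : ℕ, zetaQuotCoeff a (p ^ (k + 1)) ^ 2 / ((p ^ (k + 1) : ℕ) : ℝ) ≤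
      (r * B) * r ^ k := by
    intro k
    have := zetaQuotCoeff_prime_pow_sq_le a hp k
    calc _ ≤ (((p : ℝ) ^ (2 * |a|)) ^ (k + 1) * B) / ((p ^ (k + 1) : ℕ) : ℝ) := by gcongr
      _ = (r * B) * r ^ k := by
          have : (r * B) * r ^ k = r ^ (k + 1) * B := by ring
          rw [this, hr, div_pow, Nat.cast_pow]
          ring
  have hg : Summable fun k : ℕ => (r * B) * r ^ k :=
    (summable_geometric_of_lt_one hr0.le (by linarith)).mul_left _
  have hs : Summable fun k : ℕ => zetaQuotCoeff a (p ^ (k + 1)) ^ 2 / ((p ^ (k + 1) : ℕ) : ℝ) :=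
    Summable.of_nonneg_of_le (fun k => by positivity) hbound hg
  have hs' : Summable fun k : ℕ => zetaQuotCoeff a (p ^ k) ^ 2 / ((p ^ k : ℕ) : ℝ) :=
    (summable_nat_add_iff 1).mp hs
  refine ⟨hs'.norm, ?_⟩
  rw [hs'.tsum_eq_zero_add]
  simp only [pow_zero, zetaQuotCoeff_one, one_pow, Nat.cast_one, div_one]
  gcongr
  calc _ ≤ ∑' k : ℕ, (r * B) * r ^ k := hs.tsum_le_tsum hbound hg
    _ = (r * B) * (1 - r)⁻¹ := by rw [tsum_mul_left, tsum_geometric_of_lt_one hr0.le (by linarith)]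
    _ ≤ (r * B) * (5 / 2) := by
        gcongr
        rw [inv_le_comm₀ (by linarith) (by norm_num)]
        linarith
    _ = _ := by ring

/-- The mean square of the coefficients of `ζ(s + a) / ζ(s - a)`. -/
theorem sum_zetaQuotCoeff_sq_le : ∃ C : ℝ, 0 ≤ C ∧ ∀ (a : ℝ) (N : ℕ), |a| ≤ 1 / 16 →
    |a| * Real.log N ≤ 3 / 2 →
    ∑ n ∈ Finset.Ioc 1 N, zetaQuotCoeff a n ^ 2 / n ≤ C * (|a| * Real.log N) ^ 2 := by
  set C₁ : ℝ := 10 * Real.exp 3 with hC₁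
  refine ⟨3 * C₁ * Real.exp (3 * C₁ * (3 / 2) ^ 2), by positivity, fun a N ha haN => ?_⟩
  rcases lt_or_ge N 2 with hN | hN
  · rw [Finset.Ioc_eq_empty (by omega), Finset.sum_empty]
    positivity
  obtain ⟨f, hf, hfe⟩ := zetaQuotCoeff_eq a
  set g : ℕ → ℝ := fun n => zetaQuotCoeff a n ^ 2 / n with hg
  have hg1 : g 1 = 1 := by simp [hg, zetaQuotCoeff_one]
  have hgm : ∀ {m n : ℕ}, m.Coprime n → g (m * n) = g m * g n := by
    intro m n hmn
    simp only [hg, hfe, hf.map_mul_of_coprime hmn, Nat.cast_mul]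
    rw [mul_pow, mul_div_mul_comm]
  have hEP := EulerProduct.summable_and_hasSum_smoothNumbers_prod_primesBelow_tsum hg1 hgm
    (fun {p} hp => (local_factor_le ha hp).1) (N + 1)
  have hlogN : 0 ≤ Real.log N := Real.log_natCast_nonneg N
  have hN0 : (0 : ℝ) < N := by exact_mod_cast (by omega : 0 < N)
  -- The terms are nonnegative and every `n ≤ N` has all its prime factors at most `N`.
  have hsum : ∑ n ∈ Finset.Icc 1 N, g n ≤ ∏ p ∈ (N + 1).primesBelow, ∑' k : ℕ, g (p ^ k) := by
    rw [← hEP.2.tsum_eq, tsum_subtype (f := g)]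
    have hs : Summable (Set.indicator (N + 1).smoothNumbers g) :=
      summable_subtype_iff_indicator.mp hEP.2.summable
    refine le_trans (le_of_eq ?_) (hs.sum_le_tsum (Finset.Icc 1 N) fun n _ => ?_)
    · refine Finset.sum_congr rfl fun n hn => ?_
      obtain ⟨hn1, hn2⟩ := Finset.mem_Icc.mp hn
      rw [Set.indicator_of_mem]
      rw [Nat.mem_smoothNumbers']
      intro p _ hd
      have := Nat.le_of_dvd hn1 hd
      omega
    · exact Set.indicator_nonneg (fun n _ => by simp only [hg]; positivity) n
  have hprimes : (N + 1).primesBelow = (Finset.Ioc 0 N).filter Nat.Prime := by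
    ext p
    simp only [Nat.mem_primesBelow, Finset.mem_filter, Finset.mem_Ioc]
    constructor
    · rintro ⟨h1, h2⟩; exact ⟨⟨h2.pos, by omega⟩, h2⟩
    · rintro ⟨⟨_, h1⟩, h2⟩; exact ⟨by omega, h2⟩
  set T : ℝ := 3 * C₁ * (|a| * Real.log N) ^ 2 with hT
  have hprod : ∏ p ∈ (N + 1).primesBelow, ∑' k : ℕ, g (p ^ k) ≤ Real.exp T := by
    have hb : ∀ p ∈ (N + 1).primesBelow, ∑' k : ℕ, g (p ^ k) ≤
        Real.exp (C₁ * |a| ^ 2 * Real.log N * (Real.log p / p)) := by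
      intro p hp
      have hpp := Nat.prime_of_mem_primesBelow hp
      have hpN : p ≤ N := Nat.lt_succ_iff.mp (Nat.lt_of_mem_primesBelow hp)
      have hp0 : (0 : ℝ) < p := by exact_mod_cast hpp.pos
      have hl0 : 0 ≤ Real.log p := Real.log_natCast_nonneg p
      have hll : Real.log p ≤ Real.log N := Real.log_le_log hp0 (by exact_mod_cast hpN)
      refine ((local_factor_le ha hpp).2).trans ?_
      -- This is where `|a| log N ≤ 3/2` keeps the Euler factors uniform in `a`.
      have h3 : (p : ℝ) ^ (2 * |a|) ≤ Real.exp 3 := by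
        rw [Real.rpow_def_of_pos hp0]
        gcongr
        nlinarith [mul_le_mul_of_nonneg_left hll (abs_nonneg a)]
      have h4 : 5 / 2 * ((p : ℝ) ^ (2 * |a|) / p) * (2 * |a| * Real.log p) ^ 2 ≤
          C₁ * |a| ^ 2 * Real.log N * (Real.log p / p) := by
        calc 5 / 2 * ((p : ℝ) ^ (2 * |a|) / p) * (2 * |a| * Real.log p) ^ 2
            = 10 * (p : ℝ) ^ (2 * |a|) * |a| ^ 2 * Real.log p * (Real.log p / p) := by ring
          _ ≤ 10 * Real.exp 3 * |a| ^ 2 * Real.log N * (Real.log p / p) := by gcongr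
      have h5 := Real.add_one_le_exp (C₁ * |a| ^ 2 * Real.log N * (Real.log p / p))
      linarith
    refine (Finset.prod_le_prod (fun p _ => tsum_nonneg fun k => by
      simp only [hg]; positivity) hb).trans ?_
    rw [← Real.exp_sum, ← Finset.mul_sum, hprimes]
    gcongr
    calc _ ≤ C₁ * |a| ^ 2 * Real.log N * (3 * Real.log N) := by
          gcongr
          exact sum_log_div_prime_le hN
      _ = T := by rw [hT]; ring
  have hIcc : ∑ n ∈ Finset.Icc 1 N, g n = 1 + ∑ n ∈ Finset.Ioc 1 N, g n := by
    rw [← hg1, ← Finset.sum_insert (by simp), Finset.Ioc_insert_left (by omega)]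
  have hT0 : 0 ≤ T := by positivity
  -- Removing `n = 1` leaves `e^T - 1`, which is of order `T ≍ (|a| log N)²` and not merely bounded.
  have hTe : Real.exp T - 1 ≤ T * Real.exp T := by
    have h1 := Real.add_one_le_exp (-T)
    have h2 : Real.exp (-T) * Real.exp T = 1 := by rw [← Real.exp_add]; simp
    nlinarith [Real.exp_pos T]
  calc ∑ n ∈ Finset.Ioc 1 N, g n ≤ Real.exp T - 1 := by linarith
    _ ≤ T * Real.exp T := hTe
    _ ≤ T * Real.exp (3 * C₁ * (3 / 2) ^ 2) := by
        have h0 : 0 ≤ |a| * Real.log N := by positivity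
        have : T ≤ 3 * C₁ * (3 / 2) ^ 2 := by rw [hT]; gcongr
        gcongr
    _ = _ := by rw [hT]; ring

end LandauSiegel

/-! ### Boundedness of the weight `ϑ`. -/

namespace LandauSiegel

open MeasureTheory Filter in
/-- Shifting a line of integration in the half plane `Re s > 0`. -/
theorem integral_vertical_eq {f : ℂ → ℂ} {a b B : ℝ} (ha : 0 < a) (hab : a ≤ b)
    (hf : ∀ s : ℂ, 0 < s.re → DifferentiableAt ℂ f s)
    (hB : ∀ σ t : ℝ, a ≤ σ → σ ≤ b → ‖f (σ + t * I)‖ ≤ B * Real.exp (-(1 / 4) * t ^ 2)) :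
    ∫ t : ℝ, f (a + t * I) = ∫ t : ℝ, f (b + t * I) := by
  have hint : ∀ σ : ℝ, a ≤ σ → σ ≤ b → Integrable fun t : ℝ => f (σ + t * I) := by
    intro σ h1 h2
    refine Integrable.mono' ((integrable_exp_neg_mul_sq (b := 1 / 4) (by norm_num)).const_mul B) ?_
      (Eventually.of_forall fun t => hB σ t h1 h2)
    refine Continuous.aestronglyMeasurable (continuous_iff_continuousAt.mpr fun t => ?_)
    have := (hf (σ + t * I) (by simp; linarith)).continuousAt
    exact ContinuousAt.comp (g := f) (f := fun t : ℝ => (σ : ℂ) + t * I) this (by fun_prop)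
  have hlim : ∀ σ : ℝ, a ≤ σ → σ ≤ b → Tendsto (fun T : ℝ => ∫ t in (-T)..T, f (σ + t * I)) atTop
      (nhds (∫ t : ℝ, f (σ + t * I))) := fun σ h1 h2 =>
    intervalIntegral_tendsto_integral (hint σ h1 h2) tendsto_neg_atTop_atBot tendsto_id
  have hrect : ∀ T : ℝ, ‖(∫ t in (-T)..T, f (b + t * I)) - ∫ t in (-T)..T, f (a + t * I)‖ ≤
      2 * (B * Real.exp (-(1 / 4) * T ^ 2) * |b - a|) := by
    intro T
    have h := Complex.integral_boundary_rect_eq_zero_of_differentiableOn f (a + (-T : ℝ) * I)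
      (b + (T : ℝ) * I) (fun s hs => (hf s (by
        have h1 := hs.1
        simp only [add_re, ofReal_re, mul_re, I_re, mul_zero, ofReal_im, I_im, mul_one, sub_self,
          add_zero, Set.mem_preimage] at h1
        rw [Set.uIcc_of_le hab] at h1
        exact ha.trans_le h1.1)).differentiableWithinAt)
    simp only [add_re, ofReal_re, mul_re, I_re, mul_zero, ofReal_im, I_im, mul_one, sub_self,
      add_zero, add_im, mul_im, zero_add] at h
    have hh : ∀ T' : ℝ, ‖∫ x : ℝ in a..b, f (x + T' * I)‖ ≤
        B * Real.exp (-(1 / 4) * T' ^ 2) * |b - a| := by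
      intro T'
      refine intervalIntegral.norm_integral_le_of_norm_le_const fun x hx => ?_
      rw [Set.uIoc_of_le hab] at hx
      exact hB x T' hx.1.le hx.2
    have e : I * ((∫ t in (-T)..T, f (b + t * I)) - ∫ t in (-T)..T, f (a + t * I)) =
        (∫ x : ℝ in a..b, f (x + T * I)) - ∫ x : ℝ in a..b, f (x + (-T : ℝ) * I) := by
      simp only [smul_eq_mul] at h
      linear_combination h
    have e2 := congrArg norm e
    rw [norm_mul, Complex.norm_I, one_mul] at e2
    rw [e2]
    refine (norm_sub_le _ _).trans ?_
    have h1 := hh T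
    have h2 := hh (-T)
    rw [neg_sq] at h2
    linarith
  have h0 : Tendsto (fun T : ℝ => 2 * (B * Real.exp (-(1 / 4) * T ^ 2) * |b - a|)) atTop (nhds 0) := by
    have h1 : Tendsto (fun T : ℝ => Real.exp (-(1 / 4) * T ^ 2)) atTop (nhds 0) := by
      refine Real.tendsto_exp_atBot.comp ?_
      exact (tendsto_pow_atTop two_ne_zero).const_mul_atTop_of_neg (by norm_num)
    simpa using ((h1.const_mul B).mul_const |b - a|).const_mul 2
  have hd := (hlim b hab le_rfl).sub (hlim a le_rfl hab)
  have hz := squeeze_zero_norm hrect h0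
  exact (sub_eq_zero.mp (tendsto_nhds_unique hd hz)).symm

theorem Q_pos (D : ℕ) : 0 < Q D := Real.exp_pos _

theorem Q_rpow (D : ℕ) (y : ℝ) : Q D ^ y = Real.exp (logD D ^ 2 * y) := by
  rw [Q, ← Real.exp_mul]

theorem norm_Q_cpow (D : ℕ) (s : ℂ) : ‖(Q D : ℂ) ^ s‖ = Real.exp (logD D ^ 2 * s.re) := by
  rw [Complex.norm_cpow_eq_rpow_re_of_pos (Q_pos D), Q_rpow]

theorem norm_Y_le {D : ℕ} (hL : 1 ≤ logD D) {σ t : ℝ} (hσ : 0 < σ) (hσ1 : σ ≤ 1) :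
    ‖Y D (σ + t * I)‖ ≤ 10 * alpha D * Real.exp (logD D ^ 2 * (σ / 10)) *
      (2 * Real.exp (-(1 / 4) * t ^ 2)) * (σ ^ 2 + t ^ 2)⁻¹ := by
  have hα : 0 < alpha D := by unfold alpha; positivity
  rw [Y, norm_div, norm_mul, norm_mul, norm_mul, norm_pow, norm_sq_add_mul_I, Complex.norm_exp,
    Complex.norm_real, Real.norm_eq_abs, abs_of_pos hα, div_eq_mul_inv]
  have e1 : (((σ + t * I) ^ 2 / 4 : ℂ)).re = σ ^ 2 / 4 + -(1 / 4) * t ^ 2 := by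
    simp [pow_two]; ring
  have e2 : ‖(Q D : ℂ) ^ ((σ + t * I : ℂ) / 10) - (Q D : ℂ) ^ (-(σ + t * I : ℂ) / 10)‖ ≤
      2 * Real.exp (logD D ^ 2 * (σ / 10)) := by
    refine (norm_sub_le _ _).trans ?_
    rw [norm_Q_cpow, norm_Q_cpow, two_mul]
    have r1 : ((σ + t * I : ℂ) / 10).re = σ / 10 := by simp
    have r2 : (-(σ + t * I : ℂ) / 10).re = -(σ / 10) := by simp; ring
    rw [r1, r2]
    gcongr
    linarith
  have e3 : Real.exp (((σ + t * I) ^ 2 / 4 : ℂ)).re ≤ 2 * Real.exp (-(1 / 4) * t ^ 2) := by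
    rw [e1, Real.exp_add]
    gcongr
    have h1 : Real.exp (σ ^ 2 / 4) ≤ Real.exp (1 / 4) := by gcongr; nlinarith
    have h2 : Real.exp (1 / 4) ^ 4 = Real.exp 1 := by rw [← Real.exp_nat_mul]; norm_num
    have h3 := Real.exp_one_lt_d9
    have h4 : Real.exp (1 / 4) ≤ 2 :=
      (pow_le_pow_iff_left₀ (Real.exp_nonneg _) (by norm_num) four_ne_zero).mp
        (by rw [h2]; linarith)
    linarith
  gcongr ?_ * ?_ * _
  rw [Complex.norm_ofNat]
  calc 5 * alpha D * _ ≤ 5 * alpha D * (2 * Real.exp (logD D ^ 2 * (σ / 10))) := by gcongr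
    _ = _ := by ring

open MeasureTheory in
/-- The weight `ϑ` is bounded. -/
theorem norm_vartheta_le {D : ℕ} (hL : 1 ≤ logD D) {x : ℝ} (hx : 0 < x)
    (hx2 : alpha D * Real.log x ≤ 2) : ‖vartheta D x‖ ≤ 10 * Real.exp 3 := by
  have hα : 0 < alpha D := by unfold alpha; positivity
  have hα1 : alpha D ≤ 1 := by
    unfold alpha; exact inv_le_one_of_one_le₀ (one_le_pow₀ hL)
  have hαL : logD D ^ 2 * alpha D = 1 := by unfold alpha; field_simp
  have hQ0 : (Q D : ℂ) ≠ 0 := by exact_mod_cast (Q_pos D).ne'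
  have hx0 : (x : ℂ) ≠ 0 := by exact_mod_cast hx.ne'
  set f : ℂ → ℂ := fun s => (x : ℂ) ^ s * Y D s with hf
  have hnx : ∀ σ t : ℝ, ‖(x : ℂ) ^ ((σ : ℂ) + t * I)‖ = Real.exp (Real.log x * σ) := by
    intro σ t
    rw [Complex.norm_cpow_eq_rpow_re_of_pos hx, Real.rpow_def_of_pos hx]; simp
  -- On the line `Re s = α` both `Q^{s/10}` and `x^s` are bounded, and the factor `α / |s|²` has
  -- integral `π`.
  have hshift : ∫ t : ℝ, f ((alpha D : ℝ) + t * I) = ∫ t : ℝ, f ((1 : ℝ) + t * I) := by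
    refine integral_vertical_eq (B := Real.exp |Real.log x| * (10 * alpha D *
      Real.exp (logD D ^ 2 * (1 / 10)) * 2 * (alpha D ^ 2)⁻¹)) hα hα1 (fun s hs => ?_)
      fun σ t h1 h2 => ?_
    · have hs0 : s ^ 2 ≠ 0 := pow_ne_zero 2 fun h => by rw [h] at hs; simp at hs
      simp only [hf, Y]
      refine (differentiableAt_id.const_cpow (Or.inl hx0)).mul (DifferentiableAt.div ?_ (by fun_prop) hs0)
      refine DifferentiableAt.mul (DifferentiableAt.mul (by fun_prop) (DifferentiableAt.sub ?_ ?_)) (by fun_prop)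
      · exact DifferentiableAt.const_cpow (by fun_prop) (Or.inl hQ0)
      · exact DifferentiableAt.const_cpow (by fun_prop) (Or.inl hQ0)
    · have hσ : 0 < σ := by linarith
      simp only [hf]
      rw [norm_mul, hnx]
      have h3 : Real.log x * σ ≤ |Real.log x| := by
        calc Real.log x * σ ≤ |Real.log x| * σ := by gcongr; exact le_abs_self _
          _ ≤ |Real.log x| * 1 := by gcongr
          _ = _ := mul_one _
      calc _ ≤ Real.exp |Real.log x| * (10 * alpha D * Real.exp (logD D ^ 2 * (σ / 10)) *
            (2 * Real.exp (-(1 / 4) * t ^ 2)) * (σ ^ 2 + t ^ 2)⁻¹) := by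
            gcongr
            exact norm_Y_le hL hσ h2
        _ ≤ Real.exp |Real.log x| * (10 * alpha D * Real.exp (logD D ^ 2 * (1 / 10)) *
            (2 * Real.exp (-(1 / 4) * t ^ 2)) * (alpha D ^ 2)⁻¹) := by
            gcongr
            nlinarith [sq_nonneg t]
        _ = _ := by ring
  have hv : vartheta D x = 1 / (2 * Real.pi * I) * (I * ∫ t : ℝ, f ((1 : ℝ) + t * I)) := by
    rw [vartheta]
    congr 1
    rw [← integral_const_mul]
    congr 1
    funext t
    simp only [hf]
    have : (1 + I * t : ℂ) = ((1 : ℝ) : ℂ) + t * I := by push_cast; ring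
    rw [this]
    ring
  rw [hv, ← hshift, norm_mul, norm_mul, Complex.norm_I, one_mul]
  have hI : ‖∫ t : ℝ, f ((alpha D : ℝ) + t * I)‖ ≤ 20 * Real.exp 3 * Real.pi := by
    have hint : Integrable fun t : ℝ => 20 * Real.exp 3 * ((alpha D)⁻¹ * (1 + ((alpha D)⁻¹ * t) ^ 2)⁻¹) :=
      ((integrable_inv_one_add_sq.comp_mul_left' (inv_ne_zero hα.ne')).const_mul _).const_mul _
    refine (norm_integral_le_of_norm_le hint (Filter.Eventually.of_forall fun t => ?_)).trans
      (le_of_eq ?_)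
    · simp only [hf]
      rw [norm_mul, hnx]
      have h1 : Real.exp (-(1 / 4) * t ^ 2) ≤ 1 := by
        rw [Real.exp_le_one_iff]; nlinarith [sq_nonneg t]
      have h2 : logD D ^ 2 * (alpha D / 10) = 1 / 10 := by rw [← mul_div_assoc, hαL]
      calc _ ≤ Real.exp (Real.log x * alpha D) * (10 * alpha D * Real.exp (logD D ^ 2 * (alpha D / 10)) *
            (2 * Real.exp (-(1 / 4) * t ^ 2)) * (alpha D ^ 2 + t ^ 2)⁻¹) := by
            gcongr
            exact norm_Y_le hL hα hα1
        _ ≤ Real.exp 2 * (10 * alpha D * Real.exp 1 * (2 * 1) * (alpha D ^ 2 + t ^ 2)⁻¹) := by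
            rw [h2, mul_comm (Real.log x)]
            gcongr
            norm_num
        _ = 20 * Real.exp 3 * (alpha D * (alpha D ^ 2 + t ^ 2)⁻¹) := by
            rw [show (3 : ℝ) = 2 + 1 by norm_num, Real.exp_add]; ring
        _ = _ := by
            congr 1
            field_simp
    · rw [integral_const_mul, integral_const_mul,
        Measure.integral_comp_mul_left (fun t => (1 + t ^ 2)⁻¹), integral_univ_inv_one_add_sq,
        inv_inv, abs_of_pos hα, smul_eq_mul]
      field_simp
  have hpi := Real.pi_pos
  calc _ ≤ ‖(1 / (2 * Real.pi * I) : ℂ)‖ * (20 * Real.exp 3 * Real.pi) := by gcongr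
    _ = 10 * Real.exp 3 := by
      rw [norm_div, norm_one, norm_mul, norm_mul, Complex.norm_I, Complex.norm_real,
        Real.norm_eq_abs, abs_of_pos hpi, Complex.norm_ofNat]
      field_simp
      norm_num

end LandauSiegel

/-! ### The mean value estimate over the zeros. -/

namespace LandauSiegel

theorem alpha_pos {D : ℕ} (hL : 1 ≤ logD D) : 0 < alpha D := by unfold alpha; positivity

theorem logD_sq_mul_alpha {D : ℕ} (hL : 1 ≤ logD D) : logD D ^ 2 * alpha D = 1 := by
  unfold alpha; field_simp

theorem finite_PsiStar (D : ℕ) [NeZero D] (χ : DirichletCharacter ℂ D) :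
    (PsiStar D χ).Finite := by
  have h1 : {q : ℕ+ | (q : ℕ) < ⌈2 * Q D⌉₊}.Finite :=
    (Set.finite_lt_nat ⌈2 * Q D⌉₊).preimage PNat.coe_injective.injOn
  have h2 := h1.biUnion (t := fun q => Set.range fun ψ : DirichletCharacter ℂ (q : ℕ) => (⟨q, ψ⟩ : Chars))
    fun q _ => Set.finite_range _
  exact h2.subset fun p hp => Set.mem_iUnion₂.mpr ⟨p.1, Nat.lt_ceil.mpr hp.1.2.1, ⟨p.2, rfl⟩⟩

/-- The index of the box of height `α` that contains a point of the strip `|Im s - D| < 1`. -/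
noncomputable def boxIndex (D : ℕ) (s : ℂ) : ℕ := ⌊(s.im - (D - 1)) / alpha D⌋₊

/-- The height of the lower side of a box. -/
noncomputable def boxHeight (D j : ℕ) : ℝ := D - 1 + alpha D * j

theorem boxIndex_spec {D : ℕ} (hL : 1 ≤ logD D) {s : ℂ} (hs : |s.im - D| < 1) :
    |s.im - boxHeight D (boxIndex D s)| ≤ alpha D ∧ |boxHeight D (boxIndex D s) - D| ≤ 1 ∧
      boxIndex D s < ⌊3 * logD D ^ 2⌋₊ := by
  have hα := alpha_pos hL
  obtain ⟨h1, h2⟩ := abs_lt.mp hs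
  have h0 : 0 ≤ (s.im - (D - 1)) / alpha D := div_nonneg (by linarith) hα.le
  have h3 := Nat.floor_le h0
  have h4 := Nat.lt_floor_add_one ((s.im - (D - 1)) / alpha D)
  have h5 : (boxIndex D s : ℝ) * alpha D ≤ s.im - (D - 1) := (le_div_iff₀ hα).mp h3
  have h6 : s.im - (D - 1) < ((boxIndex D s : ℝ) + 1) * alpha D := (div_lt_iff₀ hα).mp h4
  have h7 : 0 ≤ alpha D * (boxIndex D s : ℝ) := by positivity
  refine ⟨?_, ?_, ?_⟩
  · rw [abs_le, boxHeight]; constructor <;> linarith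
  · rw [abs_le, boxHeight]; constructor <;> linarith
  -- The strip has height `2`, so the index is at most `2 𝓛²`; the remaining `𝓛² ≥ 1` pays for the
  -- strict inequality.
  · rw [Nat.lt_iff_add_one_le, Nat.le_floor_iff (by positivity)]
    have h8 : (s.im - (D - 1)) / alpha D = (s.im - (D - 1)) * logD D ^ 2 := by
      rw [alpha, div_inv_eq_mul]
    push_cast
    have h9 : 1 ≤ logD D ^ 2 := one_le_pow₀ hL
    have h10 : (boxIndex D s : ℝ) ≤ (s.im - (D - 1)) * logD D ^ 2 := h8 ▸ h3
    have h11 : (s.im - (D - 1)) * logD D ^ 2 ≤ 2 * logD D ^ 2 := by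
      gcongr; linarith
    linarith

variable {D : ℕ} [NeZero D] {χ : DirichletCharacter ℂ D}

theorem card_box_le (hl : 101 ≤ Real.log (logD D))
    (hl2 : 2000 * Real.log (logD D) ≤ logD D) (hχ : χ.IsQuadratic) {p : Chars}
    (hp : p ∈ PsiStar D χ) (j : ℕ) (Z : Finset ℂ)
    (hZ : ∀ s ∈ Z, s ∈ zeroSet χ p.2 ∧ boxIndex D s = j) : Z.card ≤ 50 := by
  have hL := logD_le_of_large hl
  rcases Z.eq_empty_or_nonempty with rfl | ⟨s₀, hs₀⟩
  · simp
  refine card_zeros_disc_le hl hl2 hχ hp (t := boxHeight D j) ?_ Z fun s hs => ⟨(hZ s hs).1, ?_⟩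
  · have := (boxIndex_spec (by linarith) (hZ s₀ hs₀).1.1).2.1
    rwa [(hZ s₀ hs₀).2] at this
  · have := (boxIndex_spec (by linarith) (hZ s hs).1.1).1
    rwa [(hZ s hs).2] at this

/-- Pigeonhole: finitely many boxes, each with at most `50` zeros. -/
theorem finite_zeroSet (hl : 101 ≤ Real.log (logD D))
    (hl2 : 2000 * Real.log (logD D) ≤ logD D) (hχ : χ.IsQuadratic) {p : Chars}
    (hp : p ∈ PsiStar D χ) : (zeroSet χ p.2).Finite := by
  classical
  have hL := logD_le_of_large hl
  by_contra hinf
  obtain ⟨Z, hZ, hc⟩ := Set.Infinite.exists_subset_card_eq hinf (50 * ⌊3 * logD D ^ 2⌋₊ + 1)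
  have h := Finset.card_le_mul_card_image_of_maps_to (f := boxIndex D) (s := Z)
    (t := Finset.range ⌊3 * logD D ^ 2⌋₊)
    (fun s hs => Finset.mem_range.mpr (boxIndex_spec (by linarith) (hZ hs).1).2.2) 50
    fun j _ => card_box_le hl hl2 hχ hp j _ fun s hs =>
      ⟨hZ (Finset.mem_filter.mp hs).1, (Finset.mem_filter.mp hs).2⟩
  rw [hc, Finset.card_range] at h
  omega

/-- The constant of the mean value estimate. -/
noncomputable def meanConst : ℝ :=
  Real.exp (1 + 3 ^ 2) * (50 * (3 * (Real.exp (1 + (2 * Real.pi) ^ 2) * 4)))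

theorem meanConst_pos : 0 < meanConst := by unfold meanConst; positivity

theorem one_le_Q (D : ℕ) : 1 ≤ Q D := Real.one_le_exp (sq_nonneg _)

/-- A large sieve over the boxes that contain zeros. -/
theorem sum_box_le (hl : 101 ≤ Real.log (logD D))
    (hl2 : 2000 * Real.log (logD D) ≤ logD D) (hχ : χ.IsQuadratic) (T : Finset (Chars × ℂ))
    (hT : ∀ x ∈ T, x.1 ∈ PsiStar D χ ∧ x.2 ∈ zeroSet χ x.1.2)
    (S : Finset ℕ) (hS : ∀ n ∈ S, 1 ≤ n ∧ (n : ℝ) ≤ Q D ^ (3 / 2 : ℝ)) (c : ℕ → ℂ) :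
    ∑ x ∈ T, ‖∑ n ∈ S, c n * (x.1.2 (n : ZMod x.1.1) *
      (n : ℂ) ^ (-(boxHeight D (boxIndex D x.2) * I)))‖ ^ 2 ≤
      50 * (3 * (Real.exp (1 + (2 * Real.pi) ^ 2) * 4)) * (logD D ^ 2 * Q D ^ 2) *
        ∑ n ∈ S, ‖c n‖ ^ 2 := by
  classical
  have hL := logD_le_of_large hl
  have hQ := one_le_Q D
  set P : Finset Chars := T.image Prod.fst with hP
  have hPmem : ∀ p ∈ P, p ∈ PsiStar D χ := by
    intro p hp
    obtain ⟨x, hx, rfl⟩ := Finset.mem_image.mp hp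
    exact (hT x hx).1
  set N := ⌊3 * logD D ^ 2⌋₊ with hN
  set g : Chars × ℕ → ℝ := fun y => ‖∑ n ∈ S, c n * (y.1.2 (n : ZMod y.1.1) *
      (n : ℂ) ^ (-(boxHeight D y.2 * I)))‖ ^ 2 with hg
  have hmaps : ∀ x ∈ T, (x.1, boxIndex D x.2) ∈ P ×ˢ Finset.range N := fun x hx =>
    Finset.mem_product.mpr ⟨Finset.mem_image_of_mem _ hx,
      Finset.mem_range.mpr (boxIndex_spec (by linarith) (hT x hx).2.1).2.2⟩
  -- The summand depends on the zero only through its box, and each pair of a character and a box is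
  -- hit at most `50` times.
  have hfib : ∑ x ∈ T, g (x.1, boxIndex D x.2) ≤ ∑ y ∈ P ×ˢ Finset.range N, 50 * g y := by
    rw [← Finset.sum_fiberwise_of_maps_to hmaps]
    refine Finset.sum_le_sum fun y hy => ?_
    have hc : (T.filter fun x => (x.1, boxIndex D x.2) = y).card ≤ 50 := by
      rw [← Finset.card_image_of_injOn (f := Prod.snd)]
      · refine card_box_le hl hl2 hχ (hPmem y.1 (Finset.mem_product.mp hy).1) y.2 _ fun s hs => ?_
        obtain ⟨x, hx, rfl⟩ := Finset.mem_image.mp hs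
        obtain ⟨hx1, rfl⟩ := Finset.mem_filter.mp hx
        exact ⟨(hT x hx1).2, rfl⟩
      · intro x hx x' hx' h
        have e1 := (Finset.mem_filter.mp hx).2
        have e2 := (Finset.mem_filter.mp hx').2
        exact Prod.ext ((congrArg Prod.fst e1).trans (congrArg Prod.fst e2).symm) h
    rw [Finset.sum_congr rfl (g := fun _ => g y) fun x hx => by rw [(Finset.mem_filter.mp hx).2],
      Finset.sum_const, nsmul_eq_mul]
    have : 0 ≤ g y := sq_nonneg _
    gcongr
    exact_mod_cast hc
  -- `X` bounds the moduli, and `Q^{3/2} ≤ Q² ≤ X²` puts the polynomial in the range where the large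
  -- sieve costs only `X²`.
  set X := ⌊2 * Q D⌋₊ with hX
  have hX1 : (X : ℝ) ≤ 2 * Q D := Nat.floor_le (by linarith)
  have hX2 : Q D ≤ X := by
    have := Nat.lt_floor_add_one (2 * Q D)
    linarith
  have hSX : S ⊆ Finset.Icc 1 (X ^ 2) := by
    intro n hn
    obtain ⟨h1, h2⟩ := hS n hn
    refine Finset.mem_Icc.mpr ⟨h1, ?_⟩
    have h3 : Q D ^ (3 / 2 : ℝ) ≤ Q D ^ (2 : ℝ) := Real.rpow_le_rpow_of_exponent_le hQ (by norm_num)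
    rw [Real.rpow_two] at h3
    have h4 : Q D ^ 2 ≤ (X : ℝ) ^ 2 := by gcongr
    exact_mod_cast h2.trans (h3.trans h4)
  have hls : ∀ j : ℕ, ∑ p ∈ P, g (p, j) ≤
      Real.exp (1 + (2 * Real.pi) ^ 2) * ((X : ℝ) ^ 2 * ∑ n ∈ S, ‖c n‖ ^ 2) := by
    intro j
    have h := large_sieve X S hSX P (fun p hp => ⟨?_, (hPmem p hp).1.2.2.2.2.1⟩)
      fun n => c n * (n : ℂ) ^ (-(boxHeight D j * I))
    · refine le_trans (le_of_eq ?_) (h.trans (le_of_eq ?_))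
      · refine Finset.sum_congr rfl fun p _ => ?_
        simp only [hg]
        congr 2
        exact Finset.sum_congr rfl fun n _ => by ring
      · congr 2
        refine Finset.sum_congr rfl fun n hn => ?_
        rw [norm_mul, Complex.norm_natCast_cpow_of_pos (hS n hn).1]
        simp
    · exact Nat.le_floor (hPmem p hp).1.2.1.le
  calc ∑ x ∈ T, g (x.1, boxIndex D x.2) ≤ ∑ y ∈ P ×ˢ Finset.range N, 50 * g y := hfib
    _ = 50 * ∑ j ∈ Finset.range N, ∑ p ∈ P, g (p, j) := by
        rw [← Finset.mul_sum, Finset.sum_product_right]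
    _ ≤ 50 * ∑ j ∈ Finset.range N,
        Real.exp (1 + (2 * Real.pi) ^ 2) * ((X : ℝ) ^ 2 * ∑ n ∈ S, ‖c n‖ ^ 2) := by
        gcongr with j _
        exact hls j
    _ = 50 * ((N : ℝ) * (Real.exp (1 + (2 * Real.pi) ^ 2) * ((X : ℝ) ^ 2 * ∑ n ∈ S, ‖c n‖ ^ 2))) := by
        rw [Finset.sum_const, Finset.card_range, nsmul_eq_mul]
    _ ≤ 50 * ((3 * logD D ^ 2) * (Real.exp (1 + (2 * Real.pi) ^ 2) *
        ((2 * Q D) ^ 2 * ∑ n ∈ S, ‖c n‖ ^ 2))) := by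
        have : (N : ℝ) ≤ 3 * logD D ^ 2 := Nat.floor_le (by positivity)
        gcongr
    _ = _ := by ring

/-- The mean value estimate at points near the zeros. -/
theorem sum_dirichlet_poly_le (hl : 101 ≤ Real.log (logD D))
    (hl2 : 2000 * Real.log (logD D) ≤ logD D) (hχ : χ.IsQuadratic) (T : Finset (Chars × ℂ))
    (hT : ∀ x ∈ T, x.1 ∈ PsiStar D χ ∧ x.2 ∈ zeroSet χ x.1.2)
    (w : ℂ → ℂ) (hw : ∀ s : ℂ, |s.re - 1 / 2| ≤ alpha D →
      |(w s).re - 1 / 2| ≤ alpha D ∧ (w s).im = s.im)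
    (S : Finset ℕ) (hS : ∀ n ∈ S, 1 ≤ n ∧ (n : ℝ) ≤ Q D ^ (3 / 2 : ℝ)) (a : ℕ → ℂ) :
    ∑ x ∈ T, ‖∑ n ∈ S, a n * x.1.2 (n : ZMod x.1.1) / (n : ℂ) ^ w x.2‖ ^ 2 ≤
      meanConst * (logD D ^ 2 * Q D ^ 2) * ∑ n ∈ S, ‖a n‖ ^ 2 / n := by
  have hL := logD_le_of_large hl
  have hα := alpha_pos (D := D) (by linarith)
  have hαL := logD_sq_mul_alpha (D := D) (by linarith)
  have h := sum_norm_sq_exp_perturb T S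
    (fun x n => x.1.2 (n : ZMod x.1.1) * (n : ℂ) ^ (-(boxHeight D (boxIndex D x.2) * I)))
    (50 * (3 * (Real.exp (1 + (2 * Real.pi) ^ 2) * 4)) * (logD D ^ 2 * Q D ^ 2)) (by positivity)
    (sum_box_le hl hl2 hχ T hT S hS)
    -- The displacement from the base point of the box is at most `α` in each coordinate, so after
    -- division by `2α` it has norm at most `1`. The compensating `φ(n) = 2α log n` is at most `3`
    -- for `n ≤ Q^{3/2}`.
    (fun x => -(w x.2 - (1 / 2 + boxHeight D (boxIndex D x.2) * I)) / (2 * alpha D : ℝ))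
    (fun x hx => ?_) (fun n => 2 * alpha D * Real.log n) 3 (fun n hn => ?_)
    (fun n => a n * (n : ℂ) ^ (-(1 / 2) : ℂ))
  · refine le_trans (le_of_eq ?_) (h.trans (le_of_eq ?_))
    · refine Finset.sum_congr rfl fun x hx => ?_
      congr 2
      refine Finset.sum_congr rfl fun n hn => ?_
      have hn0 : (n : ℂ) ≠ 0 := by exact_mod_cast (by have := (hS n hn).1; omega : n ≠ 0)
      have e : exp (-(w x.2 - (1 / 2 + boxHeight D (boxIndex D x.2) * I)) / (2 * alpha D : ℝ) *
          ((2 * alpha D * Real.log n : ℝ) : ℂ)) =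
          (n : ℂ) ^ (-(w x.2 - (1 / 2 + boxHeight D (boxIndex D x.2) * I))) := by
        rw [Complex.cpow_def_of_ne_zero hn0, ← Complex.natCast_log]
        congr 1
        have : (alpha D : ℂ) ≠ 0 := by exact_mod_cast hα.ne'
        push_cast
        field_simp
      rw [e, div_eq_mul_inv, ← Complex.cpow_neg]
      have e2 : (n : ℂ) ^ (-w x.2) = (n : ℂ) ^ (-(1 / 2) : ℂ) *
          (n : ℂ) ^ (-(boxHeight D (boxIndex D x.2) * I)) *
          (n : ℂ) ^ (-(w x.2 - (1 / 2 + boxHeight D (boxIndex D x.2) * I))) := by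
        rw [← Complex.cpow_add _ _ hn0, ← Complex.cpow_add _ _ hn0]
        congr 1
        ring
      rw [e2]
      ring
    · rw [meanConst]
      have : ∑ n ∈ S, ‖a n * (n : ℂ) ^ (-(1 / 2) : ℂ)‖ ^ 2 = ∑ n ∈ S, ‖a n‖ ^ 2 / n := by
        refine Finset.sum_congr rfl fun n hn => ?_
        have hn1 : 0 < n := (hS n hn).1
        rw [norm_mul, Complex.norm_natCast_cpow_of_pos hn1, mul_pow, ← Real.rpow_natCast,
          ← Real.rpow_natCast ((n : ℝ) ^ _), ← Real.rpow_mul (by positivity)]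
        have : ((-(1 / 2) : ℂ)).re * ((2 : ℕ) : ℝ) = -1 := by
          norm_num
        rw [this, Real.rpow_neg_one, div_eq_mul_inv]
      rw [this]
      ring
  · obtain ⟨hp, hz⟩ := hT x hx
    obtain ⟨h1, h2⟩ := hw x.2 (zero_near_line hl hl2 hχ hp hz)
    have h3 := (boxIndex_spec (D := D) (by linarith) hz.1).1
    rw [norm_div, norm_neg, Complex.norm_real, Real.norm_eq_abs, abs_of_pos (by positivity),
      div_le_one (by positivity)]
    refine (Complex.norm_le_abs_re_add_abs_im _).trans ?_
    have r : (w x.2 - (1 / 2 + boxHeight D (boxIndex D x.2) * I)).re = (w x.2).re - 1 / 2 := by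
      simp
    have i : (w x.2 - (1 / 2 + boxHeight D (boxIndex D x.2) * I)).im =
        x.2.im - boxHeight D (boxIndex D x.2) := by
      simp [h2]
    rw [r, i]
    linarith
  · obtain ⟨h1, h2⟩ := hS n hn
    have hn1 : (1 : ℝ) ≤ n := by exact_mod_cast h1
    have hlog : Real.log n ≤ logD D ^ 2 * (3 / 2) := by
      rw [Q_rpow] at h2
      exact (Real.log_le_iff_le_exp (by linarith)).mpr h2
    rw [abs_of_nonneg (by have := Real.log_nonneg hn1; positivity)]
    calc 2 * alpha D * Real.log n ≤ 2 * alpha D * (logD D ^ 2 * (3 / 2)) := by gcongr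
      _ = 3 * (logD D ^ 2 * alpha D) := by ring
      _ = 3 := by rw [hαL, mul_one]

/-- The mean value estimate for `dirPoly`. -/
theorem sum_dirPoly_le (hl : 101 ≤ Real.log (logD D))
    (hl2 : 2000 * Real.log (logD D) ≤ logD D) (hχ : χ.IsQuadratic) (T : Finset (Chars × ℂ))
    (hT : ∀ x ∈ T, x.1 ∈ PsiStar D χ ∧ x.2 ∈ zeroSet χ x.1.2) {A B : ℝ} (hB0 : 0 ≤ B)
    (hB : B ≤ Q D ^ (3 / 2 : ℝ)) (c : ℕ → ℝ) (w : ℕ → ℂ) :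
    ∑ x ∈ T, ‖dirPoly A B c w x.2 x.1.2‖ ^ 2 ≤ meanConst * (logD D ^ 2 * Q D ^ 2) *
      ∑ n ∈ Finset.Ioc ⌊A⌋₊ ⌊B⌋₊, c n ^ 2 / n * ‖w n‖ ^ 2 := by
  have h := sum_dirichlet_poly_le hl hl2 hχ T hT id (fun s hs => ⟨hs, rfl⟩)
    (Finset.Ioc ⌊A⌋₊ ⌊B⌋₊) (fun n hn => ?_) fun n => c n * w n
  · refine le_trans (le_of_eq ?_) (h.trans (le_of_eq ?_))
    · refine Finset.sum_congr rfl fun x _ => ?_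
      rw [dirPoly]
      congr 2
      exact Finset.sum_congr rfl fun n _ => by simp only [id]; ring
    · congr 1
      refine Finset.sum_congr rfl fun n _ => ?_
      rw [norm_mul, mul_pow, Complex.norm_real, Real.norm_eq_abs, sq_abs]
      ring
  · obtain ⟨h1, h2⟩ := Finset.mem_Ioc.mp hn
    exact ⟨by omega, (Nat.le_floor_iff hB0).mp h2 |>.trans hB⟩

/-- Conjugation turns the value at `1 - ρ` with `ψ̄` into a polynomial in `ψ` at `1 - ρ̄`, which has
the height of `ρ` and the same distance from the critical line. -/
theorem sum_dirPoly_one_sub_le (hl : 101 ≤ Real.log (logD D))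
    (hl2 : 2000 * Real.log (logD D) ≤ logD D) (hχ : χ.IsQuadratic) (T : Finset (Chars × ℂ))
    (hT : ∀ x ∈ T, x.1 ∈ PsiStar D χ ∧ x.2 ∈ zeroSet χ x.1.2) {A B : ℝ} (hB0 : 0 ≤ B)
    (hB : B ≤ Q D ^ (3 / 2 : ℝ)) (c : ℕ → ℝ) (w : ℕ → ℂ) :
    ∑ x ∈ T, ‖dirPoly A B c w (1 - x.2) x.1.2⁻¹‖ ^ 2 ≤ meanConst * (logD D ^ 2 * Q D ^ 2) *
      ∑ n ∈ Finset.Ioc ⌊A⌋₊ ⌊B⌋₊, c n ^ 2 / n * ‖w n‖ ^ 2 := by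
  have h := sum_dirichlet_poly_le hl hl2 hχ T hT (fun s => 1 - (starRingEnd ℂ) s)
    (fun s hs => ⟨by
      have : (1 - (starRingEnd ℂ) s).re - 1 / 2 = -(s.re - 1 / 2) := by simp; ring
      rwa [this, abs_neg], by simp⟩)
    (Finset.Ioc ⌊A⌋₊ ⌊B⌋₊) (fun n hn => ?_) fun n => (starRingEnd ℂ) (c n * w n)
  · refine le_trans (le_of_eq ?_) (h.trans (le_of_eq ?_))
    · refine Finset.sum_congr rfl fun x _ => ?_
      rw [dirPoly, ← Complex.norm_conj, map_sum]
      congr 2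
      refine Finset.sum_congr rfl fun n _ => ?_
      have e : (1 - (starRingEnd ℂ) x.2) = (starRingEnd ℂ) (1 - x.2) := by simp
      rw [e, natCast_cpow_conj, inv_apply_eq_conj]
      simp only [map_mul, map_div₀, Complex.conj_conj]
      ring
    · congr 1
      refine Finset.sum_congr rfl fun n _ => ?_
      rw [Complex.norm_conj, norm_mul, mul_pow, Complex.norm_real, Real.norm_eq_abs, sq_abs]
      ring
  · obtain ⟨h1, h2⟩ := Finset.mem_Ioc.mp hn
    exact ⟨by omega, (Nat.le_floor_iff hB0).mp h2 |>.trans hB⟩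

end LandauSiegel

/-! ### Coefficient sums against kernels in `u = α log n`. -/

namespace LandauSiegel

/-- The constant in the mean square of the coefficients of `ζ(s + a) / ζ(s - a)`. -/
noncomputable def lamConst : ℝ := sum_zetaQuotCoeff_sq_le.choose

theorem lamConst_nonneg : 0 ≤ lamConst := sum_zetaQuotCoeff_sq_le.choose_spec.1

theorem one_le_Q_rpow {D : ℕ} {b : ℝ} (hb : 0 ≤ b) : 1 ≤ Q D ^ b :=
  Real.one_le_rpow (one_le_Q D) hb

theorem alpha_mul_log_nonneg {D : ℕ} (hL : 1 ≤ logD D) (n : ℕ) : 0 ≤ alpha D * Real.log n :=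
  mul_nonneg (alpha_pos hL).le (Real.log_natCast_nonneg n)

theorem le_Q_rpow_iff {D n : ℕ} (hL : 1 ≤ logD D) (hn : 1 ≤ n) (b : ℝ) :
    (n : ℝ) ≤ Q D ^ b ↔ alpha D * Real.log n ≤ b := by
  have hn0 : (0 : ℝ) < n := by exact_mod_cast hn
  have hL2 : 0 < logD D ^ 2 := by positivity
  rw [Q_rpow, ← Real.log_le_iff_le_exp hn0, alpha, inv_mul_le_iff₀ hL2]

theorem alpha_mul_log_le {D n : ℕ} (hL : 1 ≤ logD D) {b : ℝ} (hb : 0 ≤ b) (hn : 1 ≤ n)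
    (h : n ≤ ⌊Q D ^ b⌋₊) : alpha D * Real.log n ≤ b :=
  (le_Q_rpow_iff hL hn b).mp ((Nat.le_floor_iff (by linarith [one_le_Q_rpow (D := D) hb])).mp h)

theorem sum_lam_le {D : ℕ} (hL : 1 ≤ logD D) (hα : alpha D ≤ 1 / 16) {a b : ℝ}
    (ha : |a| = alpha D) (hb : 0 ≤ b) (hb2 : b ≤ 3 / 2) :
    ∑ n ∈ Finset.Ioc 1 ⌊Q D ^ b⌋₊, zetaQuotCoeff a n ^ 2 / n ≤ lamConst * b ^ 2 := by
  have h1 : 1 ≤ ⌊Q D ^ b⌋₊ := Nat.le_floor (by simpa using one_le_Q_rpow hb)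
  have h2 := alpha_mul_log_le hL hb h1 le_rfl
  rw [← ha] at h2
  refine (sum_zetaQuotCoeff_sq_le.choose_spec.2 a _ (ha ▸ hα) (h2.trans hb2)).trans ?_
  have h3 : 0 ≤ |a| * Real.log ⌊Q D ^ b⌋₊ := by rw [ha]; exact alpha_mul_log_nonneg hL _
  have := lamConst_nonneg
  exact mul_le_mul_of_nonneg_left (pow_le_pow_left₀ h3 h2 2) this

theorem sum_lam_filter_le {D : ℕ} (hL : 1 ≤ logD D) (hα : alpha D ≤ 1 / 16) {a y : ℝ}
    (ha : |a| = alpha D) (hy : 0 ≤ y) :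
    ∑ n ∈ (Finset.Ioc 1 ⌊Q D ^ (3 / 2 : ℝ)⌋₊).filter (fun n : ℕ => alpha D * Real.log n ≤ y),
      zetaQuotCoeff a n ^ 2 / n ≤ lamConst * y ^ 2 := by
  have hm0 : 0 ≤ min y (3 / 2) := le_min hy (by norm_num)
  refine (Finset.sum_le_sum_of_subset_of_nonneg (t := Finset.Ioc 1 ⌊Q D ^ min y (3 / 2)⌋₊) ?_
    fun n _ _ => by positivity).trans ((sum_lam_le hL hα ha hm0 (min_le_right _ _)).trans ?_)
  · intro n hn
    obtain ⟨h1, h2⟩ := Finset.mem_filter.mp hn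
    obtain ⟨h3, h4⟩ := Finset.mem_Ioc.mp h1
    refine Finset.mem_Ioc.mpr ⟨h3, Nat.le_floor ((le_Q_rpow_iff hL h3.le _).mpr (le_min h2 ?_))⟩
    exact alpha_mul_log_le hL (by norm_num) h3.le h4
  · exact mul_le_mul_of_nonneg_left (pow_le_pow_left₀ hm0 (min_le_left _ _) 2) lamConst_nonneg

/-- The range of `u` is cut into `J` pieces of ratio `r`. On a piece the mean square is `≪` (upper
end)² and the kernel at most (lower end)`⁻²`, so each piece contributes `≪ r²`. -/
theorem sum_lam_tail_le {D : ℕ} (hL : 1 ≤ logD D) (hα : alpha D ≤ 1 / 16) {a y r : ℝ}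
    (ha : |a| = alpha D) (hy : 0 < y) (hr : 0 < r) (J : ℕ) :
    ∑ n ∈ (Finset.Ioc 1 ⌊Q D ^ (3 / 2 : ℝ)⌋₊).filter
      (fun n : ℕ => y < alpha D * Real.log n ∧ alpha D * Real.log n ≤ y * r ^ J),
      zetaQuotCoeff a n ^ 2 / n * ((alpha D * Real.log n) ^ 2)⁻¹ ≤ J * (lamConst * r ^ 2) := by
  set S := Finset.Ioc 1 ⌊Q D ^ (3 / 2 : ℝ)⌋₊
  set u : ℕ → ℝ := fun n => alpha D * Real.log n with hu
  set c : ℕ → ℝ := fun n => zetaQuotCoeff a n ^ 2 / n with hc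
  have hc0 : ∀ n, 0 ≤ c n := fun n => by positivity
  induction J with
  | zero =>
    rw [Finset.sum_eq_zero]
    · simp
    · intro n hn
      have := (Finset.mem_filter.mp hn).2
      simp at this
      linarith
  | succ J ih =>
    have hyr : 0 < y * r ^ J := by positivity
    have hsub : (S.filter fun n => y < u n ∧ u n ≤ y * r ^ (J + 1)) ⊆
        (S.filter fun n => y < u n ∧ u n ≤ y * r ^ J) ∪
        (S.filter fun n => u n ≤ y * r ^ (J + 1) ∧ y * r ^ J < u n) := by
      intro n hn
      simp only [Finset.mem_union, Finset.mem_filter] at hn ⊢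
      rcases le_or_gt (u n) (y * r ^ J) with h | h
      · exact Or.inl ⟨hn.1, hn.2.1, h⟩
      · exact Or.inr ⟨hn.1, hn.2.2, h⟩
    have h2 : ∑ n ∈ S.filter (fun n => u n ≤ y * r ^ (J + 1) ∧ y * r ^ J < u n),
        c n * (u n ^ 2)⁻¹ ≤ lamConst * r ^ 2 := by
      calc _ ≤ ∑ n ∈ S.filter (fun n => u n ≤ y * r ^ (J + 1) ∧ y * r ^ J < u n),
            c n * ((y * r ^ J) ^ 2)⁻¹ := by
            refine Finset.sum_le_sum fun n hn => ?_
            have := (Finset.mem_filter.mp hn).2.2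
            have := hc0 n
            gcongr
        _ ≤ ∑ n ∈ S.filter (fun n => u n ≤ y * r ^ (J + 1)), c n * ((y * r ^ J) ^ 2)⁻¹ := by
            refine Finset.sum_le_sum_of_subset_of_nonneg (fun n hn => ?_) fun n _ _ =>
              mul_nonneg (hc0 n) (by positivity)
            simp only [Finset.mem_filter] at hn ⊢
            exact ⟨hn.1, hn.2.1⟩
        _ ≤ (lamConst * (y * r ^ (J + 1)) ^ 2) * ((y * r ^ J) ^ 2)⁻¹ := by
            rw [← Finset.sum_mul]
            gcongr
            exact sum_lam_filter_le hL hα ha (by positivity)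
        _ = lamConst * r ^ 2 := by
            have := hyr.ne'
            rw [pow_succ r J]
            field_simp
    calc _ ≤ ∑ n ∈ (S.filter fun n => y < u n ∧ u n ≤ y * r ^ J) ∪
          (S.filter fun n => u n ≤ y * r ^ (J + 1) ∧ y * r ^ J < u n), c n * (u n ^ 2)⁻¹ :=
          Finset.sum_le_sum_of_subset_of_nonneg hsub fun n _ _ => mul_nonneg (hc0 n) (by positivity)
      _ ≤ _ := by
          rw [← Finset.sum_union_inter]
          exact le_add_of_nonneg_right (Finset.sum_nonneg fun n _ =>
            mul_nonneg (hc0 n) (by positivity))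
      _ ≤ J * (lamConst * r ^ 2) + lamConst * r ^ 2 := add_le_add ih h2
      _ = _ := by push_cast; ring

/-- Sums of the squared coefficients against a kernel that decays like `u⁻²` in `u = α log n`. -/
theorem sum_lam_kernel_le {D : ℕ} (hL : 1 ≤ logD D) (hα : alpha D ≤ 1 / 16) {a y R' A B : ℝ}
    (ha : |a| = alpha D) (hR : 1 ≤ R') (hy : R'⁻¹ ≤ y) (hA : 0 ≤ A) (hB : 0 ≤ B) (k : ℕ → ℝ)
    {S : Finset ℕ} (hS : S ⊆ Finset.Ioc 1 ⌊Q D ^ (3 / 2 : ℝ)⌋₊)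
    (h1 : ∀ n ∈ S, alpha D * Real.log n ≤ y → k n ≤ A)
    (h2 : ∀ n ∈ S, y < alpha D * Real.log n → k n ≤ B * ((alpha D * Real.log n) ^ 2)⁻¹) :
    ∑ n ∈ S, zetaQuotCoeff a n ^ 2 / n * k n ≤
      lamConst * (A * y ^ 2 + 12 * B * R' ^ (2 / 3 : ℝ)) := by
  have hR0 : 0 < R' := by linarith
  have hy0 : 0 < y := (inv_pos.mpr hR0).trans_le hy
  set S₀ := Finset.Ioc 1 ⌊Q D ^ (3 / 2 : ℝ)⌋₊ with hS₀
  set u : ℕ → ℝ := fun n => alpha D * Real.log n with hu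
  set c : ℕ → ℝ := fun n => zetaQuotCoeff a n ^ 2 / n with hc
  have hc0 : ∀ n, 0 ≤ c n := fun n => by positivity
  -- Three pieces suffice: `y r³ = 8 y R' ≥ 8` exceeds the largest `u`, which is `3/2`. The cost is
  -- `3 r² = 12 R'^{2/3}`; a dyadic cut would give a logarithm, but this power is affordable.
  set r : ℝ := 2 * R' ^ (1 / 3 : ℝ) with hr
  have hr3 : r ^ 3 = 8 * R' := by
    rw [hr, mul_pow, ← Real.rpow_natCast (R' ^ (1 / 3 : ℝ)), ← Real.rpow_mul hR0.le]
    norm_num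
  have hr2 : r ^ 2 = 4 * R' ^ (2 / 3 : ℝ) := by
    rw [hr, mul_pow, ← Real.rpow_natCast (R' ^ (1 / 3 : ℝ)), ← Real.rpow_mul hR0.le]
    norm_num
  rw [← Finset.sum_filter_add_sum_filter_not S fun n => u n ≤ y]
  have e1 : ∑ n ∈ S with u n ≤ y, c n * k n ≤ A * (lamConst * y ^ 2) := by
    calc _ ≤ ∑ n ∈ S with u n ≤ y, A * c n := by
          refine Finset.sum_le_sum fun n hn => ?_
          obtain ⟨h3, h4⟩ := Finset.mem_filter.mp hn
          have := mul_le_mul_of_nonneg_left (h1 n h3 h4) (hc0 n)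
          linarith
      _ ≤ ∑ n ∈ S₀ with u n ≤ y, A * c n :=
          Finset.sum_le_sum_of_subset_of_nonneg (Finset.filter_subset_filter _ hS)
            fun n _ _ => mul_nonneg hA (hc0 n)
      _ ≤ _ := by
          rw [← Finset.mul_sum]
          exact mul_le_mul_of_nonneg_left (sum_lam_filter_le hL hα ha hy0.le) hA
  have e2 : ∑ n ∈ S with ¬ u n ≤ y, c n * k n ≤ B * ((3 : ℕ) * (lamConst * r ^ 2)) := by
    calc _ ≤ ∑ n ∈ S with ¬ u n ≤ y, B * (c n * (u n ^ 2)⁻¹) := by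
          refine Finset.sum_le_sum fun n hn => ?_
          obtain ⟨h3, h4⟩ := Finset.mem_filter.mp hn
          have := mul_le_mul_of_nonneg_left (h2 n h3 (not_le.mp h4)) (hc0 n)
          calc _ ≤ _ := this
            _ = _ := by ring
      _ ≤ ∑ n ∈ S₀ with y < u n ∧ u n ≤ y * r ^ 3, B * (c n * (u n ^ 2)⁻¹) := by
          refine Finset.sum_le_sum_of_subset_of_nonneg (fun n hn => ?_)
            fun n _ _ => mul_nonneg hB (mul_nonneg (hc0 n) (by positivity))
          obtain ⟨h3, h4⟩ := Finset.mem_filter.mp hn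
          have h5 := hS h3
          obtain ⟨h6, h7⟩ := Finset.mem_Ioc.mp h5
          refine Finset.mem_filter.mpr ⟨h5, not_le.mp h4, ?_⟩
          have h8 : u n ≤ 3 / 2 := alpha_mul_log_le hL (by norm_num) h6.le h7
          rw [hr3]
          have : 1 ≤ y * R' := by
            calc (1 : ℝ) = R'⁻¹ * R' := (inv_mul_cancel₀ hR0.ne').symm
              _ ≤ y * R' := by gcongr
          linarith
      _ ≤ _ := by
          rw [← Finset.mul_sum]
          exact mul_le_mul_of_nonneg_left (sum_lam_tail_le hL hα ha hy0 (by positivity) 3) hB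
  rw [hr2] at e2
  push_cast at e2
  linarith

/-- The bound for the weights `ϑ(Q^{4/3} / n)` and `ϑ(Q^{2/3} / n)`. -/
noncomputable def weightConst : ℝ := 10 * Real.exp 3

theorem norm_vartheta_div_le {D n : ℕ} (hL : 1 ≤ logD D) {b : ℝ} (hb : b ≤ 2) (hn : 1 ≤ n) :
    ‖vartheta D (Q D ^ b / n)‖ ≤ weightConst := by
  have hn0 : (0 : ℝ) < n := by exact_mod_cast hn
  have hQ : 0 < Q D ^ b := Real.rpow_pos_of_pos (Q_pos D) _
  refine norm_vartheta_le hL (by positivity) ?_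
  rw [Real.log_div hQ.ne' hn0.ne', Q_rpow, Real.log_exp, mul_sub]
  have h1 := alpha_mul_log_nonneg hL n
  have h2 := logD_sq_mul_alpha hL
  nlinarith

theorem norm_wPlus_le {D n : ℕ} (hL : 1 ≤ logD D) (hn : 1 ≤ n) : ‖wPlus D n‖ ≤ weightConst :=
  norm_vartheta_div_le hL (by norm_num) hn

theorem norm_wMinus_le {D n : ℕ} (hL : 1 ≤ logD D) (hn : 1 ≤ n) : ‖wMinus D n‖ ≤ weightConst :=
  norm_vartheta_div_le hL (by norm_num) hn

end LandauSiegel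

/-! ### Bounds for the kernels `U_±` and `X_±`. -/

namespace LandauSiegel

open MeasureTheory

/-- Because `ω log Q = R`, parametrizing the arc leaves an integral over the unit circle that
depends on `R x` only. -/
theorem Uarc_eq {D : ℕ} (hL : 1 ≤ logD D) (hR : 0 < R D) (a b x : ℝ) :
    Uarc D a b x = 1 / (2 * Real.pi) * ∫ θ in a..b, exp ((R D * x : ℝ) * circleMap 0 1 θ) := by
  have hα := alpha_pos hL
  have hω : omega D ≠ 0 := (mul_pos hα hR).ne'
  have hωc : (omega D : ℂ) ≠ 0 := by exact_mod_cast hω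
  have hpi : (Real.pi : ℂ) ≠ 0 := by exact_mod_cast Real.pi_ne_zero
  have e : ∀ θ : ℝ, (Q D : ℂ) ^ (x * circleMap 0 (omega D) θ) / circleMap 0 (omega D) θ *
      deriv (circleMap 0 (omega D)) θ = exp ((R D * x : ℝ) * circleMap 0 1 θ) * I := by
    intro θ
    have h0 : circleMap 0 (omega D) θ ≠ 0 := circleMap_ne_center hω
    rw [deriv_circleMap, Complex.cpow_def_of_ne_zero (by exact_mod_cast (Q_pos D).ne'),
      ← Complex.ofReal_log (Q_pos D).le, Q, Real.log_exp]
    have h1 : ((logD D ^ 2 : ℝ) : ℂ) * (x * circleMap 0 (omega D) θ) =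
        (R D * x : ℝ) * circleMap 0 1 θ := by
      have h2 := logD_sq_mul_alpha hL
      have h3 : ((logD D ^ 2 : ℝ) : ℂ) * (omega D : ℂ) = (R D : ℂ) := by
        rw [← Complex.ofReal_mul, omega, ← mul_assoc, h2, one_mul]
      simp only [circleMap, zero_add, Complex.ofReal_one, one_mul, Complex.ofReal_mul]
      linear_combination (x * exp (θ * I)) * h3
    rw [h1]
    field_simp
  rw [Uarc, intervalIntegral.integral_congr fun θ _ => e θ, intervalIntegral.integral_mul_const]
  have := Complex.I_ne_zero
  field_simp

theorem Uminus_eq_Uplus_neg {D : ℕ} (hL : 1 ≤ logD D) (hR : 0 < R D) (x : ℝ) :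
    Uminus D x = Uplus D (-x) := by
  rw [Uminus, Uplus, Uarc_eq hL hR, Uarc_eq hL hR]
  congr 1
  have h := intervalIntegral.integral_comp_add_right (a := -(Real.pi / 2)) (b := Real.pi / 2)
    (fun θ => exp ((R D * x : ℝ) * circleMap 0 1 θ)) Real.pi
  rw [show -(Real.pi / 2) + Real.pi = Real.pi / 2 by ring,
    show Real.pi / 2 + Real.pi = 3 * Real.pi / 2 by ring] at h
  rw [← h]
  refine intervalIntegral.integral_congr fun θ _ => ?_
  congr 1
  simp only [circleMap, zero_add, Complex.ofReal_one, one_mul, Complex.ofReal_add, add_mul,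
    Complex.exp_add, Complex.exp_pi_mul_I]
  push_cast
  ring

/-- The two arcs close up to a full circle, and the mean value property evaluates the integrand at
the centre. -/
theorem Uplus_add_Uminus {D : ℕ} (hL : 1 ≤ logD D) (hR : 0 < R D) (x : ℝ) :
    Uplus D x + Uminus D x = 1 := by
  rw [Uminus, Uplus, Uarc_eq hL hR, Uarc_eq hL hR, ← mul_add]
  set f : ℝ → ℂ := fun θ => exp ((R D * x : ℝ) * circleMap 0 1 θ) with hf
  have hcont : Continuous f := by
    have := continuous_circleMap 0 1
    fun_prop
  have hint : ∀ a b : ℝ, IntervalIntegrable f volume a b := fun a b => hcont.intervalIntegrable a b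
  rw [intervalIntegral.integral_add_adjacent_intervals (hint _ _) (hint _ _)]
  have hper : Function.Periodic f (2 * Real.pi) := fun θ => by
    simp only [hf]; rw [periodic_circleMap 0 1 θ]
  have h1 := hper.intervalIntegral_add_eq (-(Real.pi / 2)) 0
  rw [show -(Real.pi / 2) + 2 * Real.pi = 3 * Real.pi / 2 by ring, zero_add] at h1
  rw [h1]
  have hd : DiffContOnCl ℂ (fun z : ℂ => exp ((R D * x : ℝ) * z)) (Metric.ball 0 |1|) :=
    Differentiable.diffContOnCl (by fun_prop)
  have h2 := hd.circleAverage
  rw [Real.circleAverage] at h2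
  simp only [mul_zero, Complex.exp_zero, Complex.real_smul] at h2
  refine Eq.trans ?_ h2
  simp only [hf]
  push_cast
  ring

/-- Jordan's inequality `cos θ ≥ 1 - 2θ/π` on the quarter circle, doubled by symmetry. -/
theorem integral_exp_cos_le {c : ℝ} (hc : 0 < c) :
    ∫ θ in (-(Real.pi / 2))..(Real.pi / 2), Real.exp (-c * Real.cos θ) ≤ Real.pi / c := by
  have hpi := Real.pi_pos
  set g : ℝ → ℝ := fun θ => Real.exp (-c * Real.cos θ) with hg
  have hcont : Continuous g := by fun_prop
  have h0 : ∫ θ in (0 : ℝ)..(Real.pi / 2), g θ ≤ Real.pi / (2 * c) := by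
    have hle : ∀ θ ∈ Set.Icc 0 (Real.pi / 2), g θ ≤ Real.exp (-c + 2 * c / Real.pi * θ) := by
      intro θ hθ
      refine Real.exp_le_exp.mpr ?_
      have := mul_le_mul_of_nonneg_left (Real.one_sub_mul_le_cos hθ.1 hθ.2) hc.le
      have e : -c + 2 * c / Real.pi * θ = -(c * (1 - 2 / Real.pi * θ)) := by ring
      rw [e]
      linarith
    have hk : 2 * c / Real.pi ≠ 0 := by positivity
    refine (intervalIntegral.integral_mono_on (by positivity) (hcont.intervalIntegrable _ _)
      (Continuous.intervalIntegrable (by fun_prop) _ _) hle).trans ?_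
    have hi : ∫ θ in (0 : ℝ)..(Real.pi / 2), Real.exp (-c + 2 * c / Real.pi * θ) =
        (2 * c / Real.pi)⁻¹ * (1 - Real.exp (-c)) := by
      have := intervalIntegral.integral_comp_add_mul (a := 0) (b := Real.pi / 2) Real.exp hk (-c)
      rw [this, integral_exp, smul_eq_mul]
      have e : -c + 2 * c / Real.pi * (Real.pi / 2) = 0 := by field_simp; ring
      rw [e, mul_zero, add_zero, Real.exp_zero]
    rw [hi]
    calc _ ≤ (2 * c / Real.pi)⁻¹ * 1 := by
          gcongr
          linarith [Real.exp_pos (-c)]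
      _ = _ := by rw [mul_one, inv_div]
  have h1 : ∫ θ in (-(Real.pi / 2))..0, g θ = ∫ θ in (0 : ℝ)..(Real.pi / 2), g θ := by
    have := intervalIntegral.integral_comp_neg (a := 0) (b := Real.pi / 2) g
    rw [neg_zero] at this
    rw [← this]
    refine intervalIntegral.integral_congr fun θ _ => ?_
    simp [hg]
  rw [← intervalIntegral.integral_add_adjacent_intervals (b := 0) (hcont.intervalIntegrable _ _)
    (hcont.intervalIntegrable _ _), h1]
  calc _ ≤ Real.pi / (2 * c) + Real.pi / (2 * c) := add_le_add h0 h0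
    _ = _ := by field_simp; ring

theorem norm_Uplus_le_integral {D : ℕ} (hL : 1 ≤ logD D) (hR : 0 < R D) (x : ℝ) :
    ‖Uplus D x‖ ≤ 1 / (2 * Real.pi) *
      ∫ θ in (-(Real.pi / 2))..(Real.pi / 2), Real.exp (-(R D * -x) * Real.cos θ) := by
  have hpi := Real.pi_pos
  rw [Uplus, Uarc_eq hL hR, norm_mul]
  have e1 : ‖(1 / (2 * Real.pi) : ℂ)‖ = 1 / (2 * Real.pi) := by
    rw [norm_div, norm_one, norm_mul, Complex.norm_real, Real.norm_eq_abs, abs_of_pos hpi,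
      Complex.norm_ofNat]
  rw [e1]
  gcongr
  refine (intervalIntegral.norm_integral_le_integral_norm (by linarith)).trans (le_of_eq ?_)
  refine intervalIntegral.integral_congr fun θ _ => ?_
  rw [Complex.norm_exp]
  congr 1
  rw [Complex.re_ofReal_mul]
  have : (circleMap 0 1 θ).re = Real.cos θ := by
    simp [circleMap, Complex.exp_re]
  rw [this]
  ring

theorem norm_Uplus_le_div {D : ℕ} (hL : 1 ≤ logD D) (hR : 0 < R D) {x : ℝ} (hx : x < 0) :
    ‖Uplus D x‖ ≤ 1 / (R D * -x) := by
  have hc : 0 < R D * -x := mul_pos hR (neg_pos.mpr hx)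
  have hpi := Real.pi_pos
  refine (norm_Uplus_le_integral hL hR x).trans ?_
  calc _ ≤ 1 / (2 * Real.pi) * (Real.pi / (R D * -x)) := by
        gcongr
        exact integral_exp_cos_le hc
    _ = 1 / 2 * (1 / (R D * -x)) := by field_simp
    _ ≤ 1 * (1 / (R D * -x)) := by gcongr; norm_num
    _ = _ := one_mul _

theorem norm_Uplus_le_of_nonpos {D : ℕ} (hL : 1 ≤ logD D) (hR : 0 < R D) {x : ℝ} (hx : x ≤ 0) :
    ‖Uplus D x‖ ≤ 1 := by
  have hc : 0 ≤ R D * -x := mul_nonneg hR.le (neg_nonneg.mpr hx)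
  have hpi := Real.pi_pos
  refine (norm_Uplus_le_integral hL hR x).trans ?_
  have h : ∫ θ in (-(Real.pi / 2))..(Real.pi / 2), Real.exp (-(R D * -x) * Real.cos θ) ≤
      ∫ θ in (-(Real.pi / 2))..(Real.pi / 2), (1 : ℝ) := by
    refine intervalIntegral.integral_mono_on (by linarith)
      (Continuous.intervalIntegrable (by fun_prop) _ _) (by simp) fun θ hθ => ?_
    rw [Real.exp_le_one_iff]
    have := mul_nonneg hc (Real.cos_nonneg_of_mem_Icc hθ)
    linarith
  rw [intervalIntegral.integral_const, smul_eq_mul, mul_one] at h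
  calc _ ≤ 1 / (2 * Real.pi) * (Real.pi / 2 - -(Real.pi / 2)) := by gcongr
    _ = 1 / 2 := by field_simp; ring
    _ ≤ 1 := by norm_num

/-- For `x > 0` the integrand is large, but `U₊ = 1 - U₋` and `U₋(x) = U₊(-x)` is bounded by `1`. -/
theorem norm_Uplus_le {D : ℕ} (hL : 1 ≤ logD D) (hR : 0 < R D) (x : ℝ) : ‖Uplus D x‖ ≤ 2 := by
  rcases le_total x 0 with hx | hx
  · linarith [norm_Uplus_le_of_nonpos hL hR hx]
  · rw [eq_sub_of_add_eq (Uplus_add_Uminus hL hR x), Uminus_eq_Uplus_neg hL hR]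
    refine (norm_sub_le _ _).trans ?_
    rw [norm_one]
    linarith [norm_Uplus_le_of_nonpos hL hR (neg_nonpos.mpr hx)]

theorem norm_Uminus_le_div {D : ℕ} (hL : 1 ≤ logD D) (hR : 0 < R D) {x : ℝ} (hx : 0 < x) :
    ‖Uminus D x‖ ≤ 1 / (R D * x) := by
  rw [Uminus_eq_Uplus_neg hL hR]
  simpa using norm_Uplus_le_div hL hR (neg_neg_iff_pos.mpr hx)

theorem norm_Uminus_le {D : ℕ} (hL : 1 ≤ logD D) (hR : 0 < R D) (x : ℝ) : ‖Uminus D x‖ ≤ 2 := by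
  rw [Uminus_eq_Uplus_neg hL hR]
  exact norm_Uplus_le hL hR _

theorem abs_sinQuot_le {D : ℕ} (hR : 0 < R D) (x : ℝ) : |sinQuot D x| ≤ R D := by
  rw [sinQuot, abs_mul, abs_of_pos hR]
  exact mul_le_of_le_one_right hR.le (Real.abs_sinc_le_one _)

theorem abs_sinQuot_le_inv {D : ℕ} (hR : 0 < R D) {x y : ℝ} (hy : 0 < y) (hx : y ≤ |x|) :
    |sinQuot D x| ≤ y⁻¹ := by
  have hx0 : x ≠ 0 := abs_pos.mp (hy.trans_le hx)
  have e : sinQuot D x = Real.sin (R D * x) / x := by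
    rw [sinQuot, Real.sinc_of_ne_zero (mul_ne_zero hR.ne' hx0)]
    have := hR.ne'
    field_simp
  rw [e, abs_div, div_eq_mul_inv]
  calc _ ≤ 1 * y⁻¹ := by
        gcongr
        exact Real.abs_sin_le_one _
    _ = _ := one_mul _

theorem abs_Xplus_le {D : ℕ} (x : ℝ) : |Xplus D x| ≤ |sinQuot D x| + |sinQuot D (2 + x)| := by
  have hpi : (1 : ℝ) ≤ Real.pi := by linarith [Real.pi_gt_three]
  have he : (1 : ℝ) ≤ Real.exp 2 := Real.one_le_exp (by norm_num)
  rw [Xplus]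
  refine (abs_add_le _ _).trans (add_le_add ?_ ?_) <;> rw [abs_mul, abs_of_pos (by positivity)] <;>
    refine mul_le_of_le_one_left (abs_nonneg _) ((div_le_one (by positivity)).mpr ?_)
  · exact hpi
  · exact one_le_mul_of_one_le_of_one_le hpi he

theorem abs_Xminus_le {D : ℕ} (x : ℝ) : |Xminus D x| ≤ |sinQuot D x| + |sinQuot D (-2 + x)| := by
  have hpi : (1 : ℝ) ≤ Real.pi := by linarith [Real.pi_gt_three]
  have he : (1 : ℝ) ≤ Real.exp 2 := Real.one_le_exp (by norm_num)
  rw [Xminus]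
  refine (abs_add_le _ _).trans (add_le_add ?_ ?_) <;> rw [abs_mul, abs_of_pos (by positivity)] <;>
    refine mul_le_of_le_one_left (abs_nonneg _) ((div_le_one (by positivity)).mpr ?_)
  · exact one_le_mul_of_one_le_of_one_le hpi he
  · exact hpi

/-- An interchange of sum and integral that needs no integrability of the summands. -/
theorem sum_integral_le {ι : Type*} (T : Finset ι) (f : ι → ℝ → ℝ) (g : ℝ → ℝ) {a b : ℝ}
    (hab : a ≤ b) (hf : ∀ i ∈ T, ∀ y ∈ Set.Icc a b, 0 ≤ f i y)
    (hle : ∀ y ∈ Set.Icc a b, ∑ i ∈ T, f i y ≤ g y) (hg : IntervalIntegrable g volume a b) :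
    ∑ i ∈ T, ∫ y in a..b, f i y ≤ ∫ y in a..b, g y := by
  classical
  -- The integral of a nonintegrable summand is `0` by convention, so such summands may be dropped
  -- on the left.
  set T' := T.filter fun i => IntervalIntegrable (f i) volume a b with hT'
  have h1 : ∑ i ∈ T, ∫ y in a..b, f i y = ∑ i ∈ T', ∫ y in a..b, f i y := by
    rw [hT', Finset.sum_filter]
    refine Finset.sum_congr rfl fun i _ => ?_
    split_ifs with h
    · rfl
    · exact intervalIntegral.integral_undef h
  have hint : ∀ i ∈ T', IntervalIntegrable (f i) volume a b := fun i hi => (Finset.mem_filter.mp hi).2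
  rw [h1, ← intervalIntegral.integral_finsetSum hint]
  refine intervalIntegral.integral_mono_on hab ?_ hg fun y hy => ?_
  · simpa only [Finset.sum_fn] using IntervalIntegrable.sum T' hint
  · exact (Finset.sum_le_sum_of_subset_of_nonneg (Finset.filter_subset _ _)
      fun i hi _ => hf i hi y hy).trans (hle y hy)

end LandauSiegel

/-! ### Coefficient sums for the polynomials in `Υ`, `𝓔₁` and `𝓔₂`. -/

namespace LandauSiegel

open MeasureTheory

/-- The range of the parameters in which the estimates hold. -/
structure Admissible (D : ℕ) (ε : ℝ) : Prop where
  log_large : 101 ≤ Real.log (logD D)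
  logD_large : 2000 * Real.log (logD D) ≤ logD D
  one_le_R : 1 ≤ R D
  R_inv_le : (R D)⁻¹ ≤ ε
  le_delta1 : ε ≤ delta1 D
  delta1_le : delta1 D ≤ 1 / 12

namespace Admissible

variable {D : ℕ} {ε : ℝ}

theorem one_le_logD (h : Admissible D ε) : 1 ≤ logD D := by
  linarith [logD_le_of_large h.log_large]

theorem alpha_le (h : Admissible D ε) : alpha D ≤ 1 / 16 := by
  have h1 := logD_le_of_large h.log_large
  rw [alpha, one_div]
  gcongr
  nlinarith

theorem R_pos (h : Admissible D ε) : 0 < R D := by linarith [h.one_le_R]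

theorem eps_pos (h : Admissible D ε) : 0 < ε := (inv_pos.mpr h.R_pos).trans_le h.R_inv_le

theorem delta1_pos (h : Admissible D ε) : 0 < delta1 D := h.eps_pos.trans_le h.le_delta1

end Admissible

variable {D : ℕ} {ε : ℝ}

theorem abs_alpha (h : Admissible D ε) : |alpha D| = alpha D := abs_of_pos (alpha_pos h.one_le_logD)

theorem abs_neg_alpha (h : Admissible D ε) : |-alpha D| = alpha D := by rw [abs_neg, abs_alpha h]

theorem floor_Q_le (D : ℕ) : ⌊Q D⌋₊ ≤ ⌊Q D ^ (3 / 2 : ℝ)⌋₊ :=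
  Nat.floor_le_floor (Real.self_le_rpow_of_one_le (one_le_Q D) (by norm_num))

theorem Q_le (D : ℕ) : Q D ≤ Q D ^ (3 / 2 : ℝ) :=
  Real.self_le_rpow_of_one_le (one_le_Q D) (by norm_num)

theorem sq_weight_mul_le {w : ℂ} {x B : ℝ} (hw : ‖w‖ ≤ weightConst) (hx : |x| ≤ B) :
    (‖w‖ * |x|) ^ 2 ≤ weightConst ^ 2 * B ^ 2 := by
  rw [← mul_pow]
  exact pow_le_pow_left₀ (by positivity) (mul_le_mul hw hx (abs_nonneg _)
    ((norm_nonneg _).trans hw)) 2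

/-- The cut is at `u = 4 δ₁`: below it `|X₊| ≤ 2R`, above it `|z - u| ≥ u/4` and the kernel is at
most `10/u`. -/
theorem sum_Xplus_le (h : Admissible D ε) {z : ℝ} (hz : |z| ≤ 3 * delta1 D) :
    ∑ n ∈ Finset.Ioc ⌊(1 : ℝ)⌋₊ ⌊Q D ^ (3 / 2 : ℝ)⌋₊, lamMinus D n ^ 2 / n *
      ‖wPlus D n * Xplus D (z - alpha D * Real.log n)‖ ^ 2 ≤
    lamConst * weightConst ^ 2 *
      (64 * (R D ^ 2 * delta1 D ^ 2) + 1200 * R D ^ (2 / 3 : ℝ)) := by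
  have hL := h.one_le_logD
  have hR := h.R_pos
  have hδ := h.delta1_pos
  have hδ1 := h.delta1_le
  obtain ⟨hz1, hz2⟩ := abs_le.mp hz
  rw [Nat.floor_one]
  have hy : (R D)⁻¹ ≤ 4 * delta1 D := by linarith [h.R_inv_le, h.le_delta1]
  refine (sum_lam_kernel_le hL h.alpha_le (abs_neg_alpha h) h.one_le_R hy
    (A := weightConst ^ 2 * (2 * R D) ^ 2) (B := weightConst ^ 2 * 10 ^ 2) (by positivity)
    (by positivity) _ (Finset.Subset.refl _) (fun n hn hu => ?_) fun n hn hu => ?_).trans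
    (le_of_eq (by ring))
  · have hn1 := (Finset.mem_Ioc.mp hn).1
    rw [norm_mul, Complex.norm_real, Real.norm_eq_abs]
    refine sq_weight_mul_le (norm_wPlus_le hL hn1.le) ((abs_Xplus_le _).trans ?_)
    linarith [abs_sinQuot_le hR (z - alpha D * Real.log n),
      abs_sinQuot_le hR (2 + (z - alpha D * Real.log n))]
  · obtain ⟨hn1, hn2⟩ := Finset.mem_Ioc.mp hn
    have hu2 := alpha_mul_log_le hL (by norm_num) hn1.le hn2
    set u := alpha D * Real.log n
    have hu0 : 0 < u := by linarith
    rw [norm_mul, Complex.norm_real, Real.norm_eq_abs, mul_assoc, ← inv_pow, ← mul_pow]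
    refine sq_weight_mul_le (norm_wPlus_le hL hn1.le) ((abs_Xplus_le _).trans ?_)
    have h1 := abs_sinQuot_le_inv hR (x := z - u) (y := u / 4) (by positivity)
      (by rw [abs_sub_comm]; exact le_trans (by linarith) (le_abs_self _))
    -- Here `δ₁ ≤ 1/12` and `u ≤ 3/2` give `2 + z - u ≥ 1/4 ≥ u/6`.
    have h2 := abs_sinQuot_le_inv hR (x := 2 + (z - u)) (y := u / 6) (by positivity)
      (le_trans (by linarith) (le_abs_self _))
    rw [inv_div] at h1 h2
    calc _ ≤ 4 / u + 6 / u := add_le_add h1 h2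
      _ = 10 * u⁻¹ := by ring

theorem sum_Xminus_le (h : Admissible D ε) {z : ℝ} (hz : |z| ≤ 3 * delta1 D) :
    ∑ n ∈ Finset.Ioc ⌊(1 : ℝ)⌋₊ ⌊Q D⌋₊, lamPlus D n ^ 2 / n *
      ‖wMinus D n * Xminus D (z + alpha D * Real.log n)‖ ^ 2 ≤
    lamConst * weightConst ^ 2 *
      (64 * (R D ^ 2 * delta1 D ^ 2) + 1200 * R D ^ (2 / 3 : ℝ)) := by
  have hL := h.one_le_logD
  have hR := h.R_pos
  have hδ := h.delta1_pos
  have hδ1 := h.delta1_le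
  obtain ⟨hz1, hz2⟩ := abs_le.mp hz
  rw [Nat.floor_one]
  have hy : (R D)⁻¹ ≤ 4 * delta1 D := by linarith [h.R_inv_le, h.le_delta1]
  refine (sum_lam_kernel_le hL h.alpha_le (abs_alpha h) h.one_le_R hy
    (A := weightConst ^ 2 * (2 * R D) ^ 2) (B := weightConst ^ 2 * 10 ^ 2) (by positivity)
    (by positivity) _ (Finset.Ioc_subset_Ioc_right (floor_Q_le D)) (fun n hn hu => ?_)
    fun n hn hu => ?_).trans (le_of_eq (by ring))
  · have hn1 := (Finset.mem_Ioc.mp hn).1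
    rw [norm_mul, Complex.norm_real, Real.norm_eq_abs]
    refine sq_weight_mul_le (norm_wMinus_le hL hn1.le) ((abs_Xminus_le _).trans ?_)
    linarith [abs_sinQuot_le hR (z + alpha D * Real.log n),
      abs_sinQuot_le hR (-2 + (z + alpha D * Real.log n))]
  · obtain ⟨hn1, hn2⟩ := Finset.mem_Ioc.mp hn
    have hu2 := alpha_mul_log_le hL (b := 1) (by norm_num) hn1.le (by rwa [Real.rpow_one])
    set u := alpha D * Real.log n
    have hu0 : 0 < u := by linarith
    rw [norm_mul, Complex.norm_real, Real.norm_eq_abs, mul_assoc, ← inv_pow, ← mul_pow]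
    refine sq_weight_mul_le (norm_wMinus_le hL hn1.le) ((abs_Xminus_le _).trans ?_)
    have h1 := abs_sinQuot_le_inv hR (x := z + u) (y := u / 4) (by positivity)
      (le_trans (by linarith) (le_abs_self _))
    have h2 := abs_sinQuot_le_inv hR (x := -2 + (z + u)) (y := u / 6) (by positivity)
      (by rw [← abs_neg]; exact le_trans (by linarith) (le_abs_self _))
    rw [inv_div] at h1 h2
    calc _ ≤ 4 / u + 6 / u := add_le_add h1 h2
      _ = 10 * u⁻¹ := by ring

theorem sq_norm_mul_le {w v : ℂ} {B : ℝ} (hw : ‖w‖ ≤ weightConst) (hx : ‖v‖ ≤ B) :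
    ‖w * v‖ ^ 2 ≤ weightConst ^ 2 * B ^ 2 := by
  rw [norm_mul, ← mul_pow]
  exact pow_le_pow_left₀ (by positivity) (mul_le_mul hw hx (norm_nonneg _)
    ((norm_nonneg _).trans hw)) 2

/-- The cut is at `u = 2ε`: below it `|U₊| ≤ 2`, above it `u - ε ≥ u/2` and the kernel is at most
`2/(R u)`. -/
theorem sum_Y1_le (h : Admissible D ε) :
    ∑ n ∈ Finset.Ioc ⌊(1 : ℝ)⌋₊ ⌊Q D ^ (3 / 2 : ℝ)⌋₊, lamMinus D n ^ 2 / n *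
      ‖wPlus D n * Uplus D (ε - alpha D * Real.log n)‖ ^ 2 ≤
    lamConst * weightConst ^ 2 * (16 * ε ^ 2 + 48 * ((R D)⁻¹ ^ 2 * R D ^ (2 / 3 : ℝ))) := by
  have hL := h.one_le_logD
  have hR := h.R_pos
  have hε := h.eps_pos
  rw [Nat.floor_one]
  refine (sum_lam_kernel_le hL h.alpha_le (abs_neg_alpha h) h.one_le_R (y := 2 * ε)
    (by linarith [h.R_inv_le]) (A := weightConst ^ 2 * 2 ^ 2)
    (B := weightConst ^ 2 * (2 * (R D)⁻¹) ^ 2) (by positivity)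
    (by positivity) _ (Finset.Subset.refl _) (fun n hn hu => ?_) fun n hn hu => ?_).trans
    (le_of_eq (by ring))
  · exact sq_norm_mul_le (norm_wPlus_le hL (Finset.mem_Ioc.mp hn).1.le) (norm_Uplus_le hL hR _)
  · obtain ⟨hn1, hn2⟩ := Finset.mem_Ioc.mp hn
    set u := alpha D * Real.log n
    have hu0 : 0 < u := by linarith
    rw [mul_assoc, ← inv_pow, ← mul_pow]
    refine sq_norm_mul_le (norm_wPlus_le hL hn1.le)
      ((norm_Uplus_le_div hL hR (by linarith)).trans ?_)
    calc 1 / (R D * -(ε - u)) ≤ 1 / (R D * (u / 2)) := by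
          gcongr
          linarith
      _ = _ := by field_simp

theorem sum_Y4_le (h : Admissible D ε) :
    ∑ n ∈ Finset.Ioc ⌊(1 : ℝ)⌋₊ ⌊Q D⌋₊, lamPlus D n ^ 2 / n *
      ‖wMinus D n * Uminus D (ε + alpha D * Real.log n)‖ ^ 2 ≤
    lamConst * weightConst ^ 2 * (16 * ε ^ 2 + 48 * ((R D)⁻¹ ^ 2 * R D ^ (2 / 3 : ℝ))) := by
  have hL := h.one_le_logD
  have hR := h.R_pos
  have hε := h.eps_pos
  rw [Nat.floor_one]
  refine (sum_lam_kernel_le hL h.alpha_le (abs_alpha h) h.one_le_R (y := 2 * ε)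
    (by linarith [h.R_inv_le]) (A := weightConst ^ 2 * 2 ^ 2)
    (B := weightConst ^ 2 * (2 * (R D)⁻¹) ^ 2) (by positivity)
    (by positivity) _ (Finset.Ioc_subset_Ioc_right (floor_Q_le D))
    (fun n hn hu => ?_) fun n hn hu => ?_).trans (le_of_eq (by ring))
  · exact sq_norm_mul_le (norm_wMinus_le hL (Finset.mem_Ioc.mp hn).1.le) (norm_Uminus_le hL hR _)
  · obtain ⟨hn1, hn2⟩ := Finset.mem_Ioc.mp hn
    set u := alpha D * Real.log n
    have hu0 : 0 < u := by linarith
    rw [mul_assoc, ← inv_pow, ← mul_pow]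
    refine sq_norm_mul_le (norm_wMinus_le hL hn1.le)
      ((norm_Uminus_le_div hL hR (by linarith)).trans ?_)
    calc 1 / (R D * (ε + u)) ≤ 1 / (R D * (u / 2)) := by
          gcongr
          linarith
      _ = _ := by field_simp

theorem sum_lam_zero_le (h : Admissible D ε) {a b : ℝ} (ha : |a| = alpha D) (hb : 0 ≤ b)
    (hb2 : b ≤ 3 / 2) :
    ∑ n ∈ Finset.Ioc 0 ⌊Q D ^ b⌋₊, zetaQuotCoeff a n ^ 2 / n ≤ 1 + lamConst * b ^ 2 := by
  have h1 : 1 ≤ ⌊Q D ^ b⌋₊ := Nat.le_floor (by simpa using one_le_Q_rpow hb)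
  rw [← Finset.Ioc_union_Ioc_eq_Ioc zero_le_one h1, Finset.sum_union
    (Finset.Ioc_disjoint_Ioc_of_le le_rfl)]
  have h2 : Finset.Ioc 0 1 = {1} := rfl
  rw [h2, Finset.sum_singleton, zetaQuotCoeff_one]
  have := sum_lam_le h.one_le_logD h.alpha_le ha hb hb2
  simpa using this

/-- For `𝓨₂` and `𝓨₃` the term `n = 1` is present and the coefficient sum is only bounded. The
saving comes from the kernel, whose argument stays at distance at least `1/2` from `0` on the
correct side. -/
theorem sum_zero_kernel_le (h : Admissible D ε) {a b : ℝ} (ha : |a| = alpha D) (hb : 0 ≤ b)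
    (hb2 : b ≤ 3 / 2) (w v : ℕ → ℂ) (hw : ∀ n : ℕ, 1 ≤ n → ‖w n‖ ≤ weightConst)
    (hv : ∀ n : ℕ, 1 ≤ n → alpha D * Real.log n ≤ b → ‖v n‖ ≤ 2 * (R D)⁻¹) :
    ∑ n ∈ Finset.Ioc ⌊(0 : ℝ)⌋₊ ⌊Q D ^ b⌋₊, zetaQuotCoeff a n ^ 2 / n * ‖w n * v n‖ ^ 2 ≤
      (1 + 3 * lamConst) * weightConst ^ 2 * (4 * (R D)⁻¹ ^ 2) := by
  rw [Nat.floor_zero]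
  have hlam := lamConst_nonneg
  calc _ ≤ ∑ n ∈ Finset.Ioc 0 ⌊Q D ^ b⌋₊,
        zetaQuotCoeff a n ^ 2 / n * (weightConst ^ 2 * (2 * (R D)⁻¹) ^ 2) := by
        refine Finset.sum_le_sum fun n hn => ?_
        obtain ⟨h1, h2⟩ := Finset.mem_Ioc.mp hn
        exact mul_le_mul_of_nonneg_left (sq_norm_mul_le (hw n h1)
          (hv n h1 (alpha_mul_log_le h.one_le_logD hb h1 h2))) (by positivity)
    _ ≤ (1 + lamConst * b ^ 2) * (weightConst ^ 2 * (2 * (R D)⁻¹) ^ 2) := by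
        rw [← Finset.sum_mul]
        exact mul_le_mul_of_nonneg_right (sum_lam_zero_le h ha hb hb2) (by positivity)
    _ ≤ (1 + lamConst * 3) * (weightConst ^ 2 * (2 * (R D)⁻¹) ^ 2) := by
        gcongr
        nlinarith
    _ = _ := by ring

theorem sum_Y2_le (h : Admissible D ε) :
    ∑ n ∈ Finset.Ioc ⌊(0 : ℝ)⌋₊ ⌊Q D⌋₊, lamPlus D n ^ 2 / n *
      ‖wMinus D n * Uplus D (-2 + ε + alpha D * Real.log n)‖ ^ 2 ≤
    (1 + 3 * lamConst) * weightConst ^ 2 * (4 * (R D)⁻¹ ^ 2) := by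
  have hL := h.one_le_logD
  have hR := h.R_pos
  have := h.le_delta1
  have := h.delta1_le
  have key := sum_zero_kernel_le h (abs_alpha h) (b := 1) (by norm_num) (by norm_num) (wMinus D)
    (fun n => Uplus D (-2 + ε + alpha D * Real.log n)) (fun n hn => norm_wMinus_le hL hn)
    fun n hn hu => ?_
  · rwa [Real.rpow_one] at key
  · refine (norm_Uplus_le_div hL hR (by linarith)).trans ?_
    calc _ ≤ 1 / (R D * (1 / 2)) := by
          gcongr
          linarith
      _ = _ := by field_simp

theorem sum_Y3_le (h : Admissible D ε) :
    ∑ n ∈ Finset.Ioc ⌊(0 : ℝ)⌋₊ ⌊Q D ^ (3 / 2 : ℝ)⌋₊, lamMinus D n ^ 2 / n *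
      ‖wPlus D n * Uminus D (2 + ε - alpha D * Real.log n)‖ ^ 2 ≤
    (1 + 3 * lamConst) * weightConst ^ 2 * (4 * (R D)⁻¹ ^ 2) := by
  have hL := h.one_le_logD
  have hR := h.R_pos
  have := h.eps_pos
  refine sum_zero_kernel_le h (abs_neg_alpha h) (by norm_num) le_rfl (wPlus D)
    (fun n => Uminus D (2 + ε - alpha D * Real.log n)) (fun n hn => norm_wPlus_le hL hn)
    fun n hn hu => ?_
  refine (norm_Uminus_le_div hL hR (by linarith)).trans ?_
  calc _ ≤ 1 / (R D * (1 / 2)) := by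
        gcongr
        linarith
    _ = _ := by field_simp

/-- Since `Q^A ≥ 1`, the strict lower limit excludes `n = 1`, so the full saving `b²` is available.
-/
theorem sum_weight_le (h : Admissible D ε) {a A b : ℝ} (ha : |a| = alpha D) (hA : 0 ≤ A)
    (hb : 0 ≤ b) (hb2 : b ≤ 3 / 2) (w : ℕ → ℂ) (hw : ∀ n : ℕ, 1 ≤ n → ‖w n‖ ≤ weightConst) :
    ∑ n ∈ Finset.Ioc ⌊Q D ^ A⌋₊ ⌊Q D ^ b⌋₊, zetaQuotCoeff a n ^ 2 / n * ‖w n‖ ^ 2 ≤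
      lamConst * weightConst ^ 2 * b ^ 2 := by
  have h1 : 1 ≤ ⌊Q D ^ A⌋₊ := Nat.le_floor (by simpa using one_le_Q_rpow hA)
  calc _ ≤ ∑ n ∈ Finset.Ioc 1 ⌊Q D ^ b⌋₊, zetaQuotCoeff a n ^ 2 / n * ‖w n‖ ^ 2 :=
        Finset.sum_le_sum_of_subset_of_nonneg (Finset.Ioc_subset_Ioc_left h1)
          fun n _ _ => by positivity
    _ ≤ ∑ n ∈ Finset.Ioc 1 ⌊Q D ^ b⌋₊, zetaQuotCoeff a n ^ 2 / n * weightConst ^ 2 := by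
        refine Finset.sum_le_sum fun n hn => ?_
        have := hw n (Finset.mem_Ioc.mp hn).1.le
        gcongr
    _ ≤ lamConst * b ^ 2 * weightConst ^ 2 := by
        rw [← Finset.sum_mul]
        exact mul_le_mul_of_nonneg_right (sum_lam_le h.one_le_logD h.alpha_le ha hb hb2)
          (by positivity)
    _ = _ := by ring

end LandauSiegel

/-! ### Summation of `Υ`, `𝓔₁` and `𝓔₂` over the zeros. -/

namespace LandauSiegel

open MeasureTheory

/-- `meanConst * 𝓛² Q²`, the size of the mean value estimate. -/
noncomputable def meanSize (D : ℕ) : ℝ := meanConst * (logD D ^ 2 * Q D ^ 2)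

theorem meanSize_nonneg (D : ℕ) : 0 ≤ meanSize D :=
  mul_nonneg meanConst_pos.le (by positivity)

/-- A family of pairs `(ψ, ρ)` with `ψ ∈ Ψ*` and `ρ ∈ S(ψ)`. -/
def IsZeroFamily {D : ℕ} [NeZero D] (χ : DirichletCharacter ℂ D) (T : Finset (Chars × ℂ)) : Prop :=
  χ.IsQuadratic ∧ ∀ x ∈ T, x.1 ∈ PsiStar D χ ∧ x.2 ∈ zeroSet χ x.1.2

/-- For `0 ≤ y ≤ 1` the base satisfies `1 + δ - (1-y)² ≥ δ + y`, hence `ϖ₁(1-y) ≥ (δ+y)⁴/δ`. The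
saving `y²` in the mean square thus tames the singular weight, and what is left integrates to at
most `1`. -/
theorem sq_mul_varpi1_inv_le {D : ℕ} {d y : ℝ} (hd : 4 ≤ d) (hδ : 0 < delta D) (hy : 0 ≤ y) (hy1 : y ≤ 1) :
    0 ≤ (varpi1 D d (1 - y))⁻¹ ∧
    y ^ 2 * (varpi1 D d (1 - y))⁻¹ ≤ delta D * ((delta D + y) ^ 2)⁻¹ := by
  set δ := delta D with hδd
  have hb : δ + y ≤ 1 + δ - (1 - y) ^ 2 := by nlinarith
  have hb0 : 0 < δ + y := by linarith
  have hlow : (δ + y) ^ 4 / δ ≤ varpi1 D d (1 - y) := by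
    have e1 : (δ + y) ^ 4 / δ = δ ^ (3 : ℝ) * ((δ + y) / δ) ^ (4 : ℝ) := by
      rw [show (3 : ℝ) = (3 : ℕ) by norm_num, show (4 : ℝ) = (4 : ℕ) by norm_num,
        Real.rpow_natCast, Real.rpow_natCast]
      field_simp
    have e2 : δ ^ (3 - d) * (δ + y) ^ d = δ ^ (3 : ℝ) * ((δ + y) / δ) ^ d := by
      rw [Real.rpow_sub hδ, Real.div_rpow hb0.le hδ.le]
      ring
    rw [varpi1, ← hδd, e1]
    calc _ ≤ δ ^ (3 : ℝ) * ((δ + y) / δ) ^ d := by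
          gcongr
          rw [le_div_iff₀ hδ]
          linarith
      _ = δ ^ (3 - d) * (δ + y) ^ d := e2.symm
      _ ≤ _ := by gcongr
  have hpos : 0 < (δ + y) ^ 4 / δ := by positivity
  have hinv : 0 ≤ (varpi1 D d (1 - y))⁻¹ := inv_nonneg.mpr (hpos.le.trans hlow)
  refine ⟨hinv, ?_⟩
  calc y ^ 2 * (varpi1 D d (1 - y))⁻¹ ≤ (δ + y) ^ 2 * ((δ + y) ^ 4 / δ)⁻¹ :=
        mul_le_mul (pow_le_pow_left₀ hy (by linarith) 2) (inv_anti₀ hpos hlow) hinv (sq_nonneg _)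
    _ = _ := by field_simp

theorem integral_div_sq_le {δ b : ℝ} (hδ : 0 < δ) (hb : 0 ≤ b) :
    IntervalIntegrable (fun y => δ * ((δ + y) ^ 2)⁻¹) volume 0 b ∧
    ∫ y in (0 : ℝ)..b, δ * ((δ + y) ^ 2)⁻¹ ≤ 1 := by
  have hne : ∀ y ∈ Set.uIcc 0 b, δ + y ≠ 0 := by
    intro y hy
    rw [Set.uIcc_of_le hb] at hy
    have := hy.1
    positivity
  have hint : IntervalIntegrable (fun y => δ * ((δ + y) ^ 2)⁻¹) volume 0 b := by
    refine ContinuousOn.intervalIntegrable (ContinuousOn.mul continuousOn_const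
      (ContinuousOn.inv₀ (by fun_prop) fun y hy => pow_ne_zero 2 (hne y hy)))
  refine ⟨hint, ?_⟩
  rw [intervalIntegral.integral_eq_sub_of_hasDerivAt (f := fun y => -(δ * (δ + y)⁻¹)) _ hint]
  · have : 0 < δ * (δ + b)⁻¹ := by positivity
    rw [add_zero, mul_inv_cancel₀ hδ.ne']
    linarith
  · intro y hy
    have h1 : HasDerivAt (fun y => -(δ * (δ + y)⁻¹)) (-(δ * (-1 / (δ + y) ^ 2))) y :=
      (((hasDerivAt_id y).const_add δ).inv (hne y hy)).const_mul δ |>.neg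
    have e : -(δ * (-1 / (δ + y) ^ 2)) = δ * ((δ + y) ^ 2)⁻¹ := by ring
    rwa [e] at h1

variable {D : ℕ} [NeZero D] {χ : DirichletCharacter ℂ D} {ε : ℝ} {T : Finset (Chars × ℂ)}

theorem sum_dirPoly_le_of_le (h : Admissible D ε) (hT : IsZeroFamily χ T) {A B M : ℝ}
    (hB0 : 0 ≤ B) (hB : B ≤ Q D ^ (3 / 2 : ℝ)) {c : ℕ → ℝ} {w : ℕ → ℂ}
    (hM : ∑ n ∈ Finset.Ioc ⌊A⌋₊ ⌊B⌋₊, c n ^ 2 / n * ‖w n‖ ^ 2 ≤ M) :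
    ∑ x ∈ T, ‖dirPoly A B c w x.2 x.1.2‖ ^ 2 ≤ meanSize D * M :=
  (sum_dirPoly_le h.log_large h.logD_large hT.1 T hT.2 hB0 hB c w).trans
    (mul_le_mul_of_nonneg_left hM (meanSize_nonneg D))

theorem sum_dirPoly_one_sub_le_of_le (h : Admissible D ε) (hT : IsZeroFamily χ T) {A B M : ℝ}
    (hB0 : 0 ≤ B) (hB : B ≤ Q D ^ (3 / 2 : ℝ)) {c : ℕ → ℝ} {w : ℕ → ℂ}
    (hM : ∑ n ∈ Finset.Ioc ⌊A⌋₊ ⌊B⌋₊, c n ^ 2 / n * ‖w n‖ ^ 2 ≤ M) :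
    ∑ x ∈ T, ‖dirPoly A B c w (1 - x.2) x.1.2⁻¹‖ ^ 2 ≤ meanSize D * M :=
  (sum_dirPoly_one_sub_le h.log_large h.logD_large hT.1 T hT.2 hB0 hB c w).trans
    (mul_le_mul_of_nonneg_left hM (meanSize_nonneg D))

theorem Q_rpow_nonneg (D : ℕ) (b : ℝ) : 0 ≤ Q D ^ b := Real.rpow_nonneg (Q_pos D).le b

theorem sum_E1_le (h : Admissible D ε) (hT : IsZeroFamily χ T) :
    ∑ x ∈ T, E1 D ε x.2 x.1.2 ≤ meanSize D * (lamConst * weightConst ^ 2 *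
      (8 * (delta1 D * (64 * (R D ^ 2 * delta1 D ^ 2) + 1200 * R D ^ (2 / 3 : ℝ))))) := by
  set M := lamConst * weightConst ^ 2 *
      (64 * (R D ^ 2 * delta1 D ^ 2) + 1200 * R D ^ (2 / 3 : ℝ)) with hM
  have hδ := h.delta1_pos
  have hε := h.eps_pos
  have hεδ := h.le_delta1
  -- On both intervals of integration the argument is within `2 δ₁ + ε ≤ 3 δ₁` of `0`.
  have hz : ∀ z : ℝ, |z| ≤ 3 * delta1 D → ∑ x ∈ T, (‖calXplus D z x.2 x.1.2‖ ^ 2 +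
      ‖calXminus D z (1 - x.2) x.1.2⁻¹‖ ^ 2) ≤ meanSize D * M + meanSize D * M := by
    intro z hz
    rw [Finset.sum_add_distrib]
    exact add_le_add
      (sum_dirPoly_le_of_le h hT (Q_rpow_nonneg D _) le_rfl (sum_Xplus_le h hz))
      (sum_dirPoly_one_sub_le_of_le h hT (Q_pos D).le (Q_le D) (sum_Xminus_le h hz))
  simp only [E1]
  rw [Finset.sum_add_distrib]
  have h1 := sum_integral_le T (fun x y => ‖calXplus D (1 + ε - y) x.2 x.1.2‖ ^ 2 +
      ‖calXminus D (1 + ε - y) (1 - x.2) x.1.2⁻¹‖ ^ 2)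
    (fun _ => meanSize D * M + meanSize D * M) (a := 1 - 2 * delta1 D) (b := 1) (by linarith)
    (fun x _ y _ => by positivity)
    (fun y hy => hz _ (abs_le.mpr ⟨by linarith [hy.2], by linarith [hy.1]⟩)) (by simp)
  have h2 := sum_integral_le T (fun x y => ‖calXplus D (-1 + ε - y) x.2 x.1.2‖ ^ 2 +
      ‖calXminus D (-1 + ε - y) (1 - x.2) x.1.2⁻¹‖ ^ 2)
    (fun _ => meanSize D * M + meanSize D * M) (a := -1) (b := -1 + 2 * delta1 D) (by linarith)
    (fun x _ y _ => by positivity)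
    (fun y hy => hz _ (abs_le.mpr ⟨by linarith [hy.2], by linarith [hy.1]⟩)) (by simp)
  rw [intervalIntegral.integral_const, smul_eq_mul] at h1 h2
  refine (add_le_add h1 h2).trans (le_of_eq ?_)
  rw [hM]
  ring

theorem sum_E2_le (h : Admissible D ε) (hT : IsZeroFamily χ T) :
    ∑ x ∈ T, E2 D ε x.2 x.1.2 ≤ meanSize D * (ε⁻¹ * (2 * (lamConst * weightConst ^ 2 *
      (16 * ε ^ 2 + 48 * ((R D)⁻¹ ^ 2 * R D ^ (2 / 3 : ℝ)))) +
      2 * ((1 + 3 * lamConst) * weightConst ^ 2 * (4 * (R D)⁻¹ ^ 2)))) := by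
  have hε := h.eps_pos
  simp only [E2]
  rw [← Finset.mul_sum, Finset.sum_add_distrib, Finset.sum_add_distrib, Finset.sum_add_distrib]
  have h1 := sum_dirPoly_le_of_le h hT (Q_rpow_nonneg D _) le_rfl (sum_Y1_le h)
  have h2 := sum_dirPoly_one_sub_le_of_le h hT (Q_pos D).le (Q_le D) (sum_Y2_le h)
  have h3 := sum_dirPoly_le_of_le h hT (Q_rpow_nonneg D _) le_rfl (sum_Y3_le h)
  have h4 := sum_dirPoly_one_sub_le_of_le h hT (Q_pos D).le (Q_le D) (sum_Y4_le h)
  calc _ ≤ ε⁻¹ * (_ + _ + _ + _) :=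
        mul_le_mul_of_nonneg_left (add_le_add (add_le_add (add_le_add h1 h2) h3) h4) (by positivity)
    _ = _ := by ring

theorem sum_upsilonShape_le (h : Admissible D ε) (hT : IsZeroFamily χ T) {d a : ℝ} (hd : 4 ≤ d)
    (ha : |a| = alpha D) (w : ℕ → ℂ) (hw : ∀ n : ℕ, 1 ≤ n → ‖w n‖ ≤ weightConst) :
    ∑ x ∈ T, upsilonShape D d (fun A B => dirPoly (Q D ^ A) (Q D ^ B) (zetaQuotCoeff a) w x.2 x.1.2)
      ≤ meanSize D * (lamConst * weightConst ^ 2 * 4) := by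
  have hδ1 := h.delta1_pos
  have hδ12 := h.delta1_le
  have hδ : 0 < delta D := Real.rpow_pos_of_pos h.R_pos _
  set W := lamConst * weightConst ^ 2 with hW
  have hW0 : 0 ≤ W := mul_nonneg lamConst_nonneg (by positivity)
  have hm := meanSize_nonneg D
  set u : Chars × ℂ → ℝ → ℝ → ℂ :=
    fun x A B => dirPoly (Q D ^ A) (Q D ^ B) (zetaQuotCoeff a) w x.2 x.1.2 with hu
  have key : ∀ A b : ℝ, 0 ≤ A → 0 ≤ b → b ≤ 1 →
      ∑ x ∈ T, ‖u x A b‖ ^ 2 ≤ meanSize D * (W * b ^ 2) := fun A b hA hb hb1 =>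
    sum_dirPoly_le_of_le h hT (Q_rpow_nonneg D _)
      (Real.rpow_le_rpow_of_exponent_le (one_le_Q D) (by linarith))
      (sum_weight_le h ha hA hb (by linarith) w hw)
  have key1 : ∀ A b : ℝ, 0 ≤ A → 0 ≤ b → b ≤ 1 → ∑ x ∈ T, ‖u x A b‖ ^ 2 ≤ meanSize D * W :=
    fun A b hA hb hb1 => (key A b hA hb hb1).trans
      (mul_le_mul_of_nonneg_left (mul_le_of_le_one_right hW0 (pow_le_one₀ hb hb1)) hm)
  simp only [upsilonShape]
  rw [Finset.sum_add_distrib, Finset.sum_add_distrib, Finset.sum_add_distrib]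
  have h1 := key1 0 (delta1 D) le_rfl hδ1.le (by linarith)
  have h2 := key1 (delta1 D) 1 hδ1.le zero_le_one le_rfl
  obtain ⟨hint, hle⟩ := integral_div_sq_le hδ hδ1.le
  have h3 := sum_integral_le T (fun x y => ‖u x 0 y‖ ^ 2 * (varpi1 D d (1 - y))⁻¹)
    (fun y => meanSize D * W * (delta D * ((delta D + y) ^ 2)⁻¹)) hδ1.le
    (fun x _ y hy => mul_nonneg (sq_nonneg _)
      (sq_mul_varpi1_inv_le hd hδ hy.1 (by linarith [hy.2])).1)
    (fun y hy => by
      have hv := sq_mul_varpi1_inv_le hd hδ hy.1 (by linarith [hy.2])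
      rw [← Finset.sum_mul]
      calc _ ≤ meanSize D * (W * y ^ 2) * (varpi1 D d (1 - y))⁻¹ :=
            mul_le_mul_of_nonneg_right (key 0 y le_rfl hy.1 (by linarith [hy.2])) hv.1
        _ = meanSize D * W * (y ^ 2 * (varpi1 D d (1 - y))⁻¹) := by ring
        _ ≤ _ := mul_le_mul_of_nonneg_left hv.2 (mul_nonneg hm hW0)) (hint.const_mul _)
  rw [intervalIntegral.integral_const_mul] at h3
  have h3' := h3.trans (mul_le_of_le_one_right (mul_nonneg hm hW0) hle)
  have h4 := sum_integral_le T (fun x y => ‖u x (delta1 D) y‖ ^ 2) (fun _ => meanSize D * W)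
    (a := delta1 D) (b := 1) (by linarith) (fun x _ y _ => sq_nonneg _)
    (fun y hy => key1 (delta1 D) y hδ1.le (hδ1.le.trans hy.1) hy.2) (by simp)
  rw [intervalIntegral.integral_const, smul_eq_mul] at h4
  have h4' := h4.trans (mul_le_of_le_one_left (mul_nonneg hm hW0) (by linarith))
  calc _ ≤ meanSize D * W + meanSize D * W + meanSize D * W + meanSize D * W :=
        add_le_add (add_le_add (add_le_add h1 h2) h3') h4'
    _ = _ := by ring

theorem sum_UpsilonStar_le (h : Admissible D ε) (hT : IsZeroFamily χ T) :
    ∑ x ∈ T, UpsilonStar D ε x.2 x.1.2 ≤ meanSize D * (lamConst * weightConst ^ 2 * 5) := by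
  have hε := h.eps_pos
  have hε2 := h.le_delta1
  have hδ := h.delta1_le
  set W := lamConst * weightConst ^ 2 with hW
  have hW0 : 0 ≤ W := mul_nonneg lamConst_nonneg (by positivity)
  have hm := meanSize_nonneg D
  have key : ∀ A b : ℝ, 0 ≤ A → 0 ≤ b → b ≤ 3 / 2 →
      ∑ x ∈ T, ‖calUplus D A b x.2 x.1.2‖ ^ 2 ≤ meanSize D * (W * b ^ 2) := fun A b hA hb hb1 =>
    sum_dirPoly_le_of_le h hT (Q_rpow_nonneg D _)
      (Real.rpow_le_rpow_of_exponent_le (one_le_Q D) hb1)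
      (sum_weight_le h (abs_alpha h) hA hb hb1 (wPlus D) fun n => norm_wPlus_le h.one_le_logD)
  simp only [UpsilonStar]
  rw [Finset.sum_add_distrib, Finset.sum_add_distrib, ← Finset.mul_sum]
  have h1 := mul_le_mul_of_nonneg_left (key 0 ε le_rfl hε.le (by linarith))
    (inv_nonneg.mpr (sq_nonneg ε))
  have h2 := key 1 (3 / 2) zero_le_one (by norm_num) le_rfl
  have h3 := sum_integral_le T (fun x y => ‖calUplus D (1 + y) (3 / 2) x.2 x.1.2‖ ^ 2)
    (fun _ => meanSize D * (W * (3 / 2) ^ 2)) (a := 0) (b := 1 / 2) (by norm_num)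
    (fun x _ y _ => sq_nonneg _)
    (fun y hy => key (1 + y) (3 / 2) (by linarith [hy.1]) (by norm_num) le_rfl) (by simp)
  rw [intervalIntegral.integral_const, smul_eq_mul] at h3
  -- The factor `ε⁻²` in `Υ*` is exactly matched by the mean square over `1 < n ≤ Q^ε`.
  have e1 : (ε ^ 2)⁻¹ * (meanSize D * (W * ε ^ 2)) = meanSize D * W := by
    field_simp
  rw [e1] at h1
  have := mul_nonneg hm hW0
  refine (add_le_add (add_le_add h1 h2) h3).trans ?_
  linarith

theorem sum_Upsilon_le (h : Admissible D ε) (hT : IsZeroFamily χ T) {d : ℝ} (hd : 4 ≤ d) :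
    ∑ x ∈ T, Upsilon D d ε x.2 x.1.2 ≤ meanSize D * (lamConst * weightConst ^ 2 * 13) := by
  simp only [Upsilon]
  rw [Finset.sum_add_distrib, Finset.sum_add_distrib]
  have h1 := sum_upsilonShape_le h hT hd (abs_alpha h) (wPlus D)
    fun n => norm_wPlus_le h.one_le_logD
  have h2 := sum_upsilonShape_le h hT hd (abs_neg_alpha h) (wMinus D)
    fun n => norm_wMinus_le h.one_le_logD
  have h3 := sum_UpsilonStar_le h hT
  refine (add_le_add (add_le_add h1 h2) h3).trans (le_of_eq ?_)
  ring

/-- The constant of the final estimate, up to `meanConst`. -/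
noncomputable def errorConst : ℝ :=
  13 * (lamConst * weightConst ^ 2) +
    8 * (10112 * (lamConst * weightConst ^ 2) + weightConst ^ 2 * (152 * lamConst + 8))

theorem sum_E_le (h : Admissible D ε) (hT : IsZeroFamily χ T) {d : ℝ} (hd : 4 ≤ d)
    (hlog : 0 < Real.log (R D)) :
    ∑ x ∈ T, E D d ε x.2 x.1.2 ≤
      meanSize D * (errorConst * (R D ^ (-(1 / 12) : ℝ) * (Real.log (R D))⁻¹)) := by
  have hr1 := h.one_le_R
  have hm := meanSize_nonneg D
  have hε := h.eps_pos
  have hεδ := h.le_delta1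
  have hεr := h.R_inv_le
  have hU := sum_Upsilon_le h hT hd
  have hE1 := sum_E1_le h hT
  have hE2 := sum_E2_le h hT
  have hlam := lamConst_nonneg
  set r := R D with hr
  have hr0 : 0 < r := by linarith
  set W := lamConst * weightConst ^ 2 with hW
  have hW0 : 0 ≤ W := mul_nonneg lamConst_nonneg (by positivity)
  -- `2/9 = 8/9 - 2/3`: the tail `R^{2/3}` in `𝓔₁` times the length `δ₁`. Every other error term
  -- from `𝓔₁` and `𝓔₂` is dominated by it.
  set t := r ^ (-(2 / 9) : ℝ) with ht
  have ht0 : 0 < t := Real.rpow_pos_of_pos hr0 _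
  have hδ : delta1 D = r ^ (-(8 / 9) : ℝ) := rfl
  set X := r ^ (-(1 / 12) : ℝ) * (Real.log r)⁻¹ with hX
  have htX : t ≤ 8 * X := by
    -- The exponent is the room available, `5/36 = 2/9 - 1/12`, and `36/5 ≤ 8`.
    have h1 : Real.log r ≤ r ^ (5 / 36 : ℝ) / (5 / 36) := Real.log_le_rpow_div hr0.le (by norm_num)
    have h2 : t * r ^ (5 / 36 : ℝ) = r ^ (-(1 / 12) : ℝ) := by
      rw [ht, ← Real.rpow_add hr0]; norm_num
    have h3 : t * Real.log r ≤ 8 * r ^ (-(1 / 12) : ℝ) := by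
      rw [← h2]
      have : 0 < r ^ (5 / 36 : ℝ) := Real.rpow_pos_of_pos hr0 _
      nlinarith
    rw [hX, ← mul_assoc, ← div_eq_mul_inv, le_div_iff₀ hlog]
    exact h3
  have e1 : 8 * (delta1 D * (64 * (r ^ 2 * delta1 D ^ 2) + 1200 * r ^ (2 / 3 : ℝ))) ≤ 10112 * t := by
    have h1 : r ^ 2 * delta1 D ^ 2 ≤ r ^ (2 / 3 : ℝ) := by
      rw [hδ, ← Real.rpow_natCast (r ^ _), ← Real.rpow_mul hr0.le, ← Real.rpow_natCast r,
        ← Real.rpow_add hr0]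
      exact Real.rpow_le_rpow_of_exponent_le hr1 (by norm_num)
    have h2 : delta1 D * r ^ (2 / 3 : ℝ) = t := by
      rw [hδ, ← Real.rpow_add hr0, ht]; norm_num
    have h3 := mul_le_mul_of_nonneg_left h1 h.delta1_pos.le
    linarith
  have hεt : ε ≤ t := hεδ.trans (by
    rw [hδ]; exact Real.rpow_le_rpow_of_exponent_le hr1 (by norm_num))
  have hεinv : ε⁻¹ ≤ r := (inv_le_comm₀ hr0 hε).mp hεr
  -- Even the crude bound `ε⁻¹ ≤ R` leaves `R^{-1/3}`.
  have e2 : ε⁻¹ * (r⁻¹ ^ 2 * r ^ (2 / 3 : ℝ)) ≤ t := by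
    calc _ ≤ r * (r⁻¹ ^ 2 * r ^ (2 / 3 : ℝ)) := by gcongr
      _ = r ^ (-(1 / 3) : ℝ) := by
        rw [← Real.rpow_neg_one, ← Real.rpow_natCast, ← Real.rpow_mul hr0.le, ← Real.rpow_add hr0]
        nth_rewrite 1 [← Real.rpow_one r]
        rw [← Real.rpow_add hr0]
        norm_num
      _ ≤ t := Real.rpow_le_rpow_of_exponent_le hr1 (by norm_num)
  have e3 : ε⁻¹ * r⁻¹ ^ 2 ≤ t := by
    refine le_trans ?_ e2
    have : 1 ≤ r ^ (2 / 3 : ℝ) := Real.one_le_rpow hr1 (by norm_num)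
    gcongr
    exact le_mul_of_one_le_right (by positivity) this
  have e4 : ε⁻¹ * (2 * (W * (16 * ε ^ 2 + 48 * (r⁻¹ ^ 2 * r ^ (2 / 3 : ℝ)))) +
      2 * ((1 + 3 * lamConst) * weightConst ^ 2 * (4 * r⁻¹ ^ 2))) ≤
      weightConst ^ 2 * (152 * lamConst + 8) * t := by
    have h1 : ε⁻¹ * ε ^ 2 = ε := by field_simp
    have hV : 0 ≤ (1 + 3 * lamConst) * weightConst ^ 2 := by positivity
    calc _ = 32 * (W * (ε⁻¹ * ε ^ 2)) + 96 * (W * (ε⁻¹ * (r⁻¹ ^ 2 * r ^ (2 / 3 : ℝ)))) +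
          8 * ((1 + 3 * lamConst) * weightConst ^ 2 * (ε⁻¹ * r⁻¹ ^ 2)) := by ring
      _ ≤ 32 * (W * t) + 96 * (W * t) + 8 * ((1 + 3 * lamConst) * weightConst ^ 2 * t) := by
          rw [h1]
          gcongr
      _ = _ := by rw [hW]; ring
  have hX0 : 0 ≤ X := by positivity
  have e5 : 1 / (r ^ (1 / 12 : ℝ) * Real.log r) = X := by
    rw [hX, Real.rpow_neg hr0.le, one_div, mul_inv]
  simp only [E]
  rw [Finset.sum_add_distrib, Finset.sum_add_distrib, ← Finset.mul_sum, e5]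
  have f1 := mul_le_mul_of_nonneg_left hU hX0
  have f2 := hE1.trans (mul_le_mul_of_nonneg_left (mul_le_mul_of_nonneg_left e1 hW0) hm)
  have f3 := hE2.trans (mul_le_mul_of_nonneg_left e4 hm)
  calc _ ≤ X * (meanSize D * (W * 13)) + meanSize D * (W * (10112 * t)) +
        meanSize D * (weightConst ^ 2 * (152 * lamConst + 8) * t) :=
        add_le_add (add_le_add f1 f2) f3
    _ = meanSize D * (13 * W * X + (10112 * W + weightConst ^ 2 * (152 * lamConst + 8)) * t) := by
        ring
    _ ≤ meanSize D * (13 * W * X + (10112 * W + weightConst ^ 2 * (152 * lamConst + 8)) * (8 * X)) := by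
        gcongr
    _ = _ := by rw [errorConst, ← hW]; ring

end LandauSiegel

/-! ### Large `D`, and the conclusion. -/

namespace LandauSiegel

open Filter

theorem tendsto_logD : Tendsto logD atTop atTop :=
  Real.tendsto_log_atTop.comp tendsto_natCast_atTop_atTop

theorem tendsto_log_logD : Tendsto (fun D => Real.log (logD D)) atTop atTop :=
  Real.tendsto_log_atTop.comp tendsto_logD

theorem tendsto_R : Tendsto R atTop atTop := by
  have h : Tendsto (fun D => Real.log (logD D) / 30 + -(3 / 2 * Real.pi)) atTop atTop :=
    tendsto_atTop_add_const_right _ _ (tendsto_log_logD.atTop_div_const (by norm_num))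
  refine tendsto_atTop_mono (fun D => ?_) h
  have h1 := Int.lt_floor_add_one (Real.log (logD D) / (30 * Real.pi))
  have hpi := Real.pi_pos
  have h2 := mul_le_mul_of_nonneg_left h1.le hpi.le
  have h3 : Real.pi * (Real.log (logD D) / (30 * Real.pi)) = Real.log (logD D) / 30 := by
    field_simp
  rw [R]
  linarith

theorem eventually_log_le : ∀ᶠ D in atTop, 2000 * Real.log (logD D) ≤ logD D := by
  have h := (Real.isLittleO_log_id_atTop.bound (c := 1 / 2000) (by norm_num)).and
    (eventually_ge_atTop 1)
  refine (tendsto_logD.eventually h).mono fun D hD => ?_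
  obtain ⟨h1, h2⟩ := hD
  rw [Real.norm_of_nonneg (Real.log_nonneg h2), id, Real.norm_of_nonneg (by linarith)] at h1
  linarith

/-- Up to a relative error at most `1/2`, `ε` equals `R^{-11/12}`, which lies a factor `R^{1/12}`
above `R⁻¹` and a factor `R^{1/36}` below `δ₁ = R^{-8/9}`. -/
theorem admissible_of_large {D : ℕ} {ε K : ℝ} (h1 : 101 ≤ Real.log (logD D))
    (h2 : 2000 * Real.log (logD D) ≤ logD D) (hr : 1 ≤ R D)
    (hK : 2 * K ≤ R D ^ (1 / 12 : ℝ)) (h3 : 2 ≤ R D ^ (1 / 36 : ℝ))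
    (h4 : 12 ≤ R D ^ (8 / 9 : ℝ))
    (hε : |ε - R D ^ (-(11 / 12) : ℝ)| ≤ K * (R D)⁻¹) : Admissible D ε := by
  have hr0 : 0 < R D := by linarith
  obtain ⟨e1, e2⟩ := abs_le.mp hε
  have hinv : 0 < (R D)⁻¹ := inv_pos.mpr hr0
  have a1 : R D ^ (-(11 / 12) : ℝ) = (R D)⁻¹ * R D ^ (1 / 12 : ℝ) := by
    rw [← Real.rpow_neg_one, ← Real.rpow_add hr0]; norm_num
  have a2 : delta1 D = R D ^ (-(11 / 12) : ℝ) * R D ^ (1 / 36 : ℝ) := by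
    rw [delta1, ← Real.rpow_add hr0]; norm_num
  have a3 : K * (R D)⁻¹ ≤ R D ^ (-(11 / 12) : ℝ) / 2 := by
    rw [a1]; nlinarith
  have a4 : 2 ≤ R D ^ (1 / 12 : ℝ) :=
    h3.trans (Real.rpow_le_rpow_of_exponent_le hr (by norm_num))
  have a5 : 0 < R D ^ (-(11 / 12) : ℝ) := Real.rpow_pos_of_pos hr0 _
  refine ⟨h1, h2, hr, ?_, ?_, ?_⟩
  · have : 2 * (R D)⁻¹ ≤ R D ^ (-(11 / 12) : ℝ) := by rw [a1]; nlinarith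
    linarith
  · have : R D ^ (-(11 / 12) : ℝ) * 2 ≤ delta1 D := by
      rw [a2]; exact mul_le_mul_of_nonneg_left h3 a5.le
    linarith
  · rw [delta1, Real.rpow_neg hr0.le, one_div]
    exact inv_anti₀ (by norm_num) h4

theorem eventually_admissible (K : ℝ) : ∀ᶠ D in atTop, 0 < Real.log (R D) ∧
    ∀ ε : ℝ, |ε - R D ^ (-(11 / 12) : ℝ)| ≤ K * (R D)⁻¹ → Admissible D ε := by
  have hp : ∀ p : ℝ, 0 < p → Tendsto (fun D => R D ^ p) atTop atTop := fun p hp =>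
    (tendsto_rpow_atTop hp).comp tendsto_R
  filter_upwards [tendsto_log_logD.eventually_ge_atTop 101, eventually_log_le,
    tendsto_R.eventually_gt_atTop 1, (hp (1 / 12) (by norm_num)).eventually_ge_atTop (2 * K),
    (hp (1 / 36) (by norm_num)).eventually_ge_atTop 2,
    (hp (8 / 9) (by norm_num)).eventually_ge_atTop 12] with D h1 h2 h3 h4 h5 h6
  exact ⟨Real.log_pos h3, fun ε hε => admissible_of_large h1 h2 h3.le h4 h5 h6 hε⟩

-- A `finsum` with infinite support is `0` by convention; finiteness of the index sets makes the
-- double sum an honest one over pairs.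
open Classical in
theorem finsum_eq_sum_pairs {D : ℕ} [NeZero D] {χ : DirichletCharacter ℂ D}
    (h1 : (PsiStar D χ).Finite) (h2 : ∀ p ∈ PsiStar D χ, (zeroSet χ p.2).Finite)
    (f : Chars → ℂ → ℝ) : ∃ T : Finset (Chars × ℂ),
      (∀ x ∈ T, x.1 ∈ PsiStar D χ ∧ x.2 ∈ zeroSet χ x.1.2) ∧
      ∑ᶠ p ∈ PsiStar D χ, ∑ᶠ ρ ∈ zeroSet χ p.2, f p ρ = ∑ x ∈ T, f x.1 x.2 := by
  set Z : Chars → Finset ℂ := fun p =>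
    if h : (zeroSet χ p.2).Finite then h.toFinset else ∅ with hZ
  have hZmem : ∀ p ∈ PsiStar D χ, ∀ s, s ∈ Z p ↔ s ∈ zeroSet χ p.2 := fun p hp s => by
    simp only [hZ, dif_pos (h2 p hp), Set.Finite.mem_toFinset]
  have hmem : ∀ x : Chars × ℂ, x ∈ h1.toFinset.biUnion (fun p => (Z p).image (Prod.mk p)) ↔
      x.1 ∈ h1.toFinset ∧ x.2 ∈ Z x.1 := by
    rintro ⟨p, s⟩
    simp only [Finset.mem_biUnion, Finset.mem_image, Prod.mk.injEq]
    constructor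
    · rintro ⟨p', hp', s', hs', rfl, rfl⟩
      exact ⟨hp', hs'⟩
    · exact fun h => ⟨p, h.1, s, h.2, rfl, rfl⟩
  refine ⟨h1.toFinset.biUnion fun p => (Z p).image (Prod.mk p), fun x hx => ?_, ?_⟩
  rotate_right
  · rw [Finset.sum_finset_product _ _ _ hmem, finsum_mem_eq_finite_toFinset_sum _ h1]
    refine Finset.sum_congr rfl fun p hp => ?_
    have hp' := h1.mem_toFinset.mp hp
    rw [finsum_mem_eq_finite_toFinset_sum _ (h2 p hp')]
    simp only [hZ, dif_pos (h2 p hp')]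
  · obtain ⟨h3, h4⟩ := (hmem x).mp hx
    have h5 := h1.mem_toFinset.mp h3
    exact ⟨h5, (hZmem _ h5 _).mp h4⟩

end LandauSiegel

theorem proposition12p3 (d : ℝ) (hd : 425 ≤ d) (K : ℝ) :
    ∃ C : ℝ, ∃ D₀ : ℕ, ∀ (D : ℕ) [NeZero D] (χ : DirichletCharacter ℂ D) (ε : ℝ),
      D₀ ≤ D → χ.IsPrimitive → χ.IsQuadratic →
      |ε - LandauSiegel.R D ^ (-(11 / 12) : ℝ)| ≤ K * (LandauSiegel.R D)⁻¹ →
      (∃ m : ℤ, ε * LandauSiegel.R D = 2 * Real.pi * m) →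
      (LandauSiegel.PsiStar D χ).Finite ∧
      (∀ p ∈ LandauSiegel.PsiStar D χ, (LandauSiegel.zeroSet χ p.2).Finite) ∧
      LandauSiegel.totalE D χ d ε ≤
        C * (LandauSiegel.logD D ^ 2 * LandauSiegel.Q D ^ 2 *
          LandauSiegel.R D ^ (-(1 / 12) : ℝ) * (Real.log (LandauSiegel.R D))⁻¹) := by
  obtain ⟨D₀, hD₀⟩ := Filter.eventually_atTop.mp (LandauSiegel.eventually_admissible K)
  refine ⟨LandauSiegel.meanConst * LandauSiegel.errorConst, D₀,
    fun D _ χ ε hD _ hχ hε _ => ?_⟩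
  obtain ⟨hlog, hadm⟩ := hD₀ D hD
  have h := hadm ε hε
  have h1 := LandauSiegel.finite_PsiStar D χ
  have h2 : ∀ p ∈ LandauSiegel.PsiStar D χ, (LandauSiegel.zeroSet χ p.2).Finite := fun p hp =>
    LandauSiegel.finite_zeroSet h.log_large h.logD_large hχ hp
  refine ⟨h1, h2, ?_⟩
  obtain ⟨T, hT, hsum⟩ := LandauSiegel.finsum_eq_sum_pairs h1 h2
    fun p ρ => LandauSiegel.E D d ε ρ p.2
  rw [LandauSiegel.totalE, hsum]
  refine (LandauSiegel.sum_E_le h ⟨hχ, hT⟩ (by linarith) hlog).trans (le_of_eq ?_)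
  rw [LandauSiegel.meanSize]
  ring
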